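/- For $d\ge 1$ let $\mathcal F_d$ be the class of log-concave probability densities on $\mathbb R^d$, that is, densities $f$ with $f(\lambda x+(1-\lambda)y)\ge f(x)^{\lambda}f(y)^{1-\lambda}$ for all $x,y\in\mathbb R^d$ and $\lambda\in(0,1)$. An estimator from $n$ samples is a (jointly measurable) map $\bar f$ that sends each sample $(X_1,\dots,X_n)\in(\mathbb R^d)^n$ to a real-valued function on $\mathbb R^d$. Put $d_{\mathrm{TV}}(p,q)=\frac12\int_{\mathbb R^d}|p(x)-q(x)|\,dx\in[0,\infty]$ and $$\mathcal R_{\mathrm{TV}}(\bar f,\mathcal F_d)=\sup_{f\in\mathcal F_d}\mathbb E\, d_{\mathrm{TV}}\big(\bar f(X_1,\dots,X_n),f\big),$$ where $X_1,\dots,X_n$ are i.i.d. with density $f$. (i) For every $d\ge 2$ there are $C(d)>0$ and $N(d)$ such that for every $n\ge N(d)$ there is an estimator $\bar f_S$ from $n$ samples, whose values are probability densities, with $$\mathcal R_{\mathrm{TV}}(\bar f_S,\mathcal F_d)\le C(d)\,\log(n)^{\frac{d(d+1)}{d+4}}\,n^{-\frac{2}{d+4}}.$$ (ii) There is a universal constant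 $c>0$ such that for all $d\ge 2$ and all $n\ge 1$, $$\inf_{\bar f}\mathcal R_{\mathrm{TV}}(\bar f,\mathcal F_d)\ge c^{d}\,n^{-\frac{2}{d+4}},$$ where the infimum runs over all estimators from $n$ samples. -/

import Mathlib

open MeasureTheory
open scoped ENNReal

/-- `f` is a probability density on `ℝ^d` with respect to Lebesgue measure. -/
structure IsProbDensity {d : ℕ} (f : EuclideanSpace ℝ (Fin d) → ℝ) : Prop where
  aemeasurable : AEMeasurable f volume
  nonneg : ∀ x, 0 ≤ f x
  lintegral_eq_one : ∫⁻ x, ENNReal.ofReal (f x) = 1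

/-- The class of log-concave probability densities on `ℝ^d`. -/
def logConcaveDensities (d : ℕ) : Set (EuclideanSpace ℝ (Fin d) → ℝ) :=
  {f | IsProbDensity f ∧
    ∀ x y : EuclideanSpace ℝ (Fin d), ∀ t : ℝ, 0 < t → t < 1 →
      f x ^ t * f y ^ (1 - t) ≤ f (t • x + (1 - t) • y)}

/-- The total variation distance `(1/2) ∫ |p - q|`, with values in `[0, ∞]`. It is `∞` when
`p - q` is not integrable, which can only happen if `p` or `q` is not integrable. -/
noncomputable def tvDist {d : ℕ} (p q : EuclideanSpace ℝ (Fin d) → ℝ) : ℝ≥0∞ :=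
  (∫⁻ x, ENNReal.ofReal |p x - q x|) / 2

/-- The joint law of `n` independent observations drawn from the density `f`. -/
noncomputable def sampleLaw {d : ℕ} (n : ℕ) (f : EuclideanSpace ℝ (Fin d) → ℝ) :
    Measure (Fin n → EuclideanSpace ℝ (Fin d)) :=
  Measure.pi fun _ => volume.withDensity fun x => ENNReal.ofReal (f x)

/-- An estimator based on `n` observations in `ℝ^d`: a function that sends every `n`-sample to a
real-valued function on `ℝ^d`, jointly measurable in the sample and the point. Its values need
not be densities. -/
structure Estimator (d n : ℕ) where
  toFun : (Fin n → EuclideanSpace ℝ (Fin d)) → EuclideanSpace ℝ (Fin d) → ℝ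
  measurable_uncurry : Measurable (Function.uncurry toFun)

/-- The worst-case expected total variation error of an estimator over a class `F` of
densities. -/
noncomputable def riskTV {d n : ℕ} (est : Estimator d n)
    (F : Set (EuclideanSpace ℝ (Fin d) → ℝ)) : ℝ≥0∞ :=
  ⨆ f ∈ F, ∫⁻ X, tvDist (est.toFun X) f ∂(sampleLaw n f)

/-- The minimax total variation risk with `n` observations over a class `F` of densities. -/
noncomputable def minimaxRiskTV {d : ℕ} (n : ℕ)
    (F : Set (EuclideanSpace ℝ (Fin d) → ℝ)) : ℝ≥0∞ :=
  ⨅ est : Estimator d n, riskTV est F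

/-! Upper bound. The estimator is Yatracos' minimum distance estimator over a sieve: if the
comparison sets `{g' < g}` of the sieve have at most `S` traces on `2n` points, its risk is at most
three times the approximation error plus a multiple of `sqrt (log (2 S) / n)`, plus an arbitrarily
small slack (`exists_minimumDistance_estimator`). The sieve consists of densities `exp (min of k
affine functions)`, set to zero below a level (`cappedExp`). Whether one such function exceeds
another at a point is decided by signs of linear forms in the parameters, a space of dimension of
order `k d`, so Sauer-Shelah gives `log S` of order `d k log n` as long as `k ≤ n`
(`ncard_traces_cappedExp_le`, `log_cappedExpTraceBound_le`).

For the approximation error, an affine change of variables brings any log-concave density to a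
position controlled by `d` alone (`exists_normalizedLogConcave`). The sieve is affine invariant, so
the estimator never has to know this map. The hypograph of `log F`, truncated at height `-T`, is a
convex set in dimension `d + 1`. Dudley's argument approximates it to within order `ρ ^ 2` by about
`ρ ^ (-d)` half-spaces (`exists_normals_of_cubeFaceCell`), which become the affine pieces. The set
contains a ball, so this error is absorbed by a dilation of ratio `1 + η` with `η` of order `T ρ ^
2`, and costs `O(η)` in relative `L¹` norm; the truncation costs `O(exp (-T / 2))`.

Taking `η = n ^ (-2 / (d + 4))` and `T` of order `log n` gives `k` of order `(log n / η) ^ (d / 2)`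
and a stochastic error of order `(log n) ^ ((d + 2) / 4) * η`. The logarithmic exponent is at most
`d (d + 1) / (d + 4)` exactly because `(d - 2) (3 d + 4) ≥ 0`.

Lower bound. Start from a density on the unit cube that is a constant minus `b ‖x‖ ^ 2`. Subtracting
`b` times a bump `r ^ 2 - ‖x - c‖ ^ 2` on a small ball makes it affine there and preserves concavity
(`convexOn_norm_sq_add_sum_quadBump`). Bits that move each bump between two disjoint balls give a
hypercube of densities of total mass one. With `r` of order `n ^ (-1 / (d + 4))` neighbours cannot
be told apart from `n` samples, and a packing by about `r ^ (-d)` balls turns Assouad's lemma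
(`assouad_le_riskTV`) into a bound of order `r ^ 2`. -/

/-! ### Sign patterns of linear forms and Sauer-Shelah -/

/-- More than `dim W` forms satisfy a relation `∑ c i • ℓ i = 0` with some `c i > 0`. Shattering
supplies a `θ` at which exactly the forms with positive coefficient are positive; every term of the
relation is then nonnegative at `θ` and one is positive. -/
theorem Finset.Shatters.card_le_finrank {W κ : Type*} [AddCommGroup W] [Module ℝ W]
    [FiniteDimensional ℝ W] [DecidableEq κ] (ℓ : κ → Module.Dual ℝ W)
    {𝒜 : Finset (Finset κ)} (h𝒜 : ∀ t ∈ 𝒜, ∃ θ, ∀ i, i ∈ t ↔ 0 < ℓ i θ)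
    {s : Finset κ} (hs : 𝒜.Shatters s) : s.card ≤ Module.finrank ℝ W := by
  by_contra! hlt
  rw [← Subspace.dual_finrank_eq] at hlt
  obtain ⟨c, hc0, i, his, hci⟩ : ∃ c : κ → ℝ, (∑ i ∈ s, c i • ℓ i = 0) ∧
      ∃ i ∈ s, 0 < c i := by
    have hli : ¬ LinearIndependent ℝ (fun i : s => ℓ i) := fun h => by
      have := h.fintype_card_le_finrank
      rw [Fintype.card_coe] at this
      omega
    rw [Fintype.not_linearIndependent_iff] at hli
    obtain ⟨g, hg, i, hi⟩ := hli
    have key : ∀ g : s → ℝ, ∑ i, g i • ℓ i = 0 → 0 < g i →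
        ∃ c : κ → ℝ, (∑ i ∈ s, c i • ℓ i = 0) ∧ ∃ i ∈ s, 0 < c i := by
      intro g hg hi
      refine ⟨fun j => if h : j ∈ s then g ⟨j, h⟩ else 0, ?_, i, i.2, by simpa using hi⟩
      rw [← Finset.sum_coe_sort, ← hg]
      exact Finset.sum_congr rfl fun j _ => by simp
    rcases lt_or_gt_of_ne hi with h | h
    · refine key (-g) ?_ (by simpa using h)
      have h2 : ∑ i, (-g) i • ℓ ↑i = (-1 : ℝ) • ∑ i, g i • ℓ ↑i := by
        rw [Finset.smul_sum]
        exact Finset.sum_congr rfl fun j _ => by rw [smul_smul, Pi.neg_apply, neg_one_mul]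
      rw [h2, hg, smul_zero]
    · exact key g hg h
  obtain ⟨u, hu, hut⟩ := hs (Finset.filter_subset (fun j => 0 < c j) s)
  obtain ⟨θ, hθ⟩ := h𝒜 u hu
  have h0 : ∑ j ∈ s, c j * ℓ j θ = 0 := by
    have := congrArg (fun φ : Module.Dual ℝ W => φ θ) hc0
    simpa [LinearMap.sum_apply] using this
  have hiff : ∀ j ∈ s, (0 < c j ↔ 0 < ℓ j θ) := fun j hj => by
    have := Finset.ext_iff.1 hut j
    simp only [Finset.mem_inter, Finset.mem_filter, hj, true_and] at this
    rw [← this, hθ]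
  have hpos : 0 < ∑ j ∈ s, c j * ℓ j θ := by
    refine Finset.sum_pos' (fun j hj => ?_) ⟨i, his, mul_pos hci ((hiff i his).1 hci)⟩
    by_cases h : 0 < c j
    · exact (mul_pos h ((hiff j hj).1 h)).le
    · exact mul_nonneg_of_nonpos_of_nonpos (not_lt.1 h) (not_lt.1 fun h' => h ((hiff j hj).2 h'))
  exact hpos.ne' h0

theorem Nat.sum_Iic_choose_le (m D : ℕ) : ∑ i ∈ Finset.Iic D, m.choose i ≤ (m + 1) ^ D := by
  rw [add_pow, show Finset.Iic D = Finset.range (D + 1) by ext; simp]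
  refine Finset.sum_le_sum fun i hi => ?_
  have h1 : 1 ≤ D.choose i := Nat.choose_pos (by simpa [Nat.lt_succ_iff] using hi)
  calc m.choose i ≤ m ^ i := Nat.choose_le_pow m i
    _ ≤ m ^ i * 1 ^ (D - i) * D.choose i := by
      rw [one_pow, mul_one]; exact Nat.le_mul_of_pos_right _ h1

/-- The number of sign patterns of finitely many linear forms, by the Sauer-Shelah lemma. -/
theorem ncard_signPatterns_le {W κ : Type*} [AddCommGroup W] [Module ℝ W]
    [FiniteDimensional ℝ W] [Fintype κ] (ℓ : κ → Module.Dual ℝ W) :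
    (Set.range fun θ : W => {i | 0 < ℓ i θ}).ncard ≤
      (Fintype.card κ + 1) ^ Module.finrank ℝ W := by
  classical
  set 𝒜 : Finset (Finset κ) :=
    (Set.toFinite (Set.range fun θ : W => Finset.univ.filter fun i => 0 < ℓ i θ)).toFinset with h𝒜
  have h1 : ∀ t ∈ 𝒜, ∃ θ, ∀ i, i ∈ t ↔ 0 < ℓ i θ := by
    intro t ht
    rw [h𝒜, Set.Finite.mem_toFinset] at ht
    obtain ⟨θ, rfl⟩ := ht
    exact ⟨θ, by simp⟩
  have h2 : (Set.range fun θ : W => {i | 0 < ℓ i θ}) = (fun t : Finset κ => (t : Set κ)) '' 𝒜 := by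
    rw [h𝒜, Set.Finite.coe_toFinset, ← Set.range_comp]
    congr 1
    ext θ i
    simp
  rw [h2]
  refine (Set.ncard_image_le (Finset.finite_toSet _)).trans ?_
  rw [Set.ncard_coe_finset]
  have h3 : 𝒜.vcDim ≤ Module.finrank ℝ W :=
    Finset.sup_le fun s hs => (Finset.mem_shatterer.1 hs).card_le_finrank ℓ h1
  calc 𝒜.card ≤ 𝒜.shatterer.card := 𝒜.card_le_card_shatterer
    _ ≤ ∑ k ∈ Finset.Iic 𝒜.vcDim, (Fintype.card κ).choose k := Finset.card_shatterer_le_sum_vcDim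
    _ ≤ (Fintype.card κ + 1) ^ 𝒜.vcDim := Nat.sum_Iic_choose_le _ _
    _ ≤ _ := Nat.pow_le_pow_right (by omega) h3

/-! ### Rademacher sums and Massart's inequality -/

/-- The sign `±1` attached to a Boolean. -/
def boolSign (b : Bool) : ℝ := if b then 1 else -1

/-- The sum over signs factorizes over coordinates into `2 cosh (t b i)`, and `cosh y ≤ exp (y ^ 2 /
2)`. -/
theorem sum_exp_boolSign_le {n : ℕ} (b : Fin n → ℝ) (hb : ∀ i, |b i| ≤ 1) (t : ℝ) :
    ∑ σ : Fin n → Bool, Real.exp (t * ∑ i, boolSign (σ i) * b i) ≤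
      2 ^ n * Real.exp (n * t ^ 2 / 2) := by
  have h1 : ∀ σ : Fin n → Bool, Real.exp (t * ∑ i, boolSign (σ i) * b i) =
      ∏ i, Real.exp (t * (boolSign (σ i) * b i)) := fun σ => by
    rw [Finset.mul_sum, Real.exp_sum]
  simp_rw [h1]
  rw [← Fintype.piFinset_univ,
    ← Finset.prod_univ_sum (fun _ => Finset.univ) fun i s => Real.exp (t * (boolSign s * b i))]
  have h2 : ∀ i : Fin n, ∑ s : Bool, Real.exp (t * (boolSign s * b i)) ≤
      2 * Real.exp (t ^ 2 / 2) := fun i => by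
    have h3 : ∑ s : Bool, Real.exp (t * (boolSign s * b i)) = 2 * Real.cosh (t * b i) := by
      rw [Real.cosh_eq]
      simp [boolSign]
      ring
    rw [h3]
    have h4 := Real.cosh_le_exp_half_sq (t * b i)
    have h5 : (t * b i) ^ 2 ≤ t ^ 2 := by
      rw [mul_pow]
      have : b i ^ 2 ≤ 1 := by rw [sq_le_one_iff_abs_le_one]; exact hb i
      nlinarith [sq_nonneg t]
    have h6 : Real.exp ((t * b i) ^ 2 / 2) ≤ Real.exp (t ^ 2 / 2) := by gcongr
    linarith
  calc _ ≤ ∏ _i : Fin n, 2 * Real.exp (t ^ 2 / 2) :=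
        Finset.prod_le_prod (fun i _ => Finset.sum_nonneg fun _ _ => (Real.exp_pos _).le)
          fun i _ => h2 i
    _ = _ := by
      rw [Finset.prod_const, mul_pow, ← Real.exp_nat_mul]
      simp; ring

/-- Massart's finite maximal inequality for Rademacher sums. -/
theorem sum_signs_le_of_finite {n : ℕ} (hn : 0 < n) {V : Finset (Fin n → ℝ)} {S : ℕ} (hS : 0 < S)
    (hVS : V.card ≤ S) (hV : ∀ b ∈ V, ∀ i, |b i| ≤ 1) (B : (Fin n → Bool) → ℝ)
    (hB : ∀ σ, ∃ b ∈ V, B σ ≤ |∑ i, boolSign (σ i) * b i|) :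
    ∑ σ, B σ ≤ 2 ^ n * Real.sqrt (2 * n * Real.log (2 * S)) := by
  have hL : 0 < Real.log (2 * S) := Real.log_pos (by
    have : (1 : ℝ) ≤ S := by exact_mod_cast hS
    linarith)
  set L := Real.log (2 * S) with hLdef
  have hn' : (0 : ℝ) < n := by exact_mod_cast hn
  -- This `t` minimizes `L / t + n * t / 2`. The `2` in `L = log (2 S)` pays for the absolute value,
  -- through one exponential for each sign of the sum.
  set t := Real.sqrt (2 * L / n) with ht
  have ht0 : 0 < t := Real.sqrt_pos.2 (by positivity)
  have ht2 : t ^ 2 = 2 * L / n := Real.sq_sqrt (by positivity)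
  set c := L + n * t ^ 2 / 2 with hc
  have hc2 : c = 2 * L := by rw [hc, ht2]; field_simp; ring
  have key : ∑ σ, Real.exp (t * B σ) ≤ 2 ^ n * Real.exp c := by
    calc ∑ σ, Real.exp (t * B σ)
        ≤ ∑ σ : Fin n → Bool, ∑ b ∈ V, (Real.exp (t * ∑ i, boolSign (σ i) * b i) +
            Real.exp ((-t) * ∑ i, boolSign (σ i) * b i)) := by
          refine Finset.sum_le_sum fun σ _ => ?_
          obtain ⟨b, hb, hBb⟩ := hB σ
          refine le_trans ?_ (Finset.single_le_sum (f := fun b : Fin n → ℝ =>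
            Real.exp (t * ∑ i, boolSign (σ i) * b i) +
            Real.exp ((-t) * ∑ i, boolSign (σ i) * b i)) (fun _ _ => by positivity) hb)
          refine (Real.exp_le_exp.2 (mul_le_mul_of_nonneg_left hBb ht0.le)).trans ?_
          rcases abs_cases (∑ i, boolSign (σ i) * b i) with h | h <;> rw [h.1]
          · linarith [Real.exp_pos ((-t) * ∑ i, boolSign (σ i) * b i)]
          · rw [mul_neg, ← neg_mul]
            linarith [Real.exp_pos (t * ∑ i, boolSign (σ i) * b i)]
      _ = ∑ b ∈ V, ((∑ σ : Fin n → Bool, Real.exp (t * ∑ i, boolSign (σ i) * b i)) +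
            ∑ σ : Fin n → Bool, Real.exp ((-t) * ∑ i, boolSign (σ i) * b i)) := by
          rw [Finset.sum_comm]
          exact Finset.sum_congr rfl fun b _ => Finset.sum_add_distrib
      _ ≤ ∑ _b ∈ V, (2 ^ n * Real.exp (n * t ^ 2 / 2) + 2 ^ n * Real.exp (n * t ^ 2 / 2)) := by
          refine Finset.sum_le_sum fun b hb => add_le_add (sum_exp_boolSign_le b (hV b hb) t) ?_
          simpa using sum_exp_boolSign_le b (hV b hb) (-t)
      _ = V.card * (2 * (2 ^ n * Real.exp (n * t ^ 2 / 2))) := by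
          rw [Finset.sum_const, nsmul_eq_mul]; ring
      _ ≤ S * (2 * (2 ^ n * Real.exp (n * t ^ 2 / 2))) := by gcongr
      _ = 2 ^ n * Real.exp c := by
          rw [hc, Real.exp_add, hLdef, Real.exp_log (by positivity)]; ring
  -- `1 + y ≤ exp y`, applied to `y = t * B σ - c`, plays the role of Jensen's inequality.
  have h2 : ∑ σ, (t * B σ - c) ≤ 0 := by
    calc ∑ σ, (t * B σ - c) ≤ ∑ σ, (Real.exp (t * B σ) * Real.exp (-c) - 1) := by
          refine Finset.sum_le_sum fun σ _ => ?_
          rw [← Real.exp_add]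
          linarith [Real.add_one_le_exp (t * B σ + -c)]
      _ = (∑ σ, Real.exp (t * B σ)) * Real.exp (-c) - 2 ^ n := by
          rw [Finset.sum_sub_distrib, Finset.sum_mul]; simp
      _ ≤ 2 ^ n * Real.exp c * Real.exp (-c) - 2 ^ n := by gcongr
      _ = 0 := by rw [mul_assoc, ← Real.exp_add]; simp
  rw [Finset.sum_sub_distrib, ← Finset.mul_sum] at h2
  simp only [Finset.sum_const, Finset.card_univ, Fintype.card_pi, Fintype.card_bool,
    Finset.prod_const, Fintype.card_fin, nsmul_eq_mul, Nat.cast_pow, Nat.cast_ofNat] at h2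
  have h3 : t * Real.sqrt (2 * n * L) = 2 * L := by
    rw [ht, ← Real.sqrt_mul (by positivity),
      show 2 * L / n * (2 * n * L) = (2 * L) ^ 2 by field_simp]
    exact Real.sqrt_sq (by positivity)
  have h4 : t * ∑ σ, B σ ≤ t * (2 ^ n * Real.sqrt (2 * n * L)) := by
    rw [show t * (2 ^ n * Real.sqrt (2 * n * L)) = 2 ^ n * (t * Real.sqrt (2 * n * L)) by ring,
      h3, ← hc2]
    linarith
  exact le_of_mul_le_mul_left h4 ht0

/-! ### Empirical frequencies and symmetrization -/

/-- The empirical frequency of the set `A` in the sample `X`. -/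
noncomputable def empFreq {Ω : Type*} {n : ℕ} (A : Set Ω) (X : Fin n → Ω) : ℝ :=
  (∑ i, A.indicator (1 : Ω → ℝ) (X i)) / n

theorem empFreq_nonneg {Ω : Type*} {n : ℕ} (A : Set Ω) (X : Fin n → Ω) : 0 ≤ empFreq A X :=
  div_nonneg (Finset.sum_nonneg fun i _ => Set.indicator_nonneg (by simp) _) (by simp)

theorem empFreq_le_one {Ω : Type*} {n : ℕ} (A : Set Ω) (X : Fin n → Ω) : empFreq A X ≤ 1 := by
  refine div_le_one_of_le₀ ?_ (by simp)
  calc ∑ i, A.indicator (1 : Ω → ℝ) (X i) ≤ ∑ _i : Fin n, (1 : ℝ) :=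
        Finset.sum_le_sum fun i _ => Set.indicator_le_self' (by simp) _
    _ = n := by simp

section Symmetrization
variable {Ω : Type*} [MeasurableSpace Ω] {n : ℕ}

theorem measurable_empFreq {A : Set Ω} (hA : MeasurableSet A) :
    Measurable (empFreq A : (Fin n → Ω) → ℝ) := by
  unfold empFreq
  refine (Finset.measurable_sum _ fun i _ => ?_).div_const _
  exact (measurable_one.indicator hA).comp (measurable_pi_apply i)

theorem integrable_empFreq {A : Set Ω} (hA : MeasurableSet A) (ν : Measure (Fin n → Ω))
    [IsFiniteMeasure ν] : Integrable (empFreq A) ν :=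
  Integrable.of_bound (measurable_empFreq hA).aestronglyMeasurable 1 <| ae_of_all _ fun X => by
    rw [Real.norm_eq_abs, abs_of_nonneg (empFreq_nonneg A X)]
    exact empFreq_le_one A X

theorem integral_empFreq (hn : 0 < n) (μ : Measure Ω) [IsProbabilityMeasure μ] {A : Set Ω}
    (hA : MeasurableSet A) :
    ∫ X, empFreq A X ∂(Measure.pi fun _ : Fin n => μ) = μ.real A := by
  have hn' : (n : ℝ) ≠ 0 := by exact_mod_cast hn.ne'
  unfold empFreq
  rw [integral_div, integral_finsetSum]
  · have : ∀ i : Fin n, ∫ X, A.indicator (1 : Ω → ℝ) (X i) ∂(Measure.pi fun _ : Fin n => μ) =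
        μ.real A := fun i => by
      have h := measurePreserving_eval (fun _ : Fin n => μ) i
      have h2 := integral_map (μ := Measure.pi fun _ : Fin n => μ) h.measurable.aemeasurable
        (measurable_one.indicator hA : Measurable (A.indicator (1 : Ω → ℝ))).aestronglyMeasurable
      rw [h.map_eq, integral_indicator_one hA] at h2
      exact h2.symm
    simp only [this, Finset.sum_const, Finset.card_univ, Fintype.card_fin, nsmul_eq_mul]
    field_simp
  · intro i _
    refine Integrable.of_bound ((measurable_one.indicator hA).comp
      (measurable_pi_apply i)).aestronglyMeasurable 1 <| ae_of_all _ fun X => ?_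
    exact (norm_indicator_le_norm_self _ _).trans (by simp)

/-- Exchange the coordinates `X i` and `Y i` for which `σ i` is true. -/
def swapSigns (σ : Fin n → Bool) (p : (Fin n → Ω) × (Fin n → Ω)) :
    (Fin n → Ω) × (Fin n → Ω) :=
  (fun i => if σ i then p.1 i else p.2 i, fun i => if σ i then p.2 i else p.1 i)

theorem measurePreserving_swapSigns (μ : Measure Ω) [IsProbabilityMeasure μ] (σ : Fin n → Bool) :
    MeasurePreserving (swapSigns σ)
      ((Measure.pi fun _ : Fin n => μ).prod (Measure.pi fun _ : Fin n => μ))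
      ((Measure.pi fun _ : Fin n => μ).prod (Measure.pi fun _ : Fin n => μ)) := by
  have h1 := measurePreserving_arrowProdEquivProdArrow Ω Ω (Fin n) (fun _ => μ) (fun _ => μ)
  have h2 : MeasurePreserving (fun (z : Fin n → Ω × Ω) i => (if σ i then id else Prod.swap) (z i))
      (Measure.pi fun _ : Fin n => μ.prod μ) (Measure.pi fun _ : Fin n => μ.prod μ) := by
    refine measurePreserving_pi _ _ fun i => ?_
    by_cases h : σ i
    · simpa [h] using MeasurePreserving.id _
    · simpa [h] using Measure.measurePreserving_swap
  have h3 := (h1.comp h2).comp h1.symm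
  convert h3 using 1
  ext p i
  · by_cases h : σ i <;>
      simp [swapSigns, h, MeasurableEquiv.arrowProdEquivProdArrow, Equiv.arrowProdEquivProdArrow]
  · by_cases h : σ i <;>
      simp [swapSigns, h, MeasurableEquiv.arrowProdEquivProdArrow, Equiv.arrowProdEquivProdArrow]

/-- The uniform deviation of empirical frequencies over a finite family of sets is controlled by
the number of traces of the family on `2n` points. -/
theorem integral_iSup_empFreq_sub_le {J : Type*} [Finite J] [Nonempty J] (hn : 0 < n)
    (μ : Measure Ω) [IsProbabilityMeasure μ] {A : J → Set Ω} (hA : ∀ j, MeasurableSet (A j))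
    {S : ℕ} (hS : ∀ z : Fin n ⊕ Fin n → Ω, (Set.range fun j => {k | z k ∈ A j}).ncard ≤ S) :
    ∫ X, ⨆ j, |empFreq (A j) X - μ.real (A j)| ∂(Measure.pi fun _ : Fin n => μ) ≤
      Real.sqrt (2 * Real.log (2 * S) / n) := by
  classical
  have hn' : (0 : ℝ) < n := by exact_mod_cast hn
  set ν := Measure.pi fun _ : Fin n => μ with hν
  set G : (Fin n → Ω) × (Fin n → Ω) → ℝ :=
    fun p => ⨆ j, |empFreq (A j) p.1 - empFreq (A j) p.2| with hG
  have hGm : Measurable G := Measurable.iSup fun j =>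
    (((measurable_empFreq (hA j)).comp measurable_fst).sub
      ((measurable_empFreq (hA j)).comp measurable_snd)).abs
  have hb : ∀ {a b : ℝ}, 0 ≤ a → a ≤ 1 → 0 ≤ b → b ≤ 1 → |a - b| ≤ 1 := fun h1 h2 h3 h4 =>
    abs_sub_le_iff.2 ⟨by linarith, by linarith⟩
  have hG1 : ∀ p, ‖G p‖ ≤ 1 := fun p => by
    rw [Real.norm_eq_abs, abs_of_nonneg (Real.iSup_nonneg fun _ => abs_nonneg _)]
    exact ciSup_le fun j => hb (empFreq_nonneg _ _) (empFreq_le_one _ _) (empFreq_nonneg _ _)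
      (empFreq_le_one _ _)
  have hGi : Integrable G (ν.prod ν) :=
    Integrable.of_bound hGm.aestronglyMeasurable 1 (ae_of_all _ hG1)
  -- Ghost sample: the true probability is the mean of the frequency in an independent copy `Y`.
  have hsup : ∀ X, ⨆ j, |empFreq (A j) X - μ.real (A j)| ≤ ∫ Y, G (X, Y) ∂ν := fun X => by
    refine ciSup_le fun j => ?_
    have h1 : empFreq (A j) X - μ.real (A j) = ∫ Y, (empFreq (A j) X - empFreq (A j) Y) ∂ν := by
      rw [integral_sub (integrable_const _) (integrable_empFreq (hA j) ν),
        integral_empFreq hn μ (hA j)]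
      simp
    rw [h1]
    refine abs_integral_le_integral_abs.trans (integral_mono ?_ ?_ fun Y => ?_)
    · exact ((integrable_const _).sub (integrable_empFreq (hA j) ν)).abs
    · exact Integrable.of_bound (hGm.comp measurable_prodMk_left).aestronglyMeasurable 1
        (ae_of_all _ fun Y => hG1 _)
    · exact le_ciSup (f := fun j => |empFreq (A j) X - empFreq (A j) Y|)
        (Set.finite_range _).bddAbove j
  have hS0 : 0 < S := by
    obtain ⟨x⟩ : Nonempty Ω := nonempty_of_isProbabilityMeasure μ
    exact ((Set.ncard_pos (Set.finite_range _)).2 (Set.range_nonempty _)).trans_le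
      (hS fun _ => x)
  -- For a fixed pair of samples, swapping coordinates multiplies the differences of indicators by
  -- signs. The difference vectors are determined by the traces on the `2n` points, so there are at
  -- most `S` of them.
  have hmassart : ∀ p, ∑ σ : Fin n → Bool, G (swapSigns σ p) ≤
      2 ^ n * Real.sqrt (2 * Real.log (2 * S) / n) := by
    intro p
    set v : J → Fin n → ℝ := fun j i =>
      (A j).indicator (1 : Ω → ℝ) (p.1 i) - (A j).indicator (1 : Ω → ℝ) (p.2 i) with hv
    set V : Finset (Fin n → ℝ) := (Set.finite_range v).toFinset with hV
    have hVS : V.card ≤ S := by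
      rw [← Set.ncard_coe_finset, hV, Set.Finite.coe_toFinset]
      refine le_trans ?_ (hS (Sum.elim p.1 p.2))
      have : Set.range v = (fun (t : Set (Fin n ⊕ Fin n)) i =>
          t.indicator (1 : Fin n ⊕ Fin n → ℝ) (Sum.inl i) -
            t.indicator (1 : Fin n ⊕ Fin n → ℝ) (Sum.inr i)) ''
          (Set.range fun j => {k | Sum.elim p.1 p.2 k ∈ A j}) := by
        rw [← Set.range_comp]
        rfl
      rw [this]
      exact Set.ncard_image_le (Set.finite_range _)
    have hb1 : ∀ b ∈ V, ∀ i, |b i| ≤ 1 := by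
      intro b hb' i
      rw [hV, Set.Finite.mem_toFinset] at hb'
      obtain ⟨j, rfl⟩ := hb'
      exact hb (Set.indicator_nonneg (by simp) _) (Set.indicator_le_self' (by simp) _)
        (Set.indicator_nonneg (by simp) _) (Set.indicator_le_self' (by simp) _)
    have := sum_signs_le_of_finite hn hS0 hVS hb1 (fun σ => n * G (swapSigns σ p)) (by
      intro σ
      obtain ⟨j, hj⟩ := exists_eq_ciSup_of_finite
        (f := fun j => |empFreq (A j) (swapSigns σ p).1 - empFreq (A j) (swapSigns σ p).2|)
      refine ⟨v j, (Set.Finite.mem_toFinset _).2 ⟨j, rfl⟩, ?_⟩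
      rw [hG]
      simp only
      rw [← hj]
      unfold empFreq
      rw [← sub_div, abs_div, abs_of_pos hn', mul_div_cancel₀ _ hn'.ne', ← Finset.sum_sub_distrib]
      refine le_of_eq (congrArg _ (Finset.sum_congr rfl fun i _ => ?_))
      by_cases h : σ i <;> simp [swapSigns, boolSign, h, hv])
    rw [← Finset.mul_sum] at this
    have h5 : Real.sqrt (2 * n * Real.log (2 * S)) =
        n * Real.sqrt (2 * Real.log (2 * S) / n) := by
      rw [show 2 * n * Real.log (2 * S) = n ^ 2 * (2 * Real.log (2 * S) / n) by field_simp,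
        Real.sqrt_mul (by positivity), Real.sqrt_sq hn'.le]
    rw [h5] at this
    refine le_of_mul_le_mul_left ?_ hn'
    linarith
  calc ∫ X, ⨆ j, |empFreq (A j) X - μ.real (A j)| ∂ν ≤ ∫ X, ∫ Y, G (X, Y) ∂ν ∂ν := by
        refine integral_mono ?_ hGi.integral_prod_left hsup
        refine Integrable.of_bound (Measurable.iSup fun j =>
          ((measurable_empFreq (hA j)).sub_const _).abs).aestronglyMeasurable 1
          (ae_of_all _ fun X => ?_)
        rw [Real.norm_eq_abs, abs_of_nonneg (Real.iSup_nonneg fun _ => abs_nonneg _)]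
        exact ciSup_le fun j => hb (empFreq_nonneg _ _) (empFreq_le_one _ _) measureReal_nonneg
          measureReal_le_one
    _ = ∫ p, G p ∂(ν.prod ν) := (integral_prod _ hGi).symm
    _ = (∑ _σ : Fin n → Bool, ∫ p, G p ∂(ν.prod ν)) / 2 ^ n := by simp
    -- Swaps preserve the product law, so `G` may be replaced by its average over all of them.
    _ = (∑ σ : Fin n → Bool, ∫ p, G (swapSigns σ p) ∂(ν.prod ν)) / 2 ^ n := by
        congr 1
        refine Finset.sum_congr rfl fun σ _ => ?_
        have h := measurePreserving_swapSigns μ σ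
        rw [← h.map_eq, integral_map h.measurable.aemeasurable hGm.aestronglyMeasurable, h.map_eq]
    _ = (∫ p, ∑ σ : Fin n → Bool, G (swapSigns σ p) ∂(ν.prod ν)) / 2 ^ n := by
        rw [integral_finsetSum]
        exact fun σ _ => Integrable.of_bound
          (hGm.comp (measurePreserving_swapSigns μ σ).measurable).aestronglyMeasurable 1
          (ae_of_all _ fun p => hG1 _)
    _ ≤ (∫ _p, 2 ^ n * Real.sqrt (2 * Real.log (2 * S) / n) ∂(ν.prod ν)) / 2 ^ n := by
        refine div_le_div_of_nonneg_right (integral_mono (integrable_finsetSum _ fun σ _ =>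
          Integrable.of_bound (hGm.comp (measurePreserving_swapSigns μ σ).measurable
            ).aestronglyMeasurable 1 (ae_of_all _ fun p => hG1 _)) (integrable_const _) hmassart) ?_
        positivity
    _ = _ := by simp

end Symmetrization

/-! ### Total variation and the minimum distance estimator -/

section Yatracos
variable {d : ℕ}

theorem IsProbDensity.integrable {f : EuclideanSpace ℝ (Fin d) → ℝ} (hf : IsProbDensity f) :
    Integrable f := by
  refine ⟨hf.aemeasurable.aestronglyMeasurable, ?_⟩
  rw [hasFiniteIntegral_iff_ofReal (ae_of_all _ hf.nonneg), hf.lintegral_eq_one]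
  exact ENNReal.one_lt_top

theorem IsProbDensity.integral_eq_one {f : EuclideanSpace ℝ (Fin d) → ℝ} (hf : IsProbDensity f) :
    ∫ x, f x = 1 := by
  rw [integral_eq_lintegral_of_nonneg_ae (ae_of_all _ hf.nonneg)
    hf.aemeasurable.aestronglyMeasurable, hf.lintegral_eq_one, ENNReal.toReal_one]

theorem IsProbDensity.isProbabilityMeasure {f : EuclideanSpace ℝ (Fin d) → ℝ}
    (hf : IsProbDensity f) :
    IsProbabilityMeasure (volume.withDensity fun x => ENNReal.ofReal (f x)) :=
  ⟨by rw [withDensity_apply _ MeasurableSet.univ, setLIntegral_univ, hf.lintegral_eq_one]⟩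

theorem IsProbDensity.withDensity_real {f : EuclideanSpace ℝ (Fin d) → ℝ}
    (hf : IsProbDensity f) {A : Set (EuclideanSpace ℝ (Fin d))} (hA : MeasurableSet A) :
    (volume.withDensity fun x => ENNReal.ofReal (f x)).real A = ∫ x in A, f x := by
  rw [integral_eq_lintegral_of_nonneg_ae (ae_of_all _ hf.nonneg)
    hf.aemeasurable.aestronglyMeasurable.restrict, measureReal_def, withDensity_apply _ hA]

theorem tvDist_triangle {p q r : EuclideanSpace ℝ (Fin d) → ℝ} (hp : AEMeasurable p)
    (hq : AEMeasurable q) : tvDist p r ≤ tvDist p q + tvDist q r := by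
  unfold tvDist
  have h : AEMeasurable fun x => ENNReal.ofReal |p x - q x| := (hp.sub hq).abs.ennreal_ofReal
  rw [← ENNReal.add_div, ← lintegral_add_left' h]
  gcongr with x
  rw [← ENNReal.ofReal_add (abs_nonneg _) (abs_nonneg _)]
  exact ENNReal.ofReal_le_ofReal (abs_sub_le _ _ _)

theorem tvDist_eq_ofReal {p q : EuclideanSpace ℝ (Fin d) → ℝ} (hp : IsProbDensity p)
    (hq : IsProbDensity q) : tvDist p q = ENNReal.ofReal ((∫ x, |p x - q x|) / 2) := by
  have h : Integrable fun x => |p x - q x| := (hp.integrable.sub hq.integrable).abs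
  rw [tvDist, ENNReal.ofReal_div_of_pos (by norm_num),
    ofReal_integral_eq_lintegral_ofReal h (ae_of_all _ fun x => abs_nonneg _)]
  simp

/-- As `p - q` has integral zero, its integrals over `A` and over the complement have the same
absolute value, and the two add up to at most `∫ |p - q|`. Equality on `{q < p}` is the content of
the next lemma. -/
theorem ofReal_abs_setIntegral_sub_le_tvDist {p q : EuclideanSpace ℝ (Fin d) → ℝ}
    (hp : IsProbDensity p) (hq : IsProbDensity q) {A : Set (EuclideanSpace ℝ (Fin d))}
    (hA : MeasurableSet A) :
    ENNReal.ofReal |(∫ x in A, p x) - ∫ x in A, q x| ≤ tvDist p q := by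
  rw [tvDist_eq_ofReal hp hq]
  refine ENNReal.ofReal_le_ofReal ?_
  have hu := hp.integrable.sub hq.integrable
  have h1 : (∫ x in A, p x) - ∫ x in A, q x = ∫ x in A, (p - q) x :=
    (integral_sub hp.integrable.integrableOn hq.integrable.integrableOn).symm
  have h2 : (∫ x in A, (p - q) x) + ∫ x in Aᶜ, (p - q) x = 0 := by
    rw [integral_add_compl hA hu, integral_sub' hp.integrable hq.integrable, hp.integral_eq_one,
      hq.integral_eq_one, sub_self]
  have h3 : (∫ x in A, |(p - q) x|) + ∫ x in Aᶜ, |(p - q) x| = ∫ x, |p x - q x| :=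
    integral_add_compl hA hu.abs
  have h4 : |∫ x in A, (p - q) x| ≤ ∫ x in A, |(p - q) x| := abs_integral_le_integral_abs
  have h5 : |∫ x in Aᶜ, (p - q) x| ≤ ∫ x in Aᶜ, |(p - q) x| := abs_integral_le_integral_abs
  rw [h1]
  have h6 : |∫ x in Aᶜ, (p - q) x| = |∫ x in A, (p - q) x| := by
    rw [← abs_neg (∫ x in A, (p - q) x)]
    congr 1
    linarith
  linarith

theorem tvDist_le_ofReal_setIntegral_sub {p q : EuclideanSpace ℝ (Fin d) → ℝ}
    (hp : IsProbDensity p) (hq : IsProbDensity q) (hA : MeasurableSet {x | q x < p x}) :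
    tvDist p q ≤
      ENNReal.ofReal ((∫ x in {x | q x < p x}, p x) - ∫ x in {x | q x < p x}, q x) := by
  rw [tvDist_eq_ofReal hp hq]
  refine ENNReal.ofReal_le_ofReal ?_
  set A := {x | q x < p x}
  have hu := hp.integrable.sub hq.integrable
  have h1 : (∫ x in A, p x) - ∫ x in A, q x = ∫ x in A, (p - q) x :=
    (integral_sub hp.integrable.integrableOn hq.integrable.integrableOn).symm
  have h2 : (∫ x in A, (p - q) x) + ∫ x in Aᶜ, (p - q) x = 0 := by
    rw [integral_add_compl hA hu, integral_sub' hp.integrable hq.integrable, hp.integral_eq_one,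
      hq.integral_eq_one, sub_self]
  have h3 : (∫ x in A, |(p - q) x|) + ∫ x in Aᶜ, |(p - q) x| = ∫ x, |p x - q x| :=
    integral_add_compl hA hu.abs
  have h4 : ∫ x in A, |(p - q) x| = ∫ x in A, (p - q) x :=
    setIntegral_congr_fun hA fun x hx => abs_of_pos (sub_pos.2 hx)
  have h5 : ∫ x in Aᶜ, |(p - q) x| = ∫ x in Aᶜ, -(p - q) x :=
    setIntegral_congr_fun hA.compl fun x hx => abs_of_nonpos (sub_nonpos.2 (not_lt.1 hx))
  rw [integral_neg] at h5
  linarith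

/-- Expected uniform deviation of empirical frequencies over a countable family of sets. -/
theorem lintegral_iSup_empFreq_sub_le {Ω : Type*} [MeasurableSpace Ω] {n : ℕ} (hn : 0 < n)
    {J : Type*} [Countable J]
    (μ : Measure Ω) [IsProbabilityMeasure μ] {A : J → Set Ω} (hA : ∀ j, MeasurableSet (A j))
    {S : ℕ} (hS : ∀ z : Fin n ⊕ Fin n → Ω, (Set.range fun j => {k | z k ∈ A j}).ncard ≤ S) :
    ∫⁻ X, ⨆ j, ENNReal.ofReal |empFreq (A j) X - μ.real (A j)| ∂(Measure.pi fun _ : Fin n => μ) ≤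
      ENNReal.ofReal (Real.sqrt (2 * Real.log (2 * S) / n)) := by
  classical
  -- The suprema over finite subfamilies form a directed family, so monotone convergence reduces to
  -- the finite case, whose bound does not depend on the size of the subfamily.
  simp_rw [iSup_eq_iSup_finset (fun j => ENNReal.ofReal |empFreq (A j) _ - μ.real (A j)|)]
  have hm : ∀ j, Measurable fun X : Fin n → Ω => |empFreq (A j) X - μ.real (A j)| := fun j =>
    ((measurable_empFreq (hA j)).sub_const _).abs
  rw [lintegral_iSup_directed]
  · refine iSup_le fun s => ?_
    rcases s.eq_empty_or_nonempty with rfl | hs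
    · simp
    have : Nonempty s := hs.to_subtype
    have h1 := integral_iSup_empFreq_sub_le hn μ (A := fun j : s => A j) (fun j => hA j) (S := S)
      (fun z => (Set.ncard_le_ncard (by rintro _ ⟨j, rfl⟩; exact ⟨j, rfl⟩)
        (Set.toFinite _)).trans (hS z))
    refine le_trans ?_ (ENNReal.ofReal_le_ofReal h1)
    rw [ofReal_integral_eq_lintegral_ofReal]
    · refine lintegral_mono fun X => iSup₂_le fun j hj => ENNReal.ofReal_le_ofReal ?_
      exact le_ciSup (f := fun j : s => |empFreq (A j) X - μ.real (A j)|)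
        (Set.finite_range _).bddAbove ⟨j, hj⟩
    · refine Integrable.of_bound (Measurable.iSup fun j : s => hm j).aestronglyMeasurable 1
        (ae_of_all _ fun X => ?_)
      rw [Real.norm_eq_abs, abs_of_nonneg (Real.iSup_nonneg fun _ => abs_nonneg _)]
      refine ciSup_le fun j => abs_sub_le_iff.2 ⟨?_, ?_⟩
      · linarith [empFreq_le_one (A j) X, measureReal_nonneg (μ := μ) (s := A j)]
      · linarith [empFreq_nonneg (A j) X, measureReal_le_one (μ := μ) (s := A j)]
    · exact ae_of_all _ fun X => Real.iSup_nonneg fun _ => abs_nonneg _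
  · intro s
    exact (Measurable.iSup fun j => Measurable.iSup fun _ => (hm j).ennreal_ofReal).aemeasurable
  · intro s t
    refine ⟨s ∪ t, fun X => ?_, fun X => ?_⟩
    · exact biSup_mono fun j hj => Finset.mem_union_left _ hj
    · exact biSup_mono fun j hj => Finset.mem_union_right _ hj

/-- Yatracos' minimum distance estimator over a countable family of densities. -/
theorem exists_minimumDistance_estimator {n : ℕ} (hn : 0 < n)
    (g : ℕ → EuclideanSpace ℝ (Fin d) → ℝ) (hgm : ∀ i, Measurable (g i))
    (hg : ∀ i, IsProbDensity (g i)) {S : ℕ}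
    (hS : ∀ z : Fin n ⊕ Fin n → EuclideanSpace ℝ (Fin d),
      (Set.range fun p : ℕ × ℕ => {k | g p.2 (z k) < g p.1 (z k)}).ncard ≤ S)
    {η : ℝ} (hη : 0 < η) :
    ∃ est : Estimator d n, (∀ X, IsProbDensity (est.toFun X)) ∧
      ∀ f, IsProbDensity f → ∀ i,
        ∫⁻ X, tvDist (est.toFun X) f ∂(sampleLaw n f) ≤ 3 * tvDist (g i) f +
          2 * ENNReal.ofReal (Real.sqrt (2 * Real.log (2 * S) / n)) + ENNReal.ofReal η := by
  classical
  set A : ℕ × ℕ → Set (EuclideanSpace ℝ (Fin d)) := fun p => {x | g p.2 x < g p.1 x} with hAdef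
  have hA : ∀ p, MeasurableSet (A p) := fun p => measurableSet_lt (hgm _) (hgm _)
  set Δ : ℕ → (Fin n → EuclideanSpace ℝ (Fin d)) → ℝ≥0∞ := fun i X =>
    ⨆ p, ENNReal.ofReal |empFreq (A p) X - ∫ x in A p, g i x| with hΔ
  have hΔm : ∀ i, Measurable (Δ i) := fun i => Measurable.iSup fun p =>
    ((measurable_empFreq (hA p)).sub_const _).abs.ennreal_ofReal
  -- The infimum need not be attained; with slack `η`, choosing the least admissible index makes the
  -- selection measurable.
  have hex : ∀ X, ∃ i, Δ i X ≤ (⨅ k, Δ k X) + ENNReal.ofReal η := by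
    intro X
    by_cases h : (⨅ k, Δ k X) = ⊤
    · exact ⟨0, by rw [h]; simp⟩
    · obtain ⟨i, hi⟩ := iInf_lt_iff.1 (ENNReal.lt_add_right h (ENNReal.ofReal_pos.2 hη).ne')
      exact ⟨i, hi.le⟩
  set sel : (Fin n → EuclideanSpace ℝ (Fin d)) → ℕ := fun X => Nat.find (hex X) with hsel
  have hselm : Measurable sel := measurable_find hex fun i =>
    measurableSet_le (hΔm i) ((Measurable.iInf hΔm).add_const _)
  refine ⟨⟨fun X => g (sel X), ?_⟩, fun X => hg _, ?_⟩
  · have h1 : Measurable fun q : ℕ × EuclideanSpace ℝ (Fin d) => g q.1 q.2 :=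
      measurable_from_prod_countable_right hgm
    exact h1.comp ((hselm.comp measurable_fst).prodMk measurable_snd)
  · intro f hf i
    have := hf.isProbabilityMeasure
    set μ := volume.withDensity fun x => ENNReal.ofReal (f x) with hμ
    set V : (Fin n → EuclideanSpace ℝ (Fin d)) → ℝ≥0∞ := fun X =>
      ⨆ p, ENNReal.ofReal |empFreq (A p) X - μ.real (A p)| with hV
    have hΔi : ∀ X, Δ i X ≤ V X + tvDist (g i) f := fun X => iSup_le fun p => by
      calc ENNReal.ofReal |empFreq (A p) X - ∫ x in A p, g i x|
          ≤ ENNReal.ofReal (|empFreq (A p) X - μ.real (A p)| +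
              |(∫ x in A p, g i x) - ∫ x in A p, f x|) := by
            refine ENNReal.ofReal_le_ofReal ?_
            rw [hμ, hf.withDensity_real (hA p), abs_sub_comm (∫ x in A p, g i x)]
            exact abs_sub_le _ _ _
        _ ≤ _ := by
            rw [ENNReal.ofReal_add (abs_nonneg _) (abs_nonneg _)]
            exact add_le_add (le_iSup (fun p => ENNReal.ofReal |empFreq (A p) X - μ.real (A p)|) p)
              (ofReal_abs_setIntegral_sub_le_tvDist (hg i) hf (hA p))
    have hpt : ∀ X, tvDist (g (sel X)) f ≤
        2 * V X + (3 * tvDist (g i) f + ENNReal.ofReal η) := by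
      intro X
      have h1 : Δ (sel X) X ≤ Δ i X + ENNReal.ofReal η :=
        (Nat.find_spec (hex X)).trans (by gcongr; exact iInf_le _ i)
      -- The set `{g i < g (sel X)}` realizes the distance and belongs to the family tested by `Δ`;
      -- the empirical frequency serves as intermediate point.
      have h2 : tvDist (g (sel X)) (g i) ≤ Δ (sel X) X + Δ i X := by
        refine (tvDist_le_ofReal_setIntegral_sub (hg _) (hg i) (hA (sel X, i))).trans ?_
        refine le_trans ?_ (add_le_add (le_iSup (fun p =>
          ENNReal.ofReal |empFreq (A p) X - ∫ x in A p, g (sel X) x|) (sel X, i)) (le_iSup (fun p =>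
          ENNReal.ofReal |empFreq (A p) X - ∫ x in A p, g i x|) (sel X, i)))
        rw [← ENNReal.ofReal_add (abs_nonneg _) (abs_nonneg _)]
        refine ENNReal.ofReal_le_ofReal ?_
        have h3 := abs_sub_le (∫ x in A (sel X, i), g (sel X) x) (empFreq (A (sel X, i)) X)
          (∫ x in A (sel X, i), g i x)
        rw [abs_sub_comm _ (empFreq (A (sel X, i)) X)] at h3
        exact (le_abs_self _).trans h3
      calc tvDist (g (sel X)) f ≤ tvDist (g (sel X)) (g i) + tvDist (g i) f :=
            tvDist_triangle (hgm _).aemeasurable (hgm _).aemeasurable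
        _ ≤ ((Δ i X + ENNReal.ofReal η) + Δ i X) + tvDist (g i) f := by
          gcongr
          exact h2.trans (by gcongr)
        _ ≤ (((V X + tvDist (g i) f) + ENNReal.ofReal η) + (V X + tvDist (g i) f)) +
            tvDist (g i) f := by gcongr <;> exact hΔi X
        _ = _ := by ring
    calc ∫⁻ X, tvDist (g (sel X)) f ∂(sampleLaw n f)
        ≤ ∫⁻ X, (2 * V X + (3 * tvDist (g i) f + ENNReal.ofReal η)) ∂(sampleLaw n f) :=
          lintegral_mono hpt
      _ = 2 * ∫⁻ X, V X ∂(sampleLaw n f) + (3 * tvDist (g i) f + ENNReal.ofReal η) := by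
          have : IsProbabilityMeasure (sampleLaw n f) := by
            unfold sampleLaw; infer_instance
          rw [lintegral_add_right _ measurable_const, lintegral_const, measure_univ, mul_one,
            lintegral_const_mul' _ _ (by simp)]
      _ ≤ 2 * ENNReal.ofReal (Real.sqrt (2 * Real.log (2 * S) / n)) +
            (3 * tvDist (g i) f + ENNReal.ofReal η) := by
          gcongr
          exact lintegral_iSup_empFreq_sub_le hn μ hA hS
      _ = _ := by ring

end Yatracos

/-! ### The sieve of capped exponentials -/

section CappedExp
variable {d : ℕ} {ι : Type*}

/-- The affine function `x ↦ ⟪p.1, x⟫ + p.2`, as a linear form in its parameter `p`. -/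
noncomputable def affineEval (x : EuclideanSpace ℝ (Fin d)) :
    EuclideanSpace ℝ (Fin d) × ℝ →ₗ[ℝ] ℝ :=
  (innerₛₗ ℝ x).comp (LinearMap.fst ℝ _ _) + LinearMap.snd ℝ _ _

theorem affineEval_apply (x : EuclideanSpace ℝ (Fin d)) (p : EuclideanSpace ℝ (Fin d) × ℝ) :
    affineEval x p = inner ℝ x p.1 + p.2 := rfl

open Classical in
/-- The exponential of a minimum of finitely many affine functions, set to zero where this minimum
is below `b`. -/
noncomputable def cappedExp (a : ι → EuclideanSpace ℝ (Fin d) × ℝ) (b : ℝ)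
    (x : EuclideanSpace ℝ (Fin d)) : ℝ :=
  if ∀ j, b ≤ affineEval x (a j) then Real.exp (⨅ j, affineEval x (a j)) else 0

theorem continuous_affineEval (p : EuclideanSpace ℝ (Fin d) × ℝ) :
    Continuous fun x => affineEval x p := by
  simp only [affineEval_apply]
  fun_prop

theorem measurable_cappedExp [Finite ι] (a : ι → EuclideanSpace ℝ (Fin d) × ℝ) (b : ℝ) :
    Measurable (cappedExp a b) := by
  unfold cappedExp
  refine Measurable.ite ?_ (Measurable.iInf fun j => (continuous_affineEval _).measurable).exp
    measurable_const
  rw [Set.ofPred_forall]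
  exact MeasurableSet.iInter fun j =>
    measurableSet_le measurable_const (continuous_affineEval _).measurable

theorem cappedExp_nonneg (a : ι → EuclideanSpace ℝ (Fin d) × ℝ) (b : ℝ)
    (x : EuclideanSpace ℝ (Fin d)) : 0 ≤ cappedExp a b x := by
  unfold cappedExp
  split_ifs <;> positivity

/-- The right-hand side is a Boolean combination of conditions `0 < ℓ` with `ℓ` linear in the
parameters `(a, b, a', b')`, the form needed by `ncard_signPatterns_le`. The larger function must be
nonzero; the smaller one is either cut off or has an affine piece below all pieces of the larger. -/
theorem cappedExp_lt_iff [Finite ι] [Nonempty ι] (a a' : ι → EuclideanSpace ℝ (Fin d) × ℝ)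
    (b b' : ℝ) (x : EuclideanSpace ℝ (Fin d)) :
    cappedExp a' b' x < cappedExp a b x ↔ (∀ j, ¬ 0 < b - affineEval x (a j)) ∧
      ((∃ i, 0 < b' - affineEval x (a' i)) ∨
        ∃ i, ∀ j, 0 < affineEval x (a j) - affineEval x (a' i)) := by
  simp only [sub_pos, not_lt]
  by_cases h : ∀ j, b ≤ affineEval x (a j)
  · by_cases h' : ∀ j, b' ≤ affineEval x (a' j)
    · have hn : ¬ ∃ i, affineEval x (a' i) < b' := by push Not; exact h'
      simp only [cappedExp, h, h', implies_true, if_true, Real.exp_lt_exp, true_and, hn, false_or]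
      constructor
      · intro hlt
        obtain ⟨i, hi⟩ := exists_eq_ciInf_of_finite (f := fun i => affineEval x (a' i))
        refine ⟨i, fun j => ?_⟩
        rw [hi]
        exact hlt.trans_le (ciInf_le (Set.finite_range _).bddBelow j)
      · rintro ⟨i, hi⟩
        obtain ⟨j, hj⟩ := exists_eq_ciInf_of_finite (f := fun i => affineEval x (a i))
        rw [← hj]
        exact (ciInf_le (Set.finite_range _).bddBelow i).trans_lt (hi j)
    · have hn : ∃ i, affineEval x (a' i) < b' := by push Not at h'; exact h'
      simp only [cappedExp, h, h', implies_true, if_true, if_false, true_and, hn, true_or, iff_true]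
      exact Real.exp_pos _
  · simp only [cappedExp, h, if_false, false_and, iff_false, not_lt]
    split_ifs <;> positivity

/-- The densities of the form `cappedExp a b`. -/
def cappedExpDensities (d : ℕ) (ι : Type*) : Set (EuclideanSpace ℝ (Fin d) → ℝ) :=
  {g | IsProbDensity g ∧ ∃ a : ι → EuclideanSpace ℝ (Fin d) × ℝ, ∃ b, g = cappedExp a b}

/-- Each point of `K` contributes `k ^ 2` comparisons between pieces and `2 k` comparisons with the
two cut-off levels. The trace is a function of the resulting sign pattern, and the two parameter
systems together have dimension `2 (k (d + 1) + 1)`. -/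
theorem ncard_traces_cappedExp_le [Fintype ι] [Nonempty ι] {K J : Type*} [Fintype K]
    (z : K → EuclideanSpace ℝ (Fin d)) (g h : J → EuclideanSpace ℝ (Fin d) → ℝ)
    (hg : ∀ p, g p ∈ cappedExpDensities d ι) (hh : ∀ p, h p ∈ cappedExpDensities d ι) :
    (Set.range fun p => {k | h p (z k) < g p (z k)}).ncard ≤
      (Fintype.card K * (Fintype.card ι * Fintype.card ι + (Fintype.card ι + Fintype.card ι)) + 1) ^
        (2 * (Fintype.card ι * (d + 1) + 1)) := by
  classical
  choose hg1 a b ha using hg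
  choose hh1 a' b' ha' using hh
  set P := (ι → EuclideanSpace ℝ (Fin d) × ℝ) × ℝ
  set A : P × P →ₗ[ℝ] P := LinearMap.fst ℝ P P
  set A' : P × P →ₗ[ℝ] P := LinearMap.snd ℝ P P
  set ev : EuclideanSpace ℝ (Fin d) → ι → P →ₗ[ℝ] ℝ := fun x j =>
    (affineEval x).comp ((LinearMap.proj j).comp (LinearMap.fst ℝ _ _))
  set lv : P →ₗ[ℝ] ℝ := LinearMap.snd ℝ _ _
  set ℓ : K × ((ι × ι) ⊕ (ι ⊕ ι)) → Module.Dual ℝ (P × P) := fun q =>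
    match q.2 with
    | Sum.inl (i, j) => (ev (z q.1) j).comp A - (ev (z q.1) i).comp A'
    | Sum.inr (Sum.inl j) => lv.comp A - (ev (z q.1) j).comp A
    | Sum.inr (Sum.inr i) => lv.comp A' - (ev (z q.1) i).comp A'
  set dec : Set (K × ((ι × ι) ⊕ (ι ⊕ ι))) → Set K := fun s =>
    {k | (∀ j, ¬ (k, Sum.inr (Sum.inl j)) ∈ s) ∧ ((∃ i, (k, Sum.inr (Sum.inr i)) ∈ s) ∨
      ∃ i, ∀ j, (k, Sum.inl (i, j)) ∈ s)}
  have hsub : (Set.range fun p => {k | h p (z k) < g p (z k)}) ⊆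
      dec '' (Set.range fun θ : P × P => {i | 0 < ℓ i θ}) := by
    rintro _ ⟨p, rfl⟩
    refine ⟨_, ⟨((a p, b p), (a' p, b' p)), rfl⟩, ?_⟩
    ext k
    simp only [Set.mem_ofPred_eq]
    rw [ha p, ha' p, cappedExp_lt_iff]
    rfl
  refine (Set.ncard_le_ncard hsub (Set.toFinite _)).trans
    ((Set.ncard_image_le (Set.toFinite _)).trans ((ncard_signPatterns_le ℓ).trans ?_))
  refine le_of_eq ?_
  congr 1
  · simp
  · simp [P, Module.finrank_prod, Module.finrank_pi_fintype]
    ring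

theorem tvDist_eq_edist_toL1 {p q : EuclideanSpace ℝ (Fin d) → ℝ} (hp : Integrable p)
    (hq : Integrable q) : tvDist p q = edist (hp.toL1 p) (hq.toL1 q) / 2 := by
  rw [Integrable.edist_toL1_toL1, tvDist]
  simp_rw [edist_dist, Real.dist_eq]

/-- Subsets of the separable metric space `L¹` are separable. A countable sieve is what keeps the
suprema and the selection in the estimator measurable. -/
theorem exists_dense_sequence_of_densities {F : Set (EuclideanSpace ℝ (Fin d) → ℝ)}
    (hF : ∀ f ∈ F, IsProbDensity f) (hne : F.Nonempty) :
    ∃ g : ℕ → EuclideanSpace ℝ (Fin d) → ℝ, (∀ i, g i ∈ F) ∧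
      ∀ f ∈ F, ∀ ε : ℝ≥0∞, 0 < ε → ∃ i, tvDist (g i) f ≤ ε := by
  set Φ : F → (EuclideanSpace ℝ (Fin d) →₁[volume] ℝ) := fun f =>
    (hF f f.2).integrable.toL1 f with hΦ
  have : Nonempty F := hne.to_subtype
  have : Nonempty (Set.range Φ) := (Set.range_nonempty Φ).to_subtype
  have : Fact ((1 : ℝ≥0∞) ≠ ⊤) := ⟨by simp⟩
  have hsep : TopologicalSpace.SeparableSpace (Set.range Φ) := inferInstance
  choose φ hφ using fun i : ℕ => (TopologicalSpace.denseSeq (Set.range Φ) i).2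
  refine ⟨fun i => φ i, fun i => (φ i).2, fun f hf ε hε => ?_⟩
  obtain ⟨i, hi⟩ := (TopologicalSpace.denseRange_denseSeq (Set.range Φ)).exists_mem_open
    (Metric.isOpen_eball (x := (⟨Φ ⟨f, hf⟩, ⟨_, rfl⟩⟩ : Set.range Φ)) (ε := ε))
    ⟨_, Metric.mem_eball_self hε⟩
  refine ⟨i, ?_⟩
  rw [Metric.mem_eball, Subtype.edist_eq, ← hφ i] at hi
  rw [tvDist_eq_edist_toL1 (hF _ (φ i).2).integrable (hF f hf).integrable]
  exact (ENNReal.half_le_self).trans hi.le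

end CappedExp

/-! ### Dudley's approximation of convex bodies by half-spaces -/

section Dudley

theorem exists_abs_apply_ge {D : ℕ} (u : EuclideanSpace ℝ (Fin D)) (hu : ‖u‖ = 1) :
    ∃ i, 1 ≤ Real.sqrt D * |u i| := by
  by_contra! h
  have h1 : ‖u‖ ^ 2 = ∑ i, u i ^ 2 := EuclideanSpace.real_norm_sq_eq u
  rw [hu, one_pow] at h1
  have hne : (Finset.univ : Finset (Fin D)).Nonempty := by
    by_contra hne
    rw [Finset.not_nonempty_iff_eq_empty] at hne
    rw [hne] at h1
    simp at h1
  have h2 : ∑ i, (D : ℝ) * u i ^ 2 < ∑ _i : Fin D, 1 := by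
    refine Finset.sum_lt_sum_of_nonempty hne fun i _ => ?_
    have h3 : (Real.sqrt D * |u i|) ^ 2 < 1 := by
      rw [sq_lt_one_iff₀ (by positivity)]; exact h i
    rwa [mul_pow, Real.sq_sqrt (by positivity), sq_abs] at h3
  rw [← Finset.mul_sum, ← h1] at h2
  simp at h2

/-- A ray that starts in the cube `[-1,1]^D` leaves the cube `[-3,3]^D`. -/
theorem exists_ray_mem_boundary_cube {D : ℕ} (x u : EuclideanSpace ℝ (Fin D))
    (hx : ∀ i, |x i| ≤ 1) (hu : ‖u‖ = 1) :
    ∃ t : ℝ, 2 ≤ t ∧ t ≤ 4 * Real.sqrt D ∧ (∀ i, |x i + t * u i| ≤ 3) ∧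
      ∃ i, |x i + t * u i| = 3 := by
  obtain ⟨i, hi⟩ := exists_abs_apply_ge u hu
  set φ : ℝ → ℝ := fun t => ‖(fun i => x i + t * u i : Fin D → ℝ)‖ with hφ
  have hφc : Continuous φ := by
    refine continuous_norm.comp (continuous_pi fun i => ?_)
    fun_prop
  have h0 : φ 0 ≤ 3 := by
    refine (pi_norm_le_iff_of_nonneg (by norm_num)).2 fun i => ?_
    simp only [zero_mul, add_zero, Real.norm_eq_abs]
    linarith [hx i]
  -- Some coordinate of `u` is at least `1 / √D` in absolute value, so it has moved by at least `4`
  -- from a starting value in `[-1, 1]`.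
  have h1 : 3 ≤ φ (4 * Real.sqrt D) := by
    refine le_trans ?_ (norm_le_pi_norm _ i)
    have h2 : |4 * Real.sqrt D * u i| = 4 * (Real.sqrt D * |u i|) := by
      rw [abs_mul, abs_of_nonneg (by positivity : 0 ≤ 4 * Real.sqrt D)]; ring
    have h3 := abs_sub_abs_le_abs_sub (4 * Real.sqrt D * u i) (-x i)
    rw [abs_neg, sub_neg_eq_add, add_comm (4 * Real.sqrt D * u i)] at h3
    rw [Real.norm_eq_abs]
    linarith [hx i]
  obtain ⟨t, ht, hφt⟩ := intermediate_value_Icc (by positivity) hφc.continuousOn ⟨h0, h1⟩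
  have hle : ∀ i, |x i + t * u i| ≤ 3 := fun i => by
    rw [← hφt]
    exact norm_le_pi_norm (fun i => x i + t * u i : Fin D → ℝ) i
  have hex : ∃ i, |x i + t * u i| = 3 := by
    by_contra! hne
    have : φ t < 3 := (pi_norm_lt_iff (by norm_num)).2 fun i => lt_of_le_of_ne (hle i) (hne i)
    linarith
  refine ⟨t, ?_, ht.2, hle, hex⟩
  obtain ⟨j, hj⟩ := hex
  have h4 : |u j| ≤ 1 := by
    have := PiLp.norm_apply_le u j
    rwa [hu] at this
  have h5 := abs_add_le (x j) (t * u j)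
  rw [abs_mul, abs_of_nonneg ht.1] at h5
  nlinarith [hx j, ht.1]

/-- Labels of the grid cells on the boundary of a cube of dimension `d + 1`. -/
abbrev CubeFaceCell (d m : ℕ) : Type := Fin (d + 1) × Bool × (Fin d → Fin (m + 1))

theorem abs_sub_le_of_floor_eq {m : ℕ} (hm : 0 < m) {a b : ℝ} (ha : |a| ≤ 3) (hb : |b| ≤ 3)
    (h : ⌊(a + 3) * m / 6⌋₊ = ⌊(b + 3) * m / 6⌋₊) : |a - b| ≤ 6 / m := by
  have hm' : (0 : ℝ) < m := by exact_mod_cast hm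
  have ha' := abs_le.1 ha
  have hb' := abs_le.1 hb
  have h1 : 0 ≤ (a + 3) * m / 6 := by
    have : 0 ≤ a + 3 := by linarith
    positivity
  have h2 : 0 ≤ (b + 3) * m / 6 := by
    have : 0 ≤ b + 3 := by linarith
    positivity
  have h3 := Nat.floor_le h1
  have h4 := Nat.lt_floor_add_one ((a + 3) * m / 6)
  have h5 := Nat.floor_le h2
  have h6 := Nat.lt_floor_add_one ((b + 3) * m / 6)
  rw [h] at h3 h4
  rw [abs_sub_le_iff, le_div_iff₀ hm', le_div_iff₀ hm']
  constructor <;> nlinarith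

theorem exists_cubeFaceCell {d m : ℕ} (hm : 0 < m) :
    ∃ cell : EuclideanSpace ℝ (Fin (d + 1)) → CubeFaceCell d m, ∀ y y',
      (∀ i, |y i| ≤ 3) → (∃ i, |y i| = 3) → (∀ i, |y' i| ≤ 3) → (∃ i, |y' i| = 3) →
      cell y = cell y' → ‖y - y'‖ ≤ Real.sqrt (d + 1) * (6 / m) := by
  classical
  have hm' : (0 : ℝ) < m := by exact_mod_cast hm
  set face : EuclideanSpace ℝ (Fin (d + 1)) → Fin (d + 1) := fun y =>
    if h : ∃ i, |y i| = 3 then h.choose else 0 with hface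
  have hf : ∀ y : EuclideanSpace ℝ (Fin (d + 1)), (∃ i, |y i| = 3) →
      |y (face y)| = 3 := fun y h => by
    simp only [hface, h, dif_pos]
    exact h.choose_spec
  -- The cell records a face, its side, and the grid position of the other coordinates. The floor
  -- reaches the value `m` when a coordinate equals `3`, hence `m + 1` positions.
  refine ⟨fun y => (face y, decide (0 < y (face y)), fun j =>
    Fin.ofNat (m + 1) ⌊(y ((face y).succAbove j) + 3) * m / 6⌋₊), fun y y' hy hy3 hy' hy3' h => ?_⟩
  have h1 : face y = face y' := congrArg Prod.fst h
  have h2 : decide (0 < y (face y)) = decide (0 < y' (face y')) :=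
    congrArg (fun q => q.2.1) h
  have h3 := congrArg (fun q => q.2.2) h
  have hlt : ∀ y : EuclideanSpace ℝ (Fin (d + 1)), (∀ i, |y i| ≤ 3) → ∀ i,
      ⌊(y i + 3) * m / 6⌋₊ < m + 1 := fun y hy i => by
    refine Nat.lt_succ_of_le (Nat.floor_le_of_le ?_)
    have := (abs_le.1 (hy i)).2
    rw [div_le_iff₀ (by norm_num)]
    nlinarith
  have key : ∀ i, |y i - y' i| ≤ 6 / m := by
    intro i
    by_cases hi : i = face y
    · subst hi
      have e1 := hf y hy3
      have e2 := hf y' hy3'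
      rw [← h1] at e2 h2
      have : y (face y) = y' (face y) := by
        by_cases hp : 0 < y (face y)
        · have hp' : 0 < y' (face y) := by simpa [hp] using h2
          rw [abs_of_pos hp] at e1
          rw [abs_of_pos hp'] at e2
          rw [e1, e2]
        · have hp' : ¬ 0 < y' (face y) := by simpa [hp] using h2
          rw [abs_of_nonpos (not_lt.1 hp)] at e1
          rw [abs_of_nonpos (not_lt.1 hp')] at e2
          linarith
      rw [this, sub_self, abs_zero]
      positivity
    · obtain ⟨j, rfl⟩ := Fin.exists_succAbove_eq hi
      refine abs_sub_le_of_floor_eq hm (hy _) (hy' _) ?_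
      have h4 := congrArg Fin.val (congrFun h3 j)
      simp only [Fin.ofNat] at h4
      rw [Nat.mod_eq_of_lt (hlt y hy _), Nat.mod_eq_of_lt (hlt y' hy' _), ← h1] at h4
      exact h4
  rw [← Real.sqrt_sq (norm_nonneg (y - y')), EuclideanSpace.real_norm_sq_eq,
    ← Real.sqrt_sq (by positivity : (0 : ℝ) ≤ 6 / m), ← Real.sqrt_mul (by positivity)]
  refine Real.sqrt_le_sqrt ?_
  calc ∑ i, (y - y') i ^ 2 ≤ ∑ _i : Fin (d + 1), (6 / m : ℝ) ^ 2 := by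
        refine Finset.sum_le_sum fun i _ => ?_
        rw [← sq_abs ((y - y') i)]
        exact pow_le_pow_left₀ (abs_nonneg _) (key i) 2
    _ = _ := by simp

/-- Dudley's selection of boundary normals: a set of pairs (boundary point, outward unit normal) of
a convex body has a subset, indexed by the cells of a grid on the boundary of a cube, whose
half-spaces cut every normal ray off at a distance quadratic in the mesh of the grid. -/
theorem exists_normals_of_cubeFaceCell {d m : ℕ} (hm : 0 < m)
    {S : Set (EuclideanSpace ℝ (Fin (d + 1)) × EuclideanSpace ℝ (Fin (d + 1)))}
    (hne : S.Nonempty) (h1 : ∀ p ∈ S, ∀ i, |p.1 i| ≤ 1) (h2 : ∀ p ∈ S, ‖p.2‖ = 1)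
    (h3 : ∀ p ∈ S, ∀ q ∈ S, inner ℝ (q.1 - p.1) p.2 ≤ 0)
    {ρ : ℝ} (hρ : Real.sqrt (d + 1) * (6 / m) ≤ ρ) (hρ1 : ρ ≤ 1) :
    ∃ r : CubeFaceCell d m → EuclideanSpace ℝ (Fin (d + 1)) × EuclideanSpace ℝ (Fin (d + 1)),
      (∀ l, r l ∈ S) ∧ ∀ p ∈ S, ∃ l, ∀ h σ : ℝ, 0 ≤ h → 0 ≤ σ →
        inner ℝ (p.1 + h • p.2 - (r l).1) (r l).2 ≤ σ →
          h ≤ ρ ^ 2 + 4 * Real.sqrt (d + 1) * σ := by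
  classical
  obtain ⟨cell, hcell⟩ := exists_cubeFaceCell (d := d) hm
  choose! t ht2 ht4 htle htex using fun p (hp : p ∈ S) =>
    exists_ray_mem_boundary_cube p.1 p.2 (h1 p hp) (h2 p hp)
  set Y : EuclideanSpace ℝ (Fin (d + 1)) × EuclideanSpace ℝ (Fin (d + 1)) →
    EuclideanSpace ℝ (Fin (d + 1)) := fun p => p.1 + t p • p.2 with hY
  obtain ⟨p₀, hp₀⟩ := hne
  refine ⟨fun l => if h : ∃ p ∈ S, cell (Y p) = l then h.choose else p₀, fun l => ?_,
    fun p hp => ⟨cell (Y p), ?_⟩⟩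
  · dsimp only
    split_ifs with h
    · exact h.choose_spec.1
    · exact hp₀
  have hex : ∃ q ∈ S, cell (Y q) = cell (Y p) := ⟨p, hp, rfl⟩
  simp only [dif_pos hex]
  have hq := hex.choose_spec
  set q := hex.choose
  intro h σ hh hσ hle
  have hρ' : ‖Y q - Y p‖ ≤ ρ := (hcell (Y q) (Y p) (by simpa [hY] using htle q hq.1)
    (by simpa [hY] using htex q hq.1) (by simpa [hY] using htle p hp)
    (by simpa [hY] using htex p hp) hq.2).trans hρ
  set a := q.1 - p.1 with ha
  set b := t q • q.2 - t p • p.2 with hb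
  have hab : Y q - Y p = a + b := by simp only [hY, ha, hb]; abel
  rw [hab] at hρ'
  have hsq : ‖a + b‖ ^ 2 ≤ ρ ^ 2 := pow_le_pow_left₀ (norm_nonneg _) hρ' 2
  have hexp := norm_add_sq_real a b
  -- Monotonicity of the normal map of a convex set. Consequently `‖a + b‖ ≤ ρ` bounds `‖b‖` by `ρ`
  -- and `⟪a, b⟫` by `ρ ^ 2 / 4`; the latter is the source of the quadratic gain.
  have hpos : 0 ≤ inner ℝ a b := by
    have e1 := h3 p hp q hq.1
    have e2 := h3 q hq.1 p hp
    rw [show p.1 - q.1 = -a by rw [ha]; abel, inner_neg_left] at e2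
    rw [hb, inner_sub_right, inner_smul_right, inner_smul_right]
    nlinarith [ht2 p hp, ht2 q hq.1]
  have hquarter : inner ℝ a b ≤ ρ ^ 2 / 4 := by
    have := norm_sub_sq_real a b
    nlinarith [sq_nonneg ‖a - b‖]
  have hbρ : ‖b‖ ≤ ρ := by
    have h0 : 0 ≤ ρ := (norm_nonneg _).trans hρ'
    exact abs_le_of_sq_le_sq' (by nlinarith [sq_nonneg ‖a‖]) h0 |>.2
  -- The inner product is at least `t p - ‖b‖ ≥ 2 - 1`.
  have hup : 1 ≤ inner ℝ p.2 (t q • q.2) := by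
    have e1 : t q • q.2 = t p • p.2 + b := by rw [hb]; abel
    have e2 := abs_real_inner_le_norm p.2 b
    rw [h2 p hp, one_mul] at e2
    rw [e1, inner_add_right, inner_smul_right, real_inner_self_eq_norm_sq, h2 p hp]
    linarith [(abs_le.1 e2).1, ht2 p hp]
  have hle2 : inner ℝ (p.1 + h • p.2 - q.1) (t q • q.2) ≤ 4 * Real.sqrt (d + 1) * σ := by
    rw [inner_smul_right]
    have e1 : t q ≤ 4 * Real.sqrt (d + 1) := by
      have := ht4 q hq.1
      push_cast at this
      exact this
    have e2 := ht2 q hq.1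
    calc t q * inner ℝ (p.1 + h • p.2 - q.1) q.2 ≤ t q * σ :=
          mul_le_mul_of_nonneg_left hle (by linarith)
      _ ≤ _ := mul_le_mul_of_nonneg_right e1 hσ
  -- The first term on the right is at least `h`, the second loses at most `ρ ^ 2 / 4`, and the
  -- third helps since `⟪a, p.2⟫ ≤ 0`.
  have hdec : inner ℝ (p.1 + h • p.2 - q.1) (t q • q.2) =
      h * inner ℝ p.2 (t q • q.2) - inner ℝ a b - t p * inner ℝ a p.2 := by
    rw [show p.1 + h • p.2 - q.1 = h • p.2 - a by rw [ha]; abel, inner_sub_left, inner_smul_left,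
      show inner ℝ a b = inner ℝ a (t q • q.2) - inner ℝ a (t p • p.2) by
        rw [hb, inner_sub_right], inner_smul_right (𝕜 := ℝ) a p.2]
    simp only [conj_trivial]
    ring
  have hap : inner ℝ a p.2 ≤ 0 := h3 p hp q hq.1
  nlinarith [ht2 p hp, sq_nonneg ρ]

end Dudley

/-! ### From hypographs to affine pieces -/

section Hypograph
variable {d : ℕ}

/-- A log-concave function in normalized position: bounded by one, bounded below by `exp (-1)` on a
ball, with exponential decay at an absolute rate. -/
structure NormalizedLogConcave (c : EuclideanSpace ℝ (Fin d)) (r : ℝ)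
    (F : EuclideanSpace ℝ (Fin d) → ℝ) : Prop where
  nonneg : ∀ x, 0 ≤ F x
  le_one : ∀ x, F x ≤ 1
  logConcave : ∀ x y : EuclideanSpace ℝ (Fin d), ∀ t : ℝ, 0 < t → t < 1 →
      F x ^ t * F y ^ (1 - t) ≤ F (t • x + (1 - t) • y)
  core : ∀ x, ‖x - c‖ ≤ r → Real.exp (-1) ≤ F x
  decay : ∀ x i, F x ≤ Real.exp (1 - |x i| / 8)

/-- The point of `ℝ^(d+1)` with first coordinate `t` and remaining coordinates `x`. -/
noncomputable def consPoint (t : ℝ) (x : EuclideanSpace ℝ (Fin d)) :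
    EuclideanSpace ℝ (Fin (d + 1)) := WithLp.toLp 2 (Fin.cons t x)

/-- The point of `ℝ^d` obtained by deleting the first coordinate. -/
noncomputable def tailPoint (p : EuclideanSpace ℝ (Fin (d + 1))) : EuclideanSpace ℝ (Fin d) :=
  WithLp.toLp 2 fun i => p i.succ

@[simp] theorem consPoint_zero (t : ℝ) (x : EuclideanSpace ℝ (Fin d)) : consPoint t x 0 = t := rfl

@[simp] theorem tailPoint_consPoint (t : ℝ) (x : EuclideanSpace ℝ (Fin d)) :
    tailPoint (consPoint t x) = x := rfl

theorem tailPoint_add (p q : EuclideanSpace ℝ (Fin (d + 1))) :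
    tailPoint (p + q) = tailPoint p + tailPoint q := rfl

theorem tailPoint_sub (p q : EuclideanSpace ℝ (Fin (d + 1))) :
    tailPoint (p - q) = tailPoint p - tailPoint q := rfl

theorem tailPoint_smul (c : ℝ) (p : EuclideanSpace ℝ (Fin (d + 1))) :
    tailPoint (c • p) = c • tailPoint p := rfl

theorem inner_eq_add_tailPoint (p q : EuclideanSpace ℝ (Fin (d + 1))) :
    inner ℝ p q = p 0 * q 0 + inner ℝ (tailPoint p) (tailPoint q) := by
  simp only [PiLp.inner_apply, Fin.sum_univ_succ, tailPoint]
  simp [mul_comm]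

theorem norm_tailPoint_le (p : EuclideanSpace ℝ (Fin (d + 1))) : ‖tailPoint p‖ ≤ ‖p‖ := by
  have h := inner_eq_add_tailPoint p p
  rw [real_inner_self_eq_norm_sq, real_inner_self_eq_norm_sq] at h
  exact (abs_le_of_sq_le_sq' (by nlinarith [mul_self_nonneg (p 0)]) (norm_nonneg _)).2

/-- The truncated hypograph of `log F`, rescaled by `R`. -/
def logHypograph (F : EuclideanSpace ℝ (Fin d) → ℝ) (R T : ℝ) :
    Set (EuclideanSpace ℝ (Fin (d + 1))) :=
  {p | -T ≤ R * p 0 ∧ Real.exp (R * p 0) ≤ F (R • tailPoint p)}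

variable {F : EuclideanSpace ℝ (Fin d) → ℝ} {c : EuclideanSpace ℝ (Fin d)} {r R T : ℝ}

theorem convex_logHypograph (hF : NormalizedLogConcave c r F) :
    Convex ℝ (logHypograph F R T) := by
  rw [convex_iff_forall_pos]
  rintro p ⟨hp1, hp2⟩ q ⟨hq1, hq2⟩ s t hs ht hst
  obtain rfl : t = 1 - s := by linarith
  refine ⟨?_, ?_⟩
  · simp only [PiLp.add_apply, PiLp.smul_apply, smul_eq_mul]
    nlinarith
  · refine le_trans ?_ (le_trans (hF.logConcave (R • tailPoint p) (R • tailPoint q) s hs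
      (by linarith)) (le_of_eq ?_))
    · rw [show R * (s • p + (1 - s) • q) 0 = R * p 0 * s + R * q 0 * (1 - s) by
        simp only [PiLp.add_apply, PiLp.smul_apply, smul_eq_mul]; ring, Real.exp_add,
        Real.exp_mul (R * p 0), Real.exp_mul (R * q 0)]
      gcongr
      exact Real.rpow_nonneg (hF.nonneg _) _
    · congr 1
      rw [tailPoint_add, tailPoint_smul, tailPoint_smul, smul_add, smul_comm R, smul_comm R]

theorem apply_zero_nonpos_of_mem (hF : NormalizedLogConcave c r F) (hR : 0 < R)
    {p : EuclideanSpace ℝ (Fin (d + 1))} (hp : p ∈ logHypograph F R T) : p 0 ≤ 0 := by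
  have h := hp.2.trans (hF.le_one _)
  rw [Real.exp_le_one_iff] at h
  exact nonpos_of_mul_nonpos_right h hR

/-- Where `F ≥ exp (-T)`, the decay confines unscaled space coordinates to `8 (T + 1) ≤ 16 T`, which
is why the scale is `16 T`. -/
theorem abs_apply_le_one_of_mem (hF : NormalizedLogConcave c r F) (hT : 1 ≤ T)
    {p : EuclideanSpace ℝ (Fin (d + 1))} (hp : p ∈ logHypograph F (16 * T) T) (i : Fin (d + 1)) :
    |p i| ≤ 1 := by
  have hR : 0 < 16 * T := by linarith
  have h0 := apply_zero_nonpos_of_mem hF hR hp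
  obtain ⟨h1, h2⟩ := hp
  refine Fin.cases ?_ (fun j => ?_) i
  · rw [abs_le]
    exact ⟨by nlinarith, by linarith⟩
  · have h3 := (Real.exp_le_exp.2 h1).trans (h2.trans (hF.decay _ j))
    rw [Real.exp_le_exp] at h3
    have h4 : |((16 * T) • tailPoint p) j| = 16 * T * |p j.succ| := by
      rw [PiLp.smul_apply, smul_eq_mul, abs_mul, abs_of_pos hR]
      rfl
    rw [h4] at h3
    by_contra! h5
    nlinarith

/-- Replacing the height by its minimum with `s` is a continuous map of the hypograph into itself,
hence also of its closure. -/
theorem mem_closure_of_lower_apply_zero (hR : 0 < R) {s : ℝ}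
    (hs : -T ≤ R * s) {p : EuclideanSpace ℝ (Fin (d + 1))} (hp : p ∈ closure (logHypograph F R T))
    (hsp : s ≤ p 0) : p + (s - p 0) • EuclideanSpace.single 0 1 ∈ closure (logHypograph F R T) := by
  set Ψ : EuclideanSpace ℝ (Fin (d + 1)) → EuclideanSpace ℝ (Fin (d + 1)) :=
    fun p => p + (min s (p 0) - p 0) • EuclideanSpace.single 0 1 with hΨ
  have hc : Continuous Ψ := by
    have : Continuous fun p : EuclideanSpace ℝ (Fin (d + 1)) => p 0 := by fun_prop
    exact continuous_id.add (((continuous_const.min this).sub this).smul continuous_const)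
  have hm : Set.MapsTo Ψ (logHypograph F R T) (logHypograph F R T) := by
    intro q hq
    have h0 : (Ψ q) 0 = min s (q 0) := by simp [hΨ]
    have ht : tailPoint (Ψ q) = tailPoint q := by
      ext i
      simp [hΨ, tailPoint]
    refine ⟨?_, ?_⟩
    · rw [h0]
      rcases min_choice s (q 0) with h | h <;> rw [h]
      · exact hs
      · exact hq.1
    · rw [h0, ht]
      refine le_trans (Real.exp_le_exp.2 ?_) hq.2
      exact mul_le_mul_of_nonneg_left (min_le_right _ _) hR.le
  have := map_mem_closure hc hp hm
  simpa [hΨ, min_eq_left hsp] using this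

/-- Boundary points of a set with outward unit normals whose first coordinate is nonnegative. -/
def upwardNormals (K : Set (EuclideanSpace ℝ (Fin (d + 1)))) :
    Set (EuclideanSpace ℝ (Fin (d + 1)) × EuclideanSpace ℝ (Fin (d + 1))) :=
  {p | p.1 ∈ K ∧ ‖p.2‖ = 1 ∧ 0 ≤ p.2 0 ∧ ∀ q ∈ K, inner ℝ (q - p.1) p.2 ≤ 0}

/-- The normal is the direction from the metric projection `x` to `p`. Were it to point downwards,
lowering `x` to the height of `p` would stay in the set and contradict the variational inequality
for the projection. -/
theorem exists_upwardNormal (hF : NormalizedLogConcave c r F) (hR : 0 < R)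
    (hne : (logHypograph F R T).Nonempty) {p : EuclideanSpace ℝ (Fin (d + 1))}
    (hp0 : -T ≤ R * p 0) (hp : p ∉ closure (logHypograph F R T)) :
    ∃ q ∈ upwardNormals (closure (logHypograph F R T)), ∃ h : ℝ, 0 < h ∧ p = q.1 + h • q.2 := by
  have hconv := (convex_logHypograph (R := R) (T := T) hF).closure
  obtain ⟨x, hx, hmin⟩ := exists_norm_eq_iInf_of_complete_convex hne.closure
    isClosed_closure.isComplete hconv p
  rw [norm_eq_iInf_iff_real_inner_le_zero hconv hx] at hmin
  have hne' : p - x ≠ 0 := fun h => hp (by rw [sub_eq_zero.1 h]; exact hx)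
  have hpos : 0 < ‖p - x‖ := norm_pos_iff.2 hne'
  refine ⟨(x, ‖p - x‖⁻¹ • (p - x)), ⟨hx, ?_, ?_, fun q hq => ?_⟩, ‖p - x‖, hpos, ?_⟩
  · rw [norm_smul, norm_inv, norm_norm, inv_mul_cancel₀ hpos.ne']
  · simp only [PiLp.smul_apply, PiLp.sub_apply, smul_eq_mul]
    refine mul_nonneg (by positivity) ?_
    by_contra! hlt
    have h1 := hmin _ (mem_closure_of_lower_apply_zero hR hp0 hx (by linarith : p 0 ≤ x 0))
    rw [add_sub_cancel_left, inner_smul_right, EuclideanSpace.inner_single_right] at h1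
    simp only [PiLp.sub_apply, conj_trivial, one_mul] at h1
    nlinarith
  · simp only
    rw [inner_smul_right, real_inner_comm]
    exact mul_nonpos_of_nonneg_of_nonpos (by positivity) (hmin q hq)
  · simp only
    rw [smul_smul, mul_inv_cancel₀ hpos.ne', one_smul]
    abel

/-- A normalized log-concave function is approximated from above, where it is not too small, by a
capped exponential with as many affine pieces as there are grid cells on the boundary of a cube. -/
theorem exists_cappedExp_approx (hF : NormalizedLogConcave c r F) (hr : 0 < r) (hr1 : r ≤ 1)
    (hT : 3 ≤ T) {m : ℕ} (hm : 0 < m) {ρ η : ℝ} (hρ0 : 0 < ρ)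
    (hρ : Real.sqrt (d + 1) * (6 / m) ≤ ρ) (hρ1 : ρ ≤ 1) (hη0 : 0 < η)
    (hη : 4 * ρ ^ 2 * (16 * T) ≤ η * r) :
    ∃ a : CubeFaceCell d m → EuclideanSpace ℝ (Fin d) × ℝ,
      (∀ x, Real.exp (-T) ≤ F x → F x ≤ cappedExp a (-T) x) ∧
      ∀ x, cappedExp a (-T) x ≤ Real.exp (2 * η) * F (c + (1 + η)⁻¹ • (x - c)) := by
  set R := 16 * T with hRdef
  have hR : 0 < R := by linarith
  set K := logHypograph F R T with hK
  -- Height `-2` leaves room for a ball: unscaled heights stay in `[-3, -1]`, above `-T` as `T ≥ 3`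
  -- and below `log F` on the core.
  set o := consPoint (-2 / R) (R⁻¹ • c) with ho
  have hball : ∀ p, ‖p - o‖ ≤ r / R → p ∈ K := by
    intro p hp
    have h1 : |R * (p 0) + 2| ≤ r := by
      have h := (PiLp.norm_apply_le (p - o) 0).trans hp
      rw [PiLp.sub_apply, ho, consPoint_zero, Real.norm_eq_abs, le_div_iff₀ hR] at h
      rw [show R * p 0 + 2 = (p 0 - -2 / R) * R by field_simp; ring, abs_mul, abs_of_pos hR]
      exact h
    have h2 : ‖R • tailPoint p - c‖ ≤ r := by
      have h := (norm_tailPoint_le (p - o)).trans hp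
      rw [tailPoint_sub, ho, tailPoint_consPoint, le_div_iff₀ hR] at h
      rw [show R • tailPoint p - c = R • (tailPoint p - R⁻¹ • c) by
        rw [smul_sub, smul_smul, mul_inv_cancel₀ hR.ne', one_smul], norm_smul,
        Real.norm_of_nonneg hR.le, mul_comm]
      exact h
    have h3 := abs_le.1 h1
    exact ⟨by linarith, (Real.exp_le_exp.2 (by linarith)).trans (hF.core _ h2)⟩
  have hoK : o ∈ K := hball o (by rw [sub_self, norm_zero]; positivity)
  have hne : K.Nonempty := ⟨o, hoK⟩
  have hbd : ∀ p ∈ closure K, ∀ i, |p i| ≤ 1 := by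
    intro p hp i
    have hcl : IsClosed {p : EuclideanSpace ℝ (Fin (d + 1)) | |p i| ≤ 1} :=
      isClosed_le (by fun_prop) continuous_const
    exact closure_minimal (fun q hq => abs_apply_le_one_of_mem hF (by linarith) hq i) hcl hp
  have h0cl : ∀ p ∈ closure K, p 0 ≤ 0 := by
    intro p hp
    have hcl : IsClosed {p : EuclideanSpace ℝ (Fin (d + 1)) | p 0 ≤ 0} :=
      isClosed_le (by fun_prop) continuous_const
    exact closure_minimal (fun q hq => apply_zero_nonpos_of_mem hF hR hq) hcl hp
  set S := upwardNormals (closure K) with hS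
  have hSne : S.Nonempty := by
    obtain ⟨q, hq, -⟩ := exists_upwardNormal hF hR hne (p := consPoint 1 0)
      (by rw [consPoint_zero]; linarith) (fun h => by
        have := h0cl _ h
        rw [consPoint_zero] at this
        linarith)
    exact ⟨q, hq⟩
  obtain ⟨rep, hrepS, hrep⟩ := exists_normals_of_cubeFaceCell (d := d) hm hSne
    (fun p hp => hbd _ hp.1) (fun p hp => hp.2.1) (fun p hp q hq => hp.2.2.2 _ hq.1) hρ hρ1
  have hsq : 0 < Real.sqrt (d + 1) := Real.sqrt_pos.2 (by positivity)
  -- Normals may be horizontal, and then their half-space is not the hypograph of a function. Adding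
  -- `κ` to the vertical component makes it positive; heights lie in `[-T, 0]`, so the tilt only
  -- enlarges the half-space there, by a slack of at most `κ`, which `4 √(d + 1)` turns into `ρ ^
  -- 2`.
  set κ := ρ ^ 2 / (4 * Real.sqrt (d + 1)) with hκ
  have hκ0 : 0 < κ := by positivity
  have hτ : ∀ l, 0 < (rep l).2 0 + κ := fun l => add_pos_of_nonneg_of_pos (hrepS l).2.2.1 hκ0
  set a : CubeFaceCell d m → EuclideanSpace ℝ (Fin d) × ℝ := fun l =>
    (-((rep l).2 0 + κ)⁻¹ • tailPoint (rep l).2,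
      ((rep l).2 0 + κ)⁻¹ * (R * inner ℝ (rep l).1 (rep l).2)) with ha
  have hle : ∀ l t x, t ≤ affineEval x (a l) ↔
      inner ℝ (consPoint (t / R) (R⁻¹ • x) - (rep l).1) (rep l).2 + κ * t / R ≤ 0 := by
    intro l t x
    have h1 : affineEval x (a l) = (R * inner ℝ (rep l).1 (rep l).2 -
        inner ℝ x (tailPoint (rep l).2)) / ((rep l).2 0 + κ) := by
      rw [affineEval_apply, ha]
      simp only
      rw [inner_smul_right]
      field_simp
      ring
    have h2 : inner ℝ (consPoint (t / R) (R⁻¹ • x) - (rep l).1) (rep l).2 + κ * t / R =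
        (t * ((rep l).2 0 + κ) - (R * inner ℝ (rep l).1 (rep l).2 -
          inner ℝ x (tailPoint (rep l).2))) / R := by
      rw [inner_sub_left, inner_eq_add_tailPoint (consPoint _ _), consPoint_zero,
        tailPoint_consPoint, inner_smul_left]
      simp only [conj_trivial]
      field_simp
      ring
    rw [h1, h2, le_div_iff₀ (hτ l), div_nonpos_iff]
    constructor
    · intro h; right; exact ⟨by linarith, hR.le⟩
    · rintro (⟨-, h⟩ | ⟨h, -⟩)
      · linarith
      · linarith
  refine ⟨a, fun x hx => ?_, fun x => ?_⟩
  · have hFx : 0 < F x := (Real.exp_pos _).trans_le hx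
    set t := Real.log (F x) with ht
    have hexp : Real.exp t = F x := Real.exp_log hFx
    have htT : -T ≤ t := (Real.le_log_iff_exp_le hFx).2 hx
    have ht0 : t ≤ 0 := Real.log_nonpos hFx.le (hF.le_one x)
    have hpK : consPoint (t / R) (R⁻¹ • x) ∈ K := by
      refine ⟨?_, ?_⟩
      · rw [consPoint_zero, mul_div_cancel₀ _ hR.ne']; exact htT
      · rw [consPoint_zero, mul_div_cancel₀ _ hR.ne', tailPoint_consPoint, smul_smul,
          mul_inv_cancel₀ hR.ne', one_smul, hexp]
    have hall : ∀ l, t ≤ affineEval x (a l) := fun l => by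
      rw [hle]
      have h1 := (hrepS l).2.2.2 _ (subset_closure hpK)
      have h2 : κ * t / R ≤ 0 :=
        div_nonpos_of_nonpos_of_nonneg (mul_nonpos_of_nonneg_of_nonpos hκ0.le ht0) hR.le
      linarith
    rw [cappedExp, if_pos fun l => htT.trans (hall l), ← hexp]
    exact Real.exp_le_exp.2 (le_ciInf hall)
  · have hFη := hF.nonneg (c + (1 + η)⁻¹ • (x - c))
    by_cases hcap : ∀ l, -T ≤ affineEval x (a l)
    swap
    · rw [cappedExp, if_neg hcap]; positivity
    rw [cappedExp, if_pos hcap]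
    set t := ⨅ l, affineEval x (a l) with ht
    have htT : -T ≤ t := le_ciInf hcap
    have hall : ∀ l, t ≤ affineEval x (a l) := fun l => ciInf_le (Set.finite_range _).bddBelow l
    set p := consPoint (t / R) (R⁻¹ • x) with hp
    have hp0 : R * p 0 = t := by rw [hp, consPoint_zero, mul_div_cancel₀ _ hR.ne']
    have hnear : ∃ y ∈ closure K, ‖p - y‖ ≤ 2 * ρ ^ 2 := by
      by_cases hpK : p ∈ closure K
      · exact ⟨p, hpK, by rw [sub_self, norm_zero]; positivity⟩
      obtain ⟨q, hq, h, hh, hpq⟩ := exists_upwardNormal hF hR hne (by rw [hp0]; exact htT) hpK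
      obtain ⟨l, hl⟩ := hrep q hq
      refine ⟨q.1, hq.1, ?_⟩
      have h1 := hl h κ hh.le hκ0.le (by
        rw [← hpq]
        have h2 := (hle l t x).1 (hall l)
        have h3 : -κ ≤ κ * t / R := by
          rw [le_div_iff₀ hR]
          nlinarith
        linarith)
      rw [hpq, add_sub_cancel_left, norm_smul, hq.2.1, mul_one, Real.norm_of_nonneg hh.le]
      have h4 : 4 * Real.sqrt (d + 1) * κ = ρ ^ 2 := by
        rw [hκ]; field_simp
      linarith
    obtain ⟨y, hy, hpy⟩ := hnear
    obtain ⟨k, hk, hyk⟩ := Metric.mem_closure_iff.1 hy (2 * ρ ^ 2) (by positivity)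
    have hpk : ‖p - k‖ ≤ 4 * ρ ^ 2 := by
      rw [dist_eq_norm] at hyk
      calc ‖p - k‖ = ‖(p - y) + (y - k)‖ := by rw [sub_add_sub_cancel]
        _ ≤ _ := norm_add_le _ _
        _ ≤ _ := by linarith
    -- Absorbing the error: `p` is within `4 ρ ^ 2 ≤ η r / R` of `k ∈ K`, so `p - k` magnified by
    -- `η⁻¹` fits in the ball around `o`. The convex combination with `k` is then exactly `p`
    -- contracted towards `o`.
    have hwK : o + η⁻¹ • (p - k) ∈ K := hball _ (by
      rw [add_sub_cancel_left, norm_smul, norm_inv, Real.norm_of_nonneg hη0.le, le_div_iff₀ hR,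
        ← div_eq_inv_mul, div_mul_eq_mul_div, div_le_iff₀ hη0]
      nlinarith)
    have hqK : (1 + η)⁻¹ • k + (η * (1 + η)⁻¹) • (o + η⁻¹ • (p - k)) ∈ K :=
      convex_logHypograph hF hk hwK (by positivity) (by positivity) (by field_simp)
    have hq : (1 + η)⁻¹ • k + (η * (1 + η)⁻¹) • (o + η⁻¹ • (p - k)) =
        o + (1 + η)⁻¹ • (p - o) := by
      have e1 : (η * (1 + η)⁻¹) • o = o - (1 + η)⁻¹ • o := by
        rw [show η * (1 + η)⁻¹ = 1 - (1 + η)⁻¹ by field_simp; ring, sub_smul, one_smul]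
      have e2 : (η * (1 + η)⁻¹) • η⁻¹ • (p - k) = (1 + η)⁻¹ • (p - k) := by
        rw [smul_smul]; congr 1; field_simp
      rw [smul_add, e1, e2, smul_sub, smul_sub]
      abel
    rw [hq] at hqK
    obtain ⟨-, h2⟩ := hqK
    have e1 : R • tailPoint (o + (1 + η)⁻¹ • (p - o)) = c + (1 + η)⁻¹ • (x - c) := by
      rw [tailPoint_add, tailPoint_smul, tailPoint_sub, ho, hp, tailPoint_consPoint,
        tailPoint_consPoint, ← smul_sub, smul_add, smul_smul, mul_inv_cancel₀ hR.ne', one_smul,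
        smul_comm R, smul_smul R, mul_inv_cancel₀ hR.ne', one_smul]
    rw [e1] at h2
    set s := R * (o + (1 + η)⁻¹ • (p - o)) 0 with hs
    -- Undoing the contraction in the vertical coordinate about height `-2`; with `s ≤ 0` this
    -- yields `t ≤ s + 2 * η`.
    have e2 : t = s + η * s + 2 * η := by
      rw [hs, PiLp.add_apply, PiLp.smul_apply, PiLp.sub_apply, ho, consPoint_zero, smul_eq_mul,
        ← hp0]
      field_simp
      ring
    have hs0 : s ≤ 0 := Real.exp_le_one_iff.1 (h2.trans (hF.le_one _))
    calc Real.exp t ≤ Real.exp (2 * η + s) := Real.exp_le_exp.2 (by nlinarith)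
      _ = Real.exp (2 * η) * Real.exp s := Real.exp_add _ _
      _ ≤ _ := by gcongr

end Hypograph

/-! ### Relative approximation in `L¹` -/

section LOneApprox
variable {d : ℕ} {F : EuclideanSpace ℝ (Fin d) → ℝ} {c : EuclideanSpace ℝ (Fin d)} {r : ℝ}

theorem exists_norm_le_mul_abs_apply (hd : 0 < d) (x : EuclideanSpace ℝ (Fin d)) :
    ∃ i, ‖x‖ ≤ Real.sqrt d * |x i| := by
  by_cases hx : x = 0
  · exact ⟨⟨0, hd⟩, by simp [hx]⟩
  have hpos : 0 < ‖x‖ := norm_pos_iff.2 hx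
  obtain ⟨i, hi⟩ := exists_abs_apply_ge (‖x‖⁻¹ • x) (by
    rw [norm_smul, norm_inv, norm_norm, inv_mul_cancel₀ hpos.ne'])
  refine ⟨i, ?_⟩
  rw [PiLp.smul_apply, smul_eq_mul, abs_mul, abs_of_pos (inv_pos.2 hpos), ← mul_assoc,
    mul_comm (Real.sqrt d), mul_assoc, ← div_eq_inv_mul, le_div_iff₀ hpos, one_mul] at hi
  exact hi

/-- An integrable envelope for the square roots of normalized log-concave functions. -/
theorem exists_integrable_sqrt_bound (hd : 0 < d) :
    ∃ H : EuclideanSpace ℝ (Fin d) → ℝ, Integrable H ∧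
      ∀ c r F, NormalizedLogConcave c r F → ∀ x, Real.sqrt (F x) ≤ H x := by
  -- The rate `1 / 8` is halved by the square root, and `√d` comes from passing from the largest
  -- coordinate to the norm.
  set β : ℝ := 1 / (16 * Real.sqrt d) with hβ
  have hsd : 0 < Real.sqrt d := Real.sqrt_pos.2 (by exact_mod_cast hd)
  have hβ0 : 0 < β := by positivity
  refine ⟨fun x => Real.exp (1 / 2 + β) * ((d + 1).factorial / β ^ (d + 1)) *
    (1 + ‖x‖) ^ (-((d + 1 : ℕ) : ℝ)), ?_, ?_⟩
  · refine (integrable_one_add_norm ?_).const_mul _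
    rw [finrank_euclideanSpace_fin]
    exact_mod_cast Nat.lt_succ_self d
  · intro c r F hF x
    obtain ⟨i, hi⟩ := exists_norm_le_mul_abs_apply hd x
    have h1 : Real.sqrt (F x) ≤ Real.exp (1 / 2 + β - β * (1 + ‖x‖)) := by
      rw [Real.sqrt_le_left (Real.exp_pos _).le, ← Real.exp_nat_mul]
      refine (hF.decay x i).trans (Real.exp_le_exp.2 ?_)
      have : β * ‖x‖ ≤ |x i| / 16 := by
        rw [hβ, div_mul_eq_mul_div, one_mul, div_le_div_iff₀ (by positivity) (by norm_num)]
        nlinarith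
      push_cast
      linarith
    have h2 := Real.pow_div_factorial_le_exp (x := β * (1 + ‖x‖)) (by positivity) (d + 1)
    have h3 : 0 < 1 + ‖x‖ := by positivity
    refine h1.trans ?_
    dsimp only
    rw [Real.rpow_neg h3.le, Real.rpow_natCast, Real.exp_sub, mul_assoc, div_eq_mul_inv]
    gcongr
    rw [inv_le_comm₀ (Real.exp_pos _) (by positivity)]
    refine le_trans (le_of_eq ?_) h2
    rw [mul_pow]
    field_simp

theorem NormalizedLogConcave.le_sqrt (hF : NormalizedLogConcave c r F)
    (x : EuclideanSpace ℝ (Fin d)) : F x ≤ Real.sqrt (F x) :=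
  Real.le_sqrt_of_sq_le (by nlinarith [hF.nonneg x, hF.le_one x])

theorem NormalizedLogConcave.integrable_sqrt (hd : 0 < d) (hF : NormalizedLogConcave c r F)
    (hm : AEMeasurable F) : Integrable fun x => Real.sqrt (F x) := by
  obtain ⟨H, hH, hle⟩ := exists_integrable_sqrt_bound hd
  refine hH.mono' hm.sqrt.aestronglyMeasurable (ae_of_all _ fun x => ?_)
  rw [Real.norm_of_nonneg (Real.sqrt_nonneg _)]
  exact hle c r F hF x

theorem NormalizedLogConcave.integrable (hd : 0 < d) (hF : NormalizedLogConcave c r F)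
    (hm : AEMeasurable F) : Integrable F := by
  refine (hF.integrable_sqrt hd hm).mono' hm.aestronglyMeasurable (ae_of_all _ fun x => ?_)
  rw [Real.norm_of_nonneg (hF.nonneg x)]
  exact hF.le_sqrt x

theorem NormalizedLogConcave.le_integral (hd : 0 < d) (hF : NormalizedLogConcave c r F)
    (hm : AEMeasurable F) :
    Real.exp (-1) * volume.real (Metric.closedBall (0 : EuclideanSpace ℝ (Fin d)) r) ≤
      ∫ x, F x := by
  have h1 : volume.real (Metric.closedBall (0 : EuclideanSpace ℝ (Fin d)) r) =
      volume.real (Metric.closedBall c r) := by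
    rw [measureReal_def, measureReal_def, Measure.addHaar_closedBall_center volume c]
  rw [h1]
  calc Real.exp (-1) * volume.real (Metric.closedBall c r)
      = ∫ _x in Metric.closedBall c r, Real.exp (-1) := by
        rw [setIntegral_const, smul_eq_mul, mul_comm]
    _ ≤ ∫ x in Metric.closedBall c r, F x := by
        refine setIntegral_mono_on (integrableOn_const measure_closedBall_lt_top.ne)
          (hF.integrable hd hm).integrableOn measurableSet_closedBall fun x hx => ?_
        exact hF.core x (by rwa [mem_closedBall_iff_norm] at hx)
    _ ≤ ∫ x, F x := setIntegral_le_integral (hF.integrable hd hm) (ae_of_all _ hF.nonneg)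

theorem integral_comp_homothety (c : EuclideanSpace ℝ (Fin d)) {s : ℝ} (hs : 0 ≤ s)
    (F : EuclideanSpace ℝ (Fin d) → ℝ) :
    ∫ x, F (c + s⁻¹ • (x - c)) = s ^ d * ∫ x, F x := by
  rw [integral_sub_right_eq_self (fun x => F (c + s⁻¹ • x)) c,
    Measure.integral_comp_inv_smul_of_nonneg volume (fun x => F (c + x)) hs,
    integral_add_left_eq_self F c, finrank_euclideanSpace_fin, smul_eq_mul]

theorem integrable_comp_homothety (c : EuclideanSpace ℝ (Fin d)) {s : ℝ} (hs : s ≠ 0)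
    {F : EuclideanSpace ℝ (Fin d) → ℝ} (hF : Integrable F) :
    Integrable fun x => F (c + s • (x - c)) :=
  ((hF.comp_add_left c).comp_smul hs).comp_sub_right c

/-- Relative `L¹` approximation of normalized log-concave functions by capped exponentials. -/
theorem exists_cappedExp_integral_sub_le (hd : 0 < d) (hr : 0 < r) (hr1 : r ≤ 1) :
    ∃ C : ℝ, 0 < C ∧ ∀ (c : EuclideanSpace ℝ (Fin d)) (F : EuclideanSpace ℝ (Fin d) → ℝ),
      NormalizedLogConcave c r F → AEMeasurable F →
      ∀ (T : ℝ) (m : ℕ) (ρ η : ℝ), 3 ≤ T → 0 < m → 0 < ρ → Real.sqrt (d + 1) * (6 / m) ≤ ρ →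
        ρ ≤ 1 → 0 < η → 4 * ρ ^ 2 * (16 * T) ≤ η * r → (d + 2) * η ≤ 1 →
        ∃ a : CubeFaceCell d m → EuclideanSpace ℝ (Fin d) × ℝ,
          Integrable (cappedExp a (-T)) ∧
          ∫ x, |F x - cappedExp a (-T) x| ≤ C * (η + Real.exp (-T / 2)) * ∫ x, F x := by
  obtain ⟨H, hH, hHF⟩ := exists_integrable_sqrt_bound hd
  set v := Real.exp (-1) * volume.real (Metric.closedBall (0 : EuclideanSpace ℝ (Fin d)) r)
  have hv : 0 < v := mul_pos (Real.exp_pos _) (ENNReal.toReal_pos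
    (Metric.measure_closedBall_pos volume _ hr).ne' measure_closedBall_lt_top.ne)
  set J := |∫ x, H x|
  refine ⟨2 * (d + 2) + 2 * J / v, by positivity, fun c F hF hm T m ρ η hT hm0 hρ0 hρ hρ1 hη0 hη
    hdη => ?_⟩
  obtain ⟨a, hlow, hup⟩ := exists_cappedExp_approx hF hr hr1 hT hm0 hρ0 hρ hρ1 hη0 hη
  have hFi := hF.integrable hd hm
  have hSi := hF.integrable_sqrt hd hm
  have hI := hF.le_integral hd hm
  set g := cappedExp a (-T) with hg
  have hEi : Integrable fun x => Real.exp (2 * η) * F (c + (1 + η)⁻¹ • (x - c)) :=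
    (integrable_comp_homothety c (by positivity) hFi).const_mul _
  have hgi : Integrable g := by
    refine hEi.mono' (measurable_cappedExp a _).aestronglyMeasurable (ae_of_all _ fun x => ?_)
    rw [Real.norm_of_nonneg (cappedExp_nonneg a _ x)]
    exact hup x
  refine ⟨a, hgi, ?_⟩
  -- Above the threshold `F ≤ g`. Below it `F ≤ exp (-T / 2) * √F`, and `√F` has an envelope
  -- integrable uniformly over the normalized class.
  have hpt : ∀ x, |F x - g x| ≤ (g x - F x) + 2 * Real.exp (-T / 2) * Real.sqrt (F x) := by
    intro x
    have hs := Real.sqrt_nonneg (F x)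
    have he := Real.exp_pos (-T / 2)
    by_cases hx : Real.exp (-T) ≤ F x
    · have := hlow x hx
      rw [abs_of_nonpos (by linarith)]
      nlinarith
    · have h1 : Real.sqrt (F x) ≤ Real.exp (-T / 2) := by
        rw [Real.sqrt_le_left he.le, ← Real.exp_nat_mul]
        refine (not_le.1 hx).le.trans (Real.exp_le_exp.2 ?_)
        push_cast
        linarith
      have h2 : F x ≤ Real.exp (-T / 2) * Real.sqrt (F x) := by
        calc F x = Real.sqrt (F x) * Real.sqrt (F x) := (Real.mul_self_sqrt (hF.nonneg x)).symm
          _ ≤ _ := mul_le_mul_of_nonneg_right h1 hs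
      have h3 := cappedExp_nonneg a (-T) x
      have h4 := hF.nonneg x
      rw [abs_sub_le_iff]
      constructor <;> linarith
  -- The dilation contributes `(1 + η) ^ d` and the height shift `exp (2 η)`, together at most `exp
  -- ((d + 2) η)`.
  have hgI : ∫ x, g x ≤ (1 + 2 * (d + 2) * η) * ∫ x, F x := by
    have hI0 : 0 ≤ ∫ x, F x := hv.le.trans hI
    calc ∫ x, g x ≤ ∫ x, Real.exp (2 * η) * F (c + (1 + η)⁻¹ • (x - c)) :=
          integral_mono hgi hEi hup
      _ = Real.exp (2 * η) * ((1 + η) ^ d * ∫ x, F x) := by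
          rw [integral_const_mul, integral_comp_homothety c (by positivity)]
      _ ≤ Real.exp (2 * η) * (Real.exp η ^ d * ∫ x, F x) := by
          have := Real.add_one_le_exp η
          gcongr
          linarith
      _ = Real.exp ((d + 2) * η) * ∫ x, F x := by
          rw [← Real.exp_nat_mul, ← mul_assoc, ← Real.exp_add]
          ring_nf
      _ ≤ _ := by
          have h0 : 0 ≤ (d + 2) * η := by positivity
          have h1 := Real.abs_exp_sub_one_le (x := (d + 2) * η) (by rwa [abs_of_nonneg h0])
          rw [abs_of_nonneg h0] at h1
          have h2 := (abs_le.1 h1).2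
          refine mul_le_mul_of_nonneg_right ?_ hI0
          linarith
  have hsI : ∫ x, Real.sqrt (F x) ≤ J / v * ∫ x, F x := by
    calc ∫ x, Real.sqrt (F x) ≤ ∫ x, H x := integral_mono hSi hH (hHF c r F hF)
      _ ≤ J := le_abs_self _
      _ ≤ J / v * ∫ x, F x := by
          rw [div_mul_eq_mul_div, le_div_iff₀ hv]
          exact mul_le_mul_of_nonneg_left hI (abs_nonneg _)
  calc ∫ x, |F x - g x| ≤ ∫ x, ((g x - F x) + 2 * Real.exp (-T / 2) * Real.sqrt (F x)) :=
        integral_mono (hFi.sub hgi).abs ((hgi.sub hFi).add (hSi.const_mul _)) hpt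
    _ = (∫ x, g x) - (∫ x, F x) + 2 * Real.exp (-T / 2) * ∫ x, Real.sqrt (F x) := by
        have h1 : Integrable fun x => g x - F x := hgi.sub hFi
        rw [integral_add h1 (hSi.const_mul _), integral_sub hgi hFi, integral_const_mul]
    _ ≤ (1 + 2 * (d + 2) * η) * (∫ x, F x) - (∫ x, F x) +
          2 * Real.exp (-T / 2) * (J / v * ∫ x, F x) := by gcongr
    _ ≤ _ := by
        have hI0 : 0 ≤ ∫ x, F x := hv.le.trans hI
        have he := Real.exp_pos (-T / 2)
        have h1 : 0 ≤ J / v * η * ∫ x, F x := by positivity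
        have h2 : 0 ≤ (d + 2) * Real.exp (-T / 2) * ∫ x, F x := by positivity
        have : (2 * (d + 2) + 2 * J / v) * (η + Real.exp (-T / 2)) * ∫ x, F x =
          2 * (d + 2) * η * (∫ x, F x) + 2 * Real.exp (-T / 2) * (J / v * ∫ x, F x) +
          2 * (J / v * η * ∫ x, F x) + 2 * ((d + 2) * Real.exp (-T / 2) * ∫ x, F x) := by ring
        rw [this]
        linarith

end LOneApprox

/-! ### Normal position of a log-concave density -/

section NormalPosition
variable {d : ℕ} {f : EuclideanSpace ℝ (Fin d) → ℝ}

theorem IsProbDensity.mul_measureReal_le_one (hf : IsProbDensity f)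
    {B : Set (EuclideanSpace ℝ (Fin d))} {k : ℝ} (hk : 0 < k) (hB : ∀ x ∈ B, k ≤ f x) :
    k * volume.real B ≤ 1 := by
  have h1 : ENNReal.ofReal k * volume B ≤ 1 := by
    calc ENNReal.ofReal k * volume B
        ≤ ENNReal.ofReal k * volume {x | ENNReal.ofReal k ≤ ENNReal.ofReal (f x)} := by
          gcongr
          exact fun x hx => ENNReal.ofReal_le_ofReal (hB x hx)
      _ ≤ ∫⁻ x, ENNReal.ofReal (f x) := mul_meas_ge_le_lintegral₀ hf.aemeasurable.ennreal_ofReal _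
      _ = 1 := hf.lintegral_eq_one
  have h2 := ENNReal.toReal_mono ENNReal.one_ne_top h1
  rwa [ENNReal.toReal_mul, ENNReal.toReal_ofReal hk.le, ENNReal.toReal_one] at h2

theorem rpow_mul_rpow_lt {k a b t : ℝ} (hk : 0 < k) (ha : k < a) (hb : k < b) (ht0 : 0 < t)
    (ht1 : t < 1) : k < a ^ t * b ^ (1 - t) := by
  calc k = k ^ t * k ^ (1 - t) := by rw [← Real.rpow_add hk]; simp
    _ < a ^ t * b ^ (1 - t) := mul_lt_mul'' (Real.rpow_lt_rpow hk.le ha ht0)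
        (Real.rpow_lt_rpow hk.le hb (by linarith)) (Real.rpow_nonneg hk.le _)
        (Real.rpow_nonneg hk.le _)

theorem convex_superlevel (hf : f ∈ logConcaveDensities d) {k : ℝ} (hk : 0 < k) :
    Convex ℝ {x | k < f x} := by
  rw [convex_iff_forall_pos]
  intro x hx y hy s t hs ht hst
  obtain rfl : t = 1 - s := by linarith
  exact (rpow_mul_rpow_lt hk hx hy hs (by linarith)).trans_le (hf.2 x y s hs (by linarith))

/-- Some positive superlevel set has positive measure. It is convex, so its boundary is null, and
its interior cannot be empty. -/
theorem exists_closedBall_le (hf : f ∈ logConcaveDensities d) :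
    ∃ k > 0, ∃ x, ∃ s > 0, ∀ y ∈ Metric.closedBall x s, k ≤ f y := by
  obtain ⟨n, hn⟩ : ∃ n : ℕ, volume {x | 1 / ((n : ℝ) + 1) < f x} ≠ 0 := by
    by_contra! h
    have h0 : volume (⋃ n : ℕ, {x | 1 / ((n : ℝ) + 1) < f x}) = 0 := measure_iUnion_null h
    have h1 : ∀ᵐ x, f x = 0 := by
      refine measure_mono_null (fun x hx => ?_) h0
      have hpos : 0 < f x := lt_of_le_of_ne (hf.1.nonneg x) (Ne.symm hx)
      exact Set.mem_iUnion.2 (exists_nat_one_div_lt hpos)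
    have h2 := hf.1.lintegral_eq_one
    rw [lintegral_congr_ae (g := fun _ => 0) (h1.mono fun x hx => by simp [hx])] at h2
    simp at h2
  have hk : (0 : ℝ) < 1 / (n + 1) := Nat.one_div_pos_of_nat
  have hconv := convex_superlevel hf hk
  obtain ⟨x, hx⟩ : (interior {x | 1 / ((n : ℝ) + 1) < f x}).Nonempty := by
    by_contra hne
    rw [Set.not_nonempty_iff_eq_empty] at hne
    refine hn (measure_mono_null subset_closure ?_)
    rw [closure_eq_interior_union_frontier, hne, Set.empty_union]
    exact hconv.addHaar_frontier volume
  obtain ⟨s, hs, hsub⟩ := Metric.nhds_basis_closedBall.mem_iff.1 (mem_interior_iff_mem_nhds.1 hx)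
  exact ⟨_, hk, x, s, hs, fun y hy => (hsub hy).le⟩

theorem volumeReal_closedBall_pos (x : EuclideanSpace ℝ (Fin d)) {s : ℝ} (hs : 0 < s) :
    0 < volume.real (Metric.closedBall x s) :=
  ENNReal.toReal_pos (Metric.measure_closedBall_pos volume _ hs).ne' measure_closedBall_lt_top.ne

/-- Midpoints between `x` and a ball on which `f ≥ k` fill a ball of half the radius, on which `f ≥
sqrt (f x * k)`. Total mass one then bounds `f x` independently of `x`. -/
theorem bddAbove_of_mem_logConcaveDensities (hf : f ∈ logConcaveDensities d) :
    BddAbove (Set.range f) := by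
  obtain ⟨k, hk, x₁, s, hs, hball⟩ := exists_closedBall_le hf
  set V := volume.real (Metric.closedBall (0 : EuclideanSpace ℝ (Fin d)) (s / 2))
  have hV : 0 < V := volumeReal_closedBall_pos _ (by positivity)
  refine ⟨(1 / V) ^ 2 / k, ?_⟩
  rintro _ ⟨x, rfl⟩
  by_cases hx : f x = 0
  · rw [hx]; positivity
  have hx0 : 0 < f x := lt_of_le_of_ne (hf.1.nonneg x) (Ne.symm hx)
  have h1 : ∀ y ∈ Metric.closedBall ((1 / 2 : ℝ) • x + (1 / 2 : ℝ) • x₁) (s / 2),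
      Real.sqrt (f x * k) ≤ f y := by
    intro y hy
    have h2 : (2 : ℝ) • y - x ∈ Metric.closedBall x₁ s := by
      rw [mem_closedBall_iff_norm] at hy ⊢
      rw [show (2 : ℝ) • y - x - x₁ = (2 : ℝ) • (y - ((1 / 2 : ℝ) • x + (1 / 2 : ℝ) • x₁)) by
        module, norm_smul]
      norm_num
      linarith
    have h3 := hf.2 x ((2 : ℝ) • y - x) (1 / 2) (by norm_num) (by norm_num)
    rw [show (1 / 2 : ℝ) • x + (1 - 1 / 2 : ℝ) • ((2 : ℝ) • y - x) = y by module,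
      show (1 - 1 / 2 : ℝ) = 1 / 2 by norm_num, ← Real.sqrt_eq_rpow, ← Real.sqrt_eq_rpow] at h3
    rw [Real.sqrt_mul hx0.le]
    exact le_trans (by gcongr; exact hball _ h2) h3
  have h4 := hf.1.mul_measureReal_le_one (Real.sqrt_pos.2 (mul_pos hx0 hk)) h1
  rw [measureReal_def, Measure.addHaar_closedBall_center, ← measureReal_def,
    ← le_div_iff₀ hV] at h4
  have h5 := (Real.sqrt_le_left (by positivity)).1 h4
  rwa [le_div_iff₀ hk]

/-- The center of a ball inscribed in the standard simplex. -/
noncomputable def simplexCenter (d : ℕ) : EuclideanSpace ℝ (Fin d) :=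
  WithLp.toLp 2 fun _ => 1 / (2 * d)

theorem mem_simplex_of_norm_sub_le (hd : 0 < d) {x : EuclideanSpace ℝ (Fin d)}
    (hx : ‖x - simplexCenter d‖ ≤ 1 / (2 * d)) : (∀ i, 0 ≤ x i) ∧ ∑ i, x i ≤ 1 := by
  have hd' : (0 : ℝ) < d := by exact_mod_cast hd
  have h1 : ∀ i, |x i - 1 / (2 * d)| ≤ 1 / (2 * d) := fun i =>
    (PiLp.norm_apply_le (x - simplexCenter d) i).trans hx
  refine ⟨fun i => by linarith [(abs_le.1 (h1 i)).1], ?_⟩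
  calc ∑ i, x i ≤ ∑ _i : Fin d, (1 / d : ℝ) := Finset.sum_le_sum fun i _ => by
        have := (abs_le.1 (h1 i)).2
        have h2 : (1 / d : ℝ) = 1 / (2 * d) + 1 / (2 * d) := by field_simp; norm_num
        linarith
    _ = 1 := by
        rw [Finset.sum_const, Finset.card_univ, Fintype.card_fin, nsmul_eq_mul]
        field_simp

theorem exists_closedBall_lt_of_lt (hf : f ∈ logConcaveDensities d) {M : ℝ} (hM : 0 < M)
    (hfM : ∀ x, f x ≤ M) {x₀ : EuclideanSpace ℝ (Fin d)} (hx₀ : M * Real.exp (-(1 / 2)) < f x₀) :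
    ∃ v, ∃ s > 0, ∀ y ∈ Metric.closedBall v s, M * Real.exp (-1) < f y := by
  obtain ⟨k, hk, x₁, s, hs, hball⟩ := exists_closedBall_le hf
  have hkM : k ≤ M := (hball x₁ (Metric.mem_closedBall_self hs.le)).trans (hfM _)
  set l := Real.log (M / k) with hl
  have hl0 : 0 ≤ l := Real.log_nonneg (by rwa [le_div_iff₀ hk, one_mul])
  have hkl : k = M * Real.exp (-l) := by
    rw [Real.exp_neg, hl, Real.exp_log (by positivity)]
    field_simp
  -- The ball is contracted towards `x₀` by a ratio so small that its logarithmic deficit `l` costs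
  -- less than `1 / 2`; the remaining deficit is at most the `1 / 2` of `x₀`.
  set t := 1 / (2 * (l + 1)) with ht
  have ht0 : 0 < t := by positivity
  have htl : t * l < 1 / 2 := by
    rw [ht, div_mul_eq_mul_div, div_lt_iff₀ (by positivity)]
    linarith
  have ht1 : t < 1 := by
    rw [ht, div_lt_one (by positivity)]
    linarith
  refine ⟨t • x₁ + (1 - t) • x₀, t * s, by positivity, fun y hy => ?_⟩
  have h2 : x₁ + t⁻¹ • (y - (t • x₁ + (1 - t) • x₀)) ∈ Metric.closedBall x₁ s := by
    rw [mem_closedBall_iff_norm] at hy ⊢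
    rw [add_sub_cancel_left, norm_smul, norm_inv, Real.norm_of_nonneg ht0.le, ← div_eq_inv_mul,
      div_le_iff₀ ht0]
    linarith
  have h3 := hf.2 (x₁ + t⁻¹ • (y - (t • x₁ + (1 - t) • x₀))) x₀ t ht0 ht1
  rw [smul_add, smul_smul, mul_inv_cancel₀ ht0.ne', one_smul,
    show t • x₁ + (y - (t • x₁ + (1 - t) • x₀)) + (1 - t) • x₀ = y by abel] at h3
  have h4 := hball _ h2
  have h5 : k ^ t * (M * Real.exp (-(1 / 2))) ^ (1 - t) =
      M * Real.exp (-(t * l) - (1 - t) / 2) := by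
    rw [hkl, Real.mul_rpow hM.le (Real.exp_pos _).le, Real.mul_rpow hM.le (Real.exp_pos _).le,
      ← Real.exp_mul, ← Real.exp_mul]
    have : M ^ t * M ^ (1 - t) = M := by rw [← Real.rpow_add hM]; simp
    calc _ = (M ^ t * M ^ (1 - t)) * (Real.exp (-l * t) * Real.exp (-(1 / 2) * (1 - t))) := by ring
      _ = _ := by rw [this, ← Real.exp_add]; ring_nf
  calc M * Real.exp (-1) < M * Real.exp (-(t * l) - (1 - t) / 2) := by
        gcongr
        linarith
    _ = k ^ t * (M * Real.exp (-(1 / 2))) ^ (1 - t) := h5.symm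
    _ ≤ f (x₁ + t⁻¹ • (y - (t • x₁ + (1 - t) • x₀))) ^ t * f x₀ ^ (1 - t) := by
        have h6 : 0 ≤ 1 - t := by linarith
        gcongr
        exact Real.rpow_nonneg (hf.1.nonneg _) _
    _ ≤ f y := h3

theorem convex_sum_smul_mem {L : Set (EuclideanSpace ℝ (Fin d))} (hL : Convex ℝ L)
    {v : EuclideanSpace ℝ (Fin d)} (hv : v ∈ L) {w : Fin d → EuclideanSpace ℝ (Fin d)}
    (hw : ∀ i, v + w i ∈ L) {x : EuclideanSpace ℝ (Fin d)} (hx : ∀ i, 0 ≤ x i)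
    (hx1 : ∑ i, x i ≤ 1) : v + ∑ i, x i • w i ∈ L := by
  have h := hL.sum_mem (t := Finset.univ) (w := fun o : Option (Fin d) => o.elim (1 - ∑ i, x i) x)
    (z := fun o => o.elim v fun i => v + w i) (by rintro (_ | i) - <;> simp [hx, hx1])
    (by rw [Fintype.sum_option]; simp) (by rintro (_ | i) - <;> simp [hv, hw])
  rw [Fintype.sum_option] at h
  simp only [Option.elim_none, Option.elim_some, smul_add, Finset.sum_add_distrib,
    ← Finset.sum_smul, sub_smul, one_smul] at h
  convert h using 1
  abel

/-- A system of vectors pointing into a convex set from one of its points, such that the set is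
contained in the parallelepiped `[-2,2]^d` in the resulting coordinates. -/
theorem exists_basis_of_bounded_det {L : Set (EuclideanSpace ℝ (Fin d))}
    {v : EuclideanSpace ℝ (Fin d)} {s : ℝ} (hs : 0 < s) (hball : Metric.closedBall v s ⊆ L)
    {B : ℝ} (hB : ∀ w : Fin d → EuclideanSpace ℝ (Fin d), (∀ i, v + w i ∈ L) →
      |(EuclideanSpace.basisFun (Fin d) ℝ).toBasis.det w| ≤ B) :
    ∃ A : EuclideanSpace ℝ (Fin d) ≃L[ℝ] EuclideanSpace ℝ (Fin d),
      (∀ i, v + A (EuclideanSpace.basisFun (Fin d) ℝ i) ∈ L) ∧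
        ∀ x, v + A x ∈ L → ∀ i, |x i| ≤ 2 := by
  set e := (EuclideanSpace.basisFun (Fin d) ℝ).toBasis with he
  set D : Set ℝ := {t | ∃ w : Fin d → EuclideanSpace ℝ (Fin d), (∀ i, v + w i ∈ L) ∧
    t = |e.det w|} with hD
  have hDb : BddAbove D := ⟨B, by rintro _ ⟨w, hw, rfl⟩; exact hB w hw⟩
  have h0 : s ^ d ∈ D := by
    refine ⟨fun i => s • e i, fun i => hball ?_, ?_⟩
    · rw [mem_closedBall_iff_norm, add_sub_cancel_left, norm_smul, he]
      simp [abs_of_pos hs]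
    · have := e.det.map_smul_univ (fun _ => s) e
      rw [this, e.det_self]
      simp [abs_of_pos hs]
  have hsup : 0 < sSup D := (pow_pos hs d).trans_le (le_csSup hDb h0)
  -- A system within a factor two of the largest determinant suffices. By Cramer's rule `x i` is the
  -- ratio of determinants after replacing `w i` by `A x`, hence at most `2` in absolute value, and
  -- no compactness of `L` is needed.
  obtain ⟨_, ⟨w, hw, rfl⟩, hlt⟩ := exists_lt_of_lt_csSup ⟨_, h0⟩ (half_lt_self hsup)
  have hdet : e.det w ≠ 0 := by
    intro h
    rw [h, abs_zero] at hlt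
    linarith
  obtain ⟨hli, hsp⟩ := (Module.Basis.is_basis_iff_det e).2 (isUnit_iff_ne_zero.2 hdet)
  set b := Module.Basis.mk hli hsp.ge with hb
  set A := (e.equiv b (Equiv.refl _)).toContinuousLinearEquiv with hA
  have hAe : ∀ i, A (e i) = w i := fun i => by
    rw [hA, LinearEquiv.coe_toContinuousLinearEquiv', Module.Basis.equiv_apply, hb,
      Module.Basis.mk_apply, Equiv.refl_apply]
  refine ⟨A, fun i => ?_, fun x hx i => ?_⟩
  · have : EuclideanSpace.basisFun (Fin d) ℝ i = e i := by rw [he, OrthonormalBasis.coe_toBasis]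
    rw [this, hAe]
    exact hw i
  · have h1 := congrArg (fun φ : _ →ₗ[ℝ] ℝ => φ (A x))
      (e.det_smul_mk_coord_eq_det_update hli hsp.ge i)
    simp only [LinearMap.smul_apply, smul_eq_mul] at h1
    have h2 : (Module.Basis.mk hli hsp.ge).coord i (A x) = x i := by
      rw [← hb, hA, LinearEquiv.coe_toContinuousLinearEquiv']
      have h3 : x = ∑ j, x j • e j := by
        conv_lhs => rw [← e.sum_repr x]
        simp [he]
      conv_lhs => rw [h3]
      simp [Finsupp.single_apply]
    rw [h2] at h1
    have h4 : |e.det (Function.update w i (A x))| ≤ sSup D := by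
      refine le_csSup hDb ⟨_, fun j => ?_, rfl⟩
      by_cases hji : j = i
      · subst hji; simpa using hx
      · rw [Function.update_of_ne hji]; exact hw j
    have h5 : |e.det w| * |x i| ≤ sSup D := by
      rw [← abs_mul, h1]
      exact h4
    by_contra! h6
    nlinarith [abs_pos.2 hdet]

/-- `L` contains the simplex spanned by `v` and the `v + w i`, hence an affine image of the ball
inscribed in the standard simplex, with volume scaled by `|det w|`; the mass of `f` there is at most
one. -/
theorem abs_det_mul_volume_le (hd : 0 < d) {L : Set (EuclideanSpace ℝ (Fin d))}
    (hL : Convex ℝ L) {v : EuclideanSpace ℝ (Fin d)} (hv : v ∈ L) (hf : IsProbDensity f)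
    {k : ℝ} (hk : 0 < k) (hLf : ∀ x ∈ L, k ≤ f x) {w : Fin d → EuclideanSpace ℝ (Fin d)}
    (hw : ∀ i, v + w i ∈ L) :
    k * (|(EuclideanSpace.basisFun (Fin d) ℝ).toBasis.det w| *
      volume.real (Metric.closedBall (simplexCenter d) (1 / (2 * d)))) ≤ 1 := by
  set e := (EuclideanSpace.basisFun (Fin d) ℝ).toBasis with he
  set W : EuclideanSpace ℝ (Fin d) →ₗ[ℝ] EuclideanSpace ℝ (Fin d) := e.constr ℝ w with hW
  have hdet : LinearMap.det W = e.det w := by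
    have h := e.det_comp W e
    rw [e.det_self, mul_one] at h
    rw [← h]
    congr 1
    ext1 i
    simp [hW]
  have hWx : ∀ x, W x = ∑ i, x i • w i := fun x => by
    rw [hW, e.constr_apply_fintype ℝ]
    simp [he]
  have h1 := hf.mul_measureReal_le_one hk
    (B := (fun y => v + y) '' (W '' Metric.closedBall (simplexCenter d) (1 / (2 * d)))) (by
      rintro _ ⟨_, ⟨x, hx, rfl⟩, rfl⟩
      obtain ⟨hx0, hx1⟩ := mem_simplex_of_norm_sub_le hd (mem_closedBall_iff_norm.1 hx)
      refine hLf _ ?_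
      simp only [hWx]
      exact convex_sum_smul_mem hL hv hw hx0 hx1)
  rw [measureReal_def, Set.image_add_left, measure_preimage_add, Measure.addHaar_image_linearMap,
    ENNReal.toReal_mul, ENNReal.toReal_ofReal (abs_nonneg _), hdet] at h1
  exact h1

/-- Every log-concave density is, up to an affine change of variables and a factor, in normalized
position. -/
theorem exists_normalizedLogConcave (hd : 0 < d) (hf : f ∈ logConcaveDensities d) :
    ∃ (A : EuclideanSpace ℝ (Fin d) ≃L[ℝ] EuclideanSpace ℝ (Fin d))
      (v : EuclideanSpace ℝ (Fin d)) (M : ℝ), 0 < M ∧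
      NormalizedLogConcave (simplexCenter d) (1 / (2 * d)) fun x => M⁻¹ * f (v + A x) := by
  have hbdd := bddAbove_of_mem_logConcaveDensities hf
  set M := sSup (Set.range f) with hMdef
  have hfM : ∀ x, f x ≤ M := fun x => le_csSup hbdd ⟨x, rfl⟩
  have hM : 0 < M := by
    obtain ⟨k, hk, x, s, hs, hball⟩ := exists_closedBall_le hf
    exact hk.trans_le ((hball x (Metric.mem_closedBall_self hs.le)).trans (hfM x))
  have hexp : Real.exp (-(1 / 2)) < 1 :=
    (Real.exp_lt_exp.2 (by norm_num : -(1 / 2 : ℝ) < 0)).trans_eq Real.exp_zero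
  obtain ⟨_, ⟨x₀, rfl⟩, hx₀⟩ := exists_lt_of_lt_csSup (Set.range_nonempty f)
    (show M * Real.exp (-(1 / 2)) < M by nlinarith)
  obtain ⟨v, s, hs, hball⟩ := exists_closedBall_lt_of_lt hf hM hfM hx₀
  set k := M * Real.exp (-1) with hk
  have hk0 : 0 < k := by positivity
  set L := {x | k < f x} with hL
  have hLc : Convex ℝ L := convex_superlevel hf hk0
  have hvL : v ∈ L := hball v (Metric.mem_closedBall_self hs.le)
  have hd' : (0 : ℝ) < 1 / (2 * d) := by
    have : (0 : ℝ) < d := by exact_mod_cast hd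
    positivity
  set V := volume.real (Metric.closedBall (simplexCenter d) (1 / (2 * d)))
  have hV : 0 < V := volumeReal_closedBall_pos _ hd'
  obtain ⟨A, hA1, hA2⟩ := exists_basis_of_bounded_det hs (L := L) hball (B := 1 / (k * V))
    (fun w hw => by
      rw [le_div_iff₀ (by positivity)]
      have := abs_det_mul_volume_le hd hLc hvL hf.1 hk0 (fun x hx => le_of_lt hx) hw
      linarith)
  have hAx : ∀ x, A x = ∑ i, x i • A (EuclideanSpace.basisFun (Fin d) ℝ i) := fun x => by
    have h3 : x = ∑ j, x j • EuclideanSpace.basisFun (Fin d) ℝ j := by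
      conv_lhs => rw [← (EuclideanSpace.basisFun (Fin d) ℝ).sum_repr x]
      simp
    conv_lhs => rw [h3]
    simp
  refine ⟨A, v, M, hM, ⟨fun x => mul_nonneg (by positivity) (hf.1.nonneg _), fun x => ?_,
    fun x y t ht0 ht1 => ?_, fun x hx => ?_, fun x i => ?_⟩⟩
  · rw [inv_mul_le_iff₀ hM, mul_one]
    exact hfM _
  · have h1 := hf.2 (v + A x) (v + A y) t ht0 ht1
    have h2 : t • (v + A x) + (1 - t) • (v + A y) = v + A (t • x + (1 - t) • y) := by
      rw [map_add, map_smul, map_smul]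
      module
    rw [h2] at h1
    rw [Real.mul_rpow (by positivity) (hf.1.nonneg _), Real.mul_rpow (by positivity)
      (hf.1.nonneg _)]
    have h3 : M⁻¹ ^ t * M⁻¹ ^ (1 - t) = M⁻¹ := by
      rw [← Real.rpow_add (by positivity)]; simp
    calc _ = (M⁻¹ ^ t * M⁻¹ ^ (1 - t)) * (f (v + A x) ^ t * f (v + A y) ^ (1 - t)) := by ring
      _ ≤ _ := by rw [h3]; gcongr
  · obtain ⟨hx0, hx1⟩ := mem_simplex_of_norm_sub_le hd hx
    have h1 : v + A x ∈ L := by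
      rw [hAx]
      exact convex_sum_smul_mem hLc hvL hA1 hx0 hx1
    rw [← div_eq_inv_mul, le_div_iff₀ hM, mul_comm]
    exact le_of_lt h1
  · set z := A.symm (x₀ - v) with hz
    have hAz : v + A z = x₀ := by rw [hz, A.apply_symm_apply]; abel
    have hzL : v + A z ∈ L := by
      rw [hAz]
      refine lt_trans ?_ hx₀
      rw [hk]
      gcongr
      norm_num
    have hz2 := abs_le.1 (hA2 z hzL i)
    -- Chosen so that the point at fraction `q⁻¹` from `z` to `x` has a coordinate exceeding `2` in
    -- absolute value and thus leaves `L`. Log-concavity between `z`, with deficit below `1 / 2`,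
    -- and that point, with deficit at least `1`, forces `F x ≤ exp (-q / 2)`.
    set q := (|x i| - 2) / 4 with hq
    have hgoal : Real.exp (-q / 2) ≤ Real.exp (1 - |x i| / 8) := by
      refine Real.exp_le_exp.2 ?_
      rw [hq]
      linarith
    have hF1 : M⁻¹ * f (v + A x) ≤ 1 := by
      rw [inv_mul_le_iff₀ hM, mul_one]; exact hfM _
    by_cases hq1 : q ≤ 1
    · refine hF1.trans (Real.one_le_exp ?_)
      rw [hq] at hq1
      linarith
    push Not at hq1
    have hq0 : 0 < q := by linarith
    have hqi : q⁻¹ < 1 := inv_lt_one_of_one_lt₀ hq1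
    have hqi0 : 0 < q⁻¹ := by positivity
    refine le_trans ?_ hgoal
    have hnot : ¬ v + A (q⁻¹ • x + (1 - q⁻¹) • z) ∈ L := by
      intro h
      have h1 := abs_le.1 (hA2 _ h i)
      simp only [PiLp.add_apply, PiLp.smul_apply, smul_eq_mul] at h1
      have hxi : |x i| = 4 * q + 2 := by rw [hq]; ring
      have e1 : q⁻¹ * (4 * q + 2) = 4 + 2 * q⁻¹ := by field_simp
      rcases abs_cases (x i) with h2 | h2
      · rw [← h2.1, hxi, e1] at h1
        nlinarith
      · have : x i = -(4 * q + 2) := by linarith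
        rw [this, mul_neg, e1] at h1
        nlinarith
    have h1 := hf.2 (v + A x) (v + A z) q⁻¹ hqi0 hqi
    have h2 : q⁻¹ • (v + A x) + (1 - q⁻¹) • (v + A z) =
        v + A (q⁻¹ • x + (1 - q⁻¹) • z) := by
      rw [map_add, map_smul, map_smul]
      module
    rw [h2] at h1
    have h3 : f (v + A x) ^ q⁻¹ * f (v + A z) ^ (1 - q⁻¹) ≤ k := h1.trans (not_lt.1 hnot)
    by_contra! h4
    have h5 : M * Real.exp (-q / 2) < f (v + A x) := by
      rwa [← div_eq_inv_mul, lt_div_iff₀ hM, mul_comm] at h4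
    have h6 : k < f (v + A x) ^ q⁻¹ * f (v + A z) ^ (1 - q⁻¹) := by
      calc k = M * Real.exp (-q / 2 * q⁻¹ - 1 / 2) := by
            rw [hk]
            congr 2
            field_simp
            norm_num
        _ ≤ M * Real.exp (-q / 2 * q⁻¹ + -(1 / 2) * (1 - q⁻¹)) := by
            gcongr
            linarith
        _ = (M * Real.exp (-q / 2)) ^ q⁻¹ * (M * Real.exp (-(1 / 2))) ^ (1 - q⁻¹) := by
            rw [Real.mul_rpow hM.le (Real.exp_pos _).le, Real.mul_rpow hM.le (Real.exp_pos _).le,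
              ← Real.exp_mul, ← Real.exp_mul, Real.exp_add]
            have : M = M ^ q⁻¹ * M ^ (1 - q⁻¹) := by rw [← Real.rpow_add hM]; simp
            conv_lhs => rw [this]
            ring
        _ < _ := by
            rw [hAz]
            exact mul_lt_mul'' (Real.rpow_lt_rpow (by positivity) h5 hqi0)
              (Real.rpow_lt_rpow (by positivity) hx₀ (by linarith)) (by positivity) (by positivity)
    linarith

end NormalPosition

/-! ### Affine invariance and renormalization -/

section AffineChange
variable {d : ℕ}

/-- The sieve is closed under affine substitution and positive scaling with the same number of
pieces; this removes the normalizing map from the estimator. -/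
theorem exists_cappedExp_comp_affine {ι : Type*} [Finite ι] [Nonempty ι]
    (a : ι → EuclideanSpace ℝ (Fin d) × ℝ) (b s : ℝ)
    (B : EuclideanSpace ℝ (Fin d) →L[ℝ] EuclideanSpace ℝ (Fin d)) (w : EuclideanSpace ℝ (Fin d)) :
    ∃ a' : ι → EuclideanSpace ℝ (Fin d) × ℝ, ∃ b', ∀ y,
      cappedExp a' b' y = Real.exp s * cappedExp a b (B (y - w)) := by
  refine ⟨fun j => (B.adjoint (a j).1, (a j).2 - inner ℝ (B w) (a j).1 + s), b + s, fun y => ?_⟩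
  have h1 : ∀ j, affineEval y (B.adjoint (a j).1, (a j).2 - inner ℝ (B w) (a j).1 + s) =
      affineEval (B (y - w)) (a j) + s := fun j => by
    rw [affineEval_apply, affineEval_apply, ContinuousLinearMap.adjoint_inner_right, map_sub,
      inner_sub_left]
    ring
  have h2 : (∀ j, b + s ≤ affineEval y (B.adjoint (a j).1, (a j).2 - inner ℝ (B w) (a j).1 + s)) ↔
      ∀ j, b ≤ affineEval (B (y - w)) (a j) := by simp only [h1, add_le_add_iff_right]
  by_cases h : ∀ j, b ≤ affineEval (B (y - w)) (a j)
  · rw [cappedExp, cappedExp, if_pos h, if_pos (h2.2 h), ← Real.exp_add, add_comm s,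
      ciInf_add (Set.finite_range _).bddBelow]
    simp only [h1]
  · rw [cappedExp, cappedExp, if_neg h, if_neg (h ∘ h2.1), mul_zero]

theorem exists_map_affine_eq_smul (A : EuclideanSpace ℝ (Fin d) ≃L[ℝ] EuclideanSpace ℝ (Fin d))
    (v : EuclideanSpace ℝ (Fin d)) :
    ∃ κ : ℝ, 0 < κ ∧ Measure.map (fun x => v + A x) volume =
      ENNReal.ofReal κ • (volume : Measure (EuclideanSpace ℝ (Fin d))) := by
  have hdet : LinearMap.det (A : EuclideanSpace ℝ (Fin d) →ₗ[ℝ] EuclideanSpace ℝ (Fin d)) ≠ 0 :=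
    A.toLinearEquiv.isUnit_det'.ne_zero
  refine ⟨_, abs_pos.2 (inv_ne_zero hdet), ?_⟩
  rw [← Measure.map_linearMap_addHaar_eq_smul_addHaar volume hdet]
  have h : (fun x => v + A x) = (fun x => v + x) ∘ A := rfl
  rw [h, ← Measure.map_map (measurable_const_add v) A.continuous.measurable]
  have h2 := Measure.map_linearMap_addHaar_eq_smul_addHaar
    (volume : Measure (EuclideanSpace ℝ (Fin d))) hdet
  have h3 : Measure.map A volume = Measure.map
    (A : EuclideanSpace ℝ (Fin d) →ₗ[ℝ] EuclideanSpace ℝ (Fin d)) volume := rfl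
  rw [h3, h2, Measure.map_smul, map_add_left_eq_self]

/-- Every log-concave density is close to a density of capped exponential form. -/
theorem exists_cappedExpDensities_tvDist_le (hd : 0 < d) :
    ∃ C : ℝ, 0 < C ∧ ∀ f ∈ logConcaveDensities d,
      ∀ (T : ℝ) (m : ℕ) (ρ η : ℝ), 3 ≤ T → 0 < m → 0 < ρ → Real.sqrt (d + 1) * (6 / m) ≤ ρ →
        ρ ≤ 1 → 0 < η → 4 * ρ ^ 2 * (16 * T) ≤ η * (1 / (2 * d)) → (d + 2) * η ≤ 1 →
        C * (η + Real.exp (-T / 2)) ≤ 1 / 2 →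
        ∃ g ∈ cappedExpDensities d (CubeFaceCell d m),
          tvDist g f ≤ ENNReal.ofReal (C * (η + Real.exp (-T / 2))) := by
  have hd' : (1 : ℝ) ≤ d := by exact_mod_cast hd
  obtain ⟨C, hC, happ⟩ := exists_cappedExp_integral_sub_le hd (r := 1 / (2 * d)) (by positivity)
    (by rw [div_le_one (by positivity)]; linarith)
  refine ⟨C, hC, fun f hf T m ρ η hT hm hρ0 hρ hρ1 hη0 hη hdη hhalf => ?_⟩
  obtain ⟨A, v, M, hM, hF⟩ := exists_normalizedLogConcave hd hf
  obtain ⟨κ, hκ, hmap⟩ := exists_map_affine_eq_smul A v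
  set F := fun x => M⁻¹ * f (v + A x) with hFdef
  set φ : EuclideanSpace ℝ (Fin d) → EuclideanSpace ℝ (Fin d) := fun x => v + A x with hφ
  have hφe : MeasurableEmbedding φ :=
    (A.toHomeomorph.trans (Homeomorph.addLeft v)).measurableEmbedding
  have hφm : Measurable φ := hφe.measurable
  have hint : ∀ h : EuclideanSpace ℝ (Fin d) → ℝ, ∫ x, h (φ x) = κ * ∫ x, h x := fun h => by
    rw [← hφe.integral_map, hmap, integral_smul_measure, ENNReal.toReal_ofReal hκ.le, smul_eq_mul]
  have hFm : AEMeasurable F := by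
    refine AEMeasurable.const_mul (AEMeasurable.comp_aemeasurable ?_ hφm.aemeasurable) _
    rw [hmap]
    exact hf.1.aemeasurable.smul_measure _
  obtain ⟨a, hgi, hga⟩ := happ _ F hF hFm T m ρ η hT hm hρ0 hρ hρ1 hη0 hη hdη
  set δ := C * (η + Real.exp (-T / 2)) with hδ
  set G : EuclideanSpace ℝ (Fin d) → ℝ := fun y => M * cappedExp a (-T) (A.symm (y - v)) with hG
  have hGφ : ∀ x, G (φ x) = M * cappedExp a (-T) x := fun x => by
    simp only [hG, hφ, add_sub_cancel_left, ContinuousLinearEquiv.symm_apply_apply]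
  have hfφ : ∀ x, f (φ x) = M * F x := fun x => by
    rw [hFdef]
    simp only
    rw [mul_inv_cancel_left₀ hM.ne']
  have hG0 : ∀ y, 0 ≤ G y := fun y => mul_nonneg hM.le (cappedExp_nonneg _ _ _)
  have hGm : Measurable G := by
    refine ((measurable_cappedExp a (-T)).comp ?_).const_mul M
    exact A.symm.continuous.measurable.comp (measurable_sub_const v)
  have hGi : Integrable G := by
    have h1 : Integrable (G ∘ φ) := (hgi.const_mul M).congr (ae_of_all _ fun x => (hGφ x).symm)
    rw [← hφe.integrable_map_iff, hmap, integrable_smul_measure (by simpa using hκ) (by simp)] at h1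
    exact h1
  have hfi := hf.1.integrable
  have hfG : ∫ y, |f y - G y| ≤ δ := by
    have h1 := hint fun y => |f y - G y|
    have h2 := hint f
    simp only [hfφ, hGφ, ← mul_sub, abs_mul, abs_of_pos hM, integral_const_mul,
      hf.1.integral_eq_one, mul_one] at h1 h2
    have h3 : κ * ∫ y, |f y - G y| ≤ κ * δ := by
      rw [← h1, ← h2, mul_assoc, mul_comm _ δ]
      exact mul_le_mul_of_nonneg_left hga hM.le
    exact le_of_mul_le_mul_left h3 hκ
  set Z := ∫ y, G y with hZ
  have hZ1 : |Z - 1| ≤ δ := by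
    rw [hZ, ← hf.1.integral_eq_one, ← integral_sub hGi hfi]
    refine abs_integral_le_integral_abs.trans (le_trans (le_of_eq ?_) hfG)
    simp only [abs_sub_comm]
  have hZ0 : 0 < Z := by linarith [(abs_le.1 hZ1).1]
  obtain ⟨a', b', hab⟩ := exists_cappedExp_comp_affine a (-T) (Real.log (M / Z))
    (A.symm : EuclideanSpace ℝ (Fin d) →L[ℝ] EuclideanSpace ℝ (Fin d)) v
  have hgG : ∀ y, cappedExp a' b' y = Z⁻¹ * G y := fun y => by
    rw [hab, Real.exp_log (by positivity), hG]
    simp only [ContinuousLinearEquiv.coe_coe]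
    ring
  have hgd : IsProbDensity (cappedExp a' b') := by
    refine ⟨(measurable_cappedExp _ _).aemeasurable, cappedExp_nonneg _ _, ?_⟩
    simp only [hgG]
    rw [← ofReal_integral_eq_lintegral_ofReal (hGi.const_mul _)
      (ae_of_all _ fun y => mul_nonneg (by positivity) (hG0 y)), integral_const_mul, ← hZ,
      inv_mul_cancel₀ hZ0.ne', ENNReal.ofReal_one]
  refine ⟨_, ⟨hgd, a', b', rfl⟩, ?_⟩
  rw [tvDist_eq_ofReal hgd hf.1]
  refine ENNReal.ofReal_le_ofReal ?_
  have hle : ∫ y, |cappedExp a' b' y - f y| ≤ ∫ y, (|Z⁻¹ - 1| * G y + |f y - G y|) := by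
    refine integral_mono (hgd.integrable.sub hfi).abs
      ((hGi.const_mul _).add (hfi.sub hGi).abs) fun y => ?_
    simp only [hgG]
    rw [abs_sub_comm (f y)]
    calc |Z⁻¹ * G y - f y| = |(Z⁻¹ - 1) * G y + (G y - f y)| := by ring_nf
      _ ≤ |(Z⁻¹ - 1) * G y| + |G y - f y| := abs_add_le _ _
      _ = _ := by rw [abs_mul, abs_of_nonneg (hG0 y)]
  have hfGi : Integrable fun y => |f y - G y| := (hfi.sub hGi).abs
  rw [integral_add (hGi.const_mul _) hfGi, integral_const_mul, ← hZ] at hle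
  -- Renormalizing costs another `δ` in `L¹`; the factor `1 / 2` in total variation brings `2 δ`
  -- back to `δ`.
  have h5 : |Z⁻¹ - 1| * Z = |Z - 1| := by
    rw [← abs_of_pos hZ0, ← abs_mul, abs_of_pos hZ0, sub_mul, inv_mul_cancel₀ hZ0.ne', one_mul,
      abs_sub_comm]
  linarith

end AffineChange

/-! ### Risk of the estimator over the sieve -/

section UpperBound
variable {d : ℕ}

theorem logConcaveDensities_nonempty (d : ℕ) : (logConcaveDensities d).Nonempty := by
  classical
  set B := Metric.closedBall (0 : EuclideanSpace ℝ (Fin d)) 1 with hB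
  set V := volume.real B with hV
  have hV0 : 0 < V := volumeReal_closedBall_pos _ one_pos
  set f : EuclideanSpace ℝ (Fin d) → ℝ := B.indicator fun _ => V⁻¹ with hf
  have hf0 : ∀ x, 0 ≤ f x := fun x => Set.indicator_nonneg (fun _ _ => by positivity) x
  refine ⟨f, ⟨?_, hf0, ?_⟩, fun x y t ht0 ht1 => ?_⟩
  · exact (measurable_const.indicator measurableSet_closedBall).aemeasurable
  · have h1 : ∀ x, ENNReal.ofReal (f x) = B.indicator (fun _ => ENNReal.ofReal V⁻¹) x := fun x => by
      by_cases hx : x ∈ B <;> simp [hf, hx]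
    simp only [h1]
    rw [lintegral_indicator measurableSet_closedBall, setLIntegral_const, hV,
      ENNReal.ofReal_inv_of_pos hV0, ofReal_measureReal measure_closedBall_lt_top.ne]
    exact ENNReal.inv_mul_cancel (Metric.measure_closedBall_pos volume _ one_pos).ne'
      measure_closedBall_lt_top.ne
  · by_cases hx : x ∈ B
    · by_cases hy : y ∈ B
      · have hxy : t • x + (1 - t) • y ∈ B :=
          convex_closedBall _ _ hx hy ht0.le (by linarith) (by ring)
        simp only [hf, Set.indicator_of_mem hx, Set.indicator_of_mem hy, Set.indicator_of_mem hxy]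
        rw [← Real.rpow_add (by positivity)]
        simp
      · have : f y = 0 := Set.indicator_of_notMem hy _
        rw [this, Real.zero_rpow (by linarith), mul_zero]
        exact hf0 _
    · have : f x = 0 := Set.indicator_of_notMem hx _
      rw [this, Real.zero_rpow ht0.ne', zero_mul]
      exact hf0 _

/-- The bound on the number of traces on `2n` points of comparisons of capped exponentials with `k`
pieces. -/
def cappedExpTraceBound (d n k : ℕ) : ℕ :=
  (2 * n * (k * k + (k + k)) + 1) ^ (2 * (k * (d + 1) + 1))

theorem exists_estimator_of_cappedExp_approx {n : ℕ} (hn : 0 < n) {ι : Type*} [Fintype ι]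
    [Nonempty ι] {ε η : ℝ} (hε : 0 ≤ ε) (hη : 0 < η)
    (happ : ∀ f ∈ logConcaveDensities d, ∃ g ∈ cappedExpDensities d ι,
      tvDist g f ≤ ENNReal.ofReal ε) :
    ∃ est : Estimator d n, (∀ X, IsProbDensity (est.toFun X)) ∧
      riskTV est (logConcaveDensities d) ≤ ENNReal.ofReal (3 * (ε + η) +
        2 * Real.sqrt (2 * Real.log (2 * cappedExpTraceBound d n (Fintype.card ι)) / n) + η) := by
  have hne : (cappedExpDensities d ι).Nonempty := by
    obtain ⟨f, hf⟩ := logConcaveDensities_nonempty d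
    obtain ⟨g, hg, -⟩ := happ f hf
    exact ⟨g, hg⟩
  obtain ⟨g, hgF, hgd⟩ := exists_dense_sequence_of_densities (F := cappedExpDensities d ι)
    (fun f hf => hf.1) hne
  have hgm : ∀ i, Measurable (g i) := fun i => by
    obtain ⟨-, a, b, h⟩ := hgF i
    rw [h]
    exact measurable_cappedExp a b
  obtain ⟨est, hest, hrisk⟩ := exists_minimumDistance_estimator hn g hgm (fun i => (hgF i).1)
    (S := cappedExpTraceBound d n (Fintype.card ι)) (fun z => by
      have := ncard_traces_cappedExp_le (d := d) (ι := ι) z (fun p : ℕ × ℕ => g p.1)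
        (fun p => g p.2) (fun p => hgF _) (fun p => hgF _)
      rw [Fintype.card_sum, Fintype.card_fin, ← two_mul] at this
      exact this) hη
  refine ⟨est, hest, iSup₂_le fun f hf => ?_⟩
  obtain ⟨h, hh, hhf⟩ := happ f hf
  obtain ⟨i, hi⟩ := hgd h hh (ENNReal.ofReal η) (ENNReal.ofReal_pos.2 hη)
  refine (hrisk f hf.1 i).trans ?_
  have h1 : tvDist (g i) f ≤ ENNReal.ofReal (ε + η) := by
    rw [ENNReal.ofReal_add hε hη.le, add_comm]
    exact (tvDist_triangle (hgm i).aemeasurable hh.1.aemeasurable).trans (add_le_add hi hhf)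
  rw [ENNReal.ofReal_add (by positivity) hη.le, ENNReal.ofReal_add (by positivity) (by positivity),
    ENNReal.ofReal_mul (by norm_num), ENNReal.ofReal_mul (by norm_num)]
  simp only [ENNReal.ofReal_ofNat]
  gcongr

/-- With `k ≤ n` the base is at most `n ^ 4`, so only the exponent, linear in `k`, matters. -/
theorem log_cappedExpTraceBound_le {n k : ℕ} (hn : 7 ≤ n) (hk : 0 < k) (hkn : k ≤ n) :
    Real.log (2 * cappedExpTraceBound d n k) ≤ (8 * d + 17) * k * Real.log n := by
  have hn' : (7 : ℝ) ≤ n := by exact_mod_cast hn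
  have hk' : (1 : ℝ) ≤ k := by exact_mod_cast hk
  have hL : Real.log 2 ≤ Real.log n := Real.log_le_log (by norm_num) (by linarith)
  have hL0 : 0 < Real.log n := Real.log_pos (by linarith)
  have hbase : 2 * n * (k * k + (k + k)) + 1 ≤ n ^ 4 := by
    have h1 : k * k ≤ n * n := Nat.mul_le_mul hkn hkn
    have h2 : k + k ≤ 2 * n := by omega
    have h3 : 2 * n * (k * k + (k + k)) ≤ 2 * n * (n * n + 2 * n) := by gcongr
    have h4 : 2 * n * (n * n + 2 * n) + 1 ≤ n ^ 4 := by
      nlinarith [sq_nonneg n, pow_pos (by omega : 0 < n) 3]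
    omega
  have hpos : (0 : ℝ) < ((2 * n * (k * k + (k + k)) + 1 : ℕ) : ℝ) := by positivity
  rw [cappedExpTraceBound, Nat.cast_pow, Real.log_mul (by norm_num) (pow_pos hpos _).ne',
    Real.log_pow]
  have h5 : Real.log ((2 * n * (k * k + (k + k)) + 1 : ℕ) : ℝ) ≤ 4 * Real.log n := by
    have : Real.log ((n : ℝ) ^ 4) = 4 * Real.log n := by rw [Real.log_pow]; norm_num
    rw [← this]
    exact Real.log_le_log hpos (by exact_mod_cast hbase)
  have hd0 : (0 : ℝ) ≤ d := by positivity
  calc Real.log 2 + ((2 * (k * (d + 1) + 1) : ℕ) : ℝ) *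
        Real.log ((2 * n * (k * k + (k + k)) + 1 : ℕ) : ℝ)
      ≤ Real.log n + ((2 * (k * (d + 1) + 1) : ℕ) : ℝ) * (4 * Real.log n) := by gcongr
    _ = (1 + 8 * (k * (d + 1) + 1)) * Real.log n := by push_cast; ring
    _ ≤ (8 * d + 17) * k * Real.log n := by
        refine mul_le_mul_of_nonneg_right ?_ hL0.le
        nlinarith

end UpperBound

/-! ### Choice of parameters and the upper rate -/

section UpperRate

theorem card_cubeFaceCell (d m : ℕ) :
    Fintype.card (CubeFaceCell d m) = (d + 1) * (2 * (m + 1) ^ d) := by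
  simp [CubeFaceCell]

set_option maxHeartbeats 800000 in
/-- The minimum distance estimator over capped exponentials attains the rate `n ^ (-2 / (d + 4))` up
to a logarithmic factor. -/
theorem exists_estimator_riskTV_le {d : ℕ} (hd : 2 ≤ d) :
    ∃ C : ℝ, 0 < C ∧ ∃ N : ℕ, ∀ n : ℕ, N ≤ n → ∃ est : Estimator d n,
      (∀ X : Fin n → EuclideanSpace ℝ (Fin d), IsProbDensity (est.toFun X)) ∧
      riskTV est (logConcaveDensities d) ≤ ENNReal.ofReal
        (C * Real.log (n : ℝ) ^ ((d : ℝ) * ((d : ℝ) + 1) / ((d : ℝ) + 4))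
          * (n : ℝ) ^ (-(2 : ℝ) / ((d : ℝ) + 4))) := by
  have hd2 : (2 : ℝ) ≤ d := by exact_mod_cast hd
  obtain ⟨C₀, hC₀, happ⟩ := exists_cappedExpDensities_tvDist_le (d := d) (by omega)
  set α : ℝ := 2 / ((d : ℝ) + 4) with hα
  have hα0 : 0 < α := by positivity
  set q : ℝ := Real.sqrt (256 * d * α) with hq
  have hq0 : 0 < q := Real.sqrt_pos.2 (by positivity)
  have hs0 : 1 ≤ Real.sqrt (d + 1) := Real.one_le_sqrt.2 (by linarith)
  set c₃ : ℝ := (d + 1) * (2 * (8 * Real.sqrt (d + 1) * q) ^ d) with hc₃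
  have hc₃0 : 0 < c₃ := by positivity
  set c₄ : ℝ := 2 * (8 * d + 17) * c₃ with hc₄
  have hc₄0 : 0 < c₄ := by positivity
  have hlog : Filter.Tendsto (fun n : ℕ => Real.log n) Filter.atTop Filter.atTop :=
    Real.tendsto_log_atTop.comp tendsto_natCast_atTop_atTop
  have hεt : Filter.Tendsto (fun n : ℕ => (n : ℝ) ^ (-α)) Filter.atTop (nhds 0) :=
    (tendsto_rpow_neg_atTop hα0).comp tendsto_natCast_atTop_atTop
  have hlo : ∀ᶠ n : ℕ in Filter.atTop, c₃ * Real.log n ^ ((d : ℝ) / 2) ≤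
      (n : ℝ) ^ (4 / ((d : ℝ) + 4)) := by
    have h1 := (isLittleO_log_rpow_rpow_atTop ((d : ℝ) / 2)
      (show 0 < 4 / ((d : ℝ) + 4) by positivity)).bound (show 0 < 1 / c₃ by positivity)
    filter_upwards [tendsto_natCast_atTop_atTop.eventually h1, hlog.eventually_ge_atTop 0]
      with n hn hL
    rw [Real.norm_of_nonneg (Real.rpow_nonneg hL _),
      Real.norm_of_nonneg (Real.rpow_nonneg n.cast_nonneg _), one_div, ← div_eq_inv_mul,
      le_div_iff₀ hc₃0] at hn
    linarith
  obtain ⟨N, hN⟩ := Filter.eventually_atTop.1 <|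
    (Filter.eventually_ge_atTop 7).and <| (hlog.eventually_ge_atTop (max 1 (3 / (2 * α)))).and <|
    (hεt.eventually_le_const (show 0 < 1 / ((d : ℝ) + 2) by positivity)).and <|
    (hεt.eventually_le_const (show 0 < 1 / (4 * C₀) by positivity)).and <|
    (hεt.eventually_le_const (show 0 < q by positivity)).and hlo
  refine ⟨3 * (2 * C₀ + 1) + 2 * Real.sqrt c₄ + 1, by positivity, N, fun n hn => ?_⟩
  obtain ⟨hn7, hLmax, hε1, hε2, -, hlo⟩ := hN n hn
  set L := Real.log n with hLdef
  have hL1 : 1 ≤ L := (le_max_left _ _).trans hLmax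
  have hL0 : 0 < L := by linarith
  have hn7' : (7 : ℝ) ≤ n := by exact_mod_cast hn7
  have hn0 : (0 : ℝ) < n := by linarith
  set ε := (n : ℝ) ^ (-α) with hε
  have hε0 : 0 < ε := Real.rpow_pos_of_pos hn0 _
  -- Makes the truncation error `exp (-T / 2)` equal to `ε`.
  set T := 2 * α * L with hT
  have hT3 : 3 ≤ T := by
    have := (le_max_right _ _).trans hLmax
    rw [div_le_iff₀ (by positivity)] at this
    linarith
  have hexpT : Real.exp (-T / 2) = ε := by
    rw [hε, Real.rpow_def_of_pos hn0, hT]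
    congr 1
    ring
  -- `u⁻¹` is the mesh bound `ρ`; the constant `q` gives equality in `4 ρ ^ 2 (16 T) ≤ ε / (2 d)`.
  set u := q * L ^ (1 / 2 : ℝ) * (n : ℝ) ^ (α / 2) with hu
  have hu0 : 0 < u := by positivity
  have hu2 : u ^ 2 = 256 * d * α * L * ε⁻¹ := by
    rw [hu, mul_pow, mul_pow, hq, Real.sq_sqrt (by positivity), ← Real.rpow_natCast,
      ← Real.rpow_natCast, ← Real.rpow_mul hL0.le, ← Real.rpow_mul hn0.le, hε, Real.rpow_neg hn0.le,
      inv_inv]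
    norm_num
  have hu1 : 1 ≤ u := by
    have h1 : 1 ≤ u ^ 2 := by
      rw [hu2, ← div_eq_mul_inv, le_div_iff₀ hε0]
      have h2 : ε ≤ 1 := hε1.trans (by rw [div_le_one (by positivity)]; linarith)
      have h3 : 1 ≤ d * T := by nlinarith only [hd2, hT3]
      have h4 : 256 * d * α * L = 128 * (d * T) := by rw [hT]; ring
      linarith
    nlinarith only [h1, hu0]
  set m := ⌈6 * Real.sqrt (d + 1) * u⌉₊ with hm
  have hm0 : 0 < m := Nat.ceil_pos.2 (by positivity)
  have hm1 : (m : ℝ) + 1 ≤ 8 * Real.sqrt (d + 1) * u := by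
    have h1 := (Nat.ceil_lt_add_one (show 0 ≤ 6 * Real.sqrt (d + 1) * u by positivity)).le
    have h2 : 1 ≤ Real.sqrt (d + 1) * u := one_le_mul_of_one_le_of_one_le hs0 hu1
    linarith
  have hρ : Real.sqrt (d + 1) * (6 / m) ≤ u⁻¹ := by
    have h1 := Nat.le_ceil (6 * Real.sqrt (d + 1) * u)
    rw [← hm] at h1
    have hm' : (0 : ℝ) < m := by exact_mod_cast hm0
    rw [le_inv_comm₀ (by positivity) hu0, mul_div_assoc', inv_div, le_div_iff₀ (by positivity)]
    linarith
  have hηr : 4 * u⁻¹ ^ 2 * (16 * T) ≤ ε * (1 / (2 * d)) := by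
    rw [inv_pow, hu2, hT]
    refine le_of_eq ?_
    field_simp
    norm_num
  have hcond : C₀ * (ε + Real.exp (-T / 2)) ≤ 1 / 2 := by
    rw [hexpT]
    rw [le_div_iff₀ (by positivity)] at hε2
    linarith
  have hdε : ((d : ℝ) + 2) * ε ≤ 1 := by
    rw [le_div_iff₀ (by positivity)] at hε1
    linarith
  obtain ⟨est, hest, hrisk⟩ := exists_estimator_of_cappedExp_approx (d := d) (n := n) (by omega)
    (ι := CubeFaceCell d m) (ε := C₀ * (ε + Real.exp (-T / 2))) (by positivity) hε0
    (fun f hf => happ f hf T m u⁻¹ ε hT3 hm0 (by positivity) hρ (inv_le_one_of_one_le₀ hu1) hε0 hηr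
      hdε hcond)
  refine ⟨est, hest, hrisk.trans (ENNReal.ofReal_le_ofReal ?_)⟩
  set k := Fintype.card (CubeFaceCell d m) with hk
  have hk0 : 0 < k := Fintype.card_pos
  have hkle : (k : ℝ) ≤ c₃ * (L ^ ((d : ℝ) / 2) * (n : ℝ) ^ ((d : ℝ) / (d + 4))) := by
    rw [hk, card_cubeFaceCell]
    push_cast
    calc ((d : ℝ) + 1) * (2 * ((m : ℝ) + 1) ^ d)
        ≤ (d + 1) * (2 * (8 * Real.sqrt (d + 1) * u) ^ d) := by gcongr
      _ = c₃ * ((L ^ (1 / 2 : ℝ)) ^ d * ((n : ℝ) ^ (α / 2)) ^ d) := by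
          rw [hc₃, hu]
          simp only [mul_pow]
          ring
      _ = _ := by
          rw [← Real.rpow_natCast (L ^ (1 / 2 : ℝ)), ← Real.rpow_natCast ((n : ℝ) ^ (α / 2)),
            ← Real.rpow_mul hL0.le, ← Real.rpow_mul hn0.le]
          congr 3
          · ring
          · rw [hα]; ring
  have hkn : k ≤ n := by
    have h1 : (k : ℝ) ≤ n := by
      calc (k : ℝ) ≤ c₃ * L ^ ((d : ℝ) / 2) * (n : ℝ) ^ ((d : ℝ) / (d + 4)) := by
            rw [mul_assoc]; exact hkle
        _ ≤ (n : ℝ) ^ (4 / ((d : ℝ) + 4)) * (n : ℝ) ^ ((d : ℝ) / (d + 4)) := by gcongr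
        _ = n := by
            rw [← Real.rpow_add hn0, ← add_div, add_comm, div_self (by positivity), Real.rpow_one]
    exact_mod_cast h1
  have hsqrt : Real.sqrt (2 * Real.log (2 * cappedExpTraceBound d n k) / n) ≤
      Real.sqrt c₄ * (L ^ (((d : ℝ) + 2) / 4) * ε) := by
    rw [Real.sqrt_le_left (by positivity), mul_pow, Real.sq_sqrt hc₄0.le, div_le_iff₀ hn0]
    have h1 := log_cappedExpTraceBound_le (d := d) hn7 hk0 hkn
    have h2 : (L ^ (((d : ℝ) + 2) / 4) * ε) ^ 2 * n =
        L ^ ((d : ℝ) / 2) * (n : ℝ) ^ ((d : ℝ) / (d + 4)) * L := by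
      rw [mul_pow, ← Real.rpow_natCast, ← Real.rpow_mul hL0.le, hε, ← Real.rpow_natCast,
        ← Real.rpow_mul hn0.le]
      have e1 : L ^ (((d : ℝ) + 2) / 4 * (2 : ℕ)) = L ^ ((d : ℝ) / 2) * L := by
        rw [← Real.rpow_add_one hL0.ne']
        congr 1
        push_cast
        ring
      have e2 : (n : ℝ) ^ (-α * (2 : ℕ)) * n = (n : ℝ) ^ ((d : ℝ) / (d + 4)) := by
        rw [← Real.rpow_add_one hn0.ne', hα]
        congr 1
        push_cast
        field_simp
        ring
      rw [e1, mul_assoc, e2]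
      ring
    rw [mul_assoc c₄, h2]
    calc 2 * Real.log (2 * cappedExpTraceBound d n k) ≤ 2 * ((8 * d + 17) * k * L) := by gcongr
      _ ≤ 2 * ((8 * d + 17) * (c₃ * (L ^ ((d : ℝ) / 2) * (n : ℝ) ^ ((d : ℝ) / (d + 4)))) * L) := by
          gcongr
      _ = _ := by rw [hc₄]; ring
  -- After clearing denominators the exponents differ by `(d - 2) (3 d + 4)`, so `d ≥ 2` enters
  -- here.
  have hpow : L ^ (((d : ℝ) + 2) / 4) ≤ L ^ ((d : ℝ) * (d + 1) / (d + 4)) := by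
    refine Real.rpow_le_rpow_of_exponent_le hL1 ?_
    rw [div_le_div_iff₀ (by norm_num) (by positivity)]
    nlinarith only [mul_nonneg (sub_nonneg.2 hd2) (by linarith : (0 : ℝ) ≤ 3 * d + 4)]
  have hpow1 : 1 ≤ L ^ ((d : ℝ) * (d + 1) / (d + 4)) := Real.one_le_rpow hL1 (by positivity)
  have hεeq : (n : ℝ) ^ (-(2 : ℝ) / ((d : ℝ) + 4)) = ε := by
    rw [hε, hα, neg_div]
  rw [hexpT, hεeq]
  set W := L ^ ((d : ℝ) * (d + 1) / (d + 4)) with hW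
  calc 3 * (C₀ * (ε + ε) + ε) +
        2 * Real.sqrt (2 * Real.log (2 * cappedExpTraceBound d n k) / n) + ε
      ≤ 3 * (C₀ * (ε + ε) + ε) + 2 * (Real.sqrt c₄ * (W * ε)) + ε := by
        gcongr
        exact hsqrt.trans (by gcongr)
    _ = (3 * (2 * C₀ + 1) + 1) * ε + 2 * Real.sqrt c₄ * (W * ε) := by ring
    _ ≤ (3 * (2 * C₀ + 1) + 1) * (W * ε) + 2 * Real.sqrt c₄ * (W * ε) := by
        gcongr
        exact le_mul_of_one_le_left hε0.le hpow1
    _ = _ := by ring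

end UpperRate

/-! ### Le Cam's two-point method -/

section TwoPoint
variable {Ω : Type*} [MeasurableSpace Ω] {n : ℕ}

theorem lintegral_pi_prod_eq_prod (μ : Measure Ω) [IsProbabilityMeasure μ] {g : Fin n → Ω → ℝ≥0∞}
    (hg : ∀ i, Measurable (g i)) :
    ∫⁻ x, ∏ i, g i (x i) ∂(Measure.pi fun _ : Fin n => μ) = ∏ i, ∫⁻ y, g i y ∂μ := by
  rw [ProbabilityTheory.lintegral_prod_eq_prod_lintegral_of_indepFun Finset.univ
    (fun i (x : Fin n → Ω) => g i (x i))
    (ProbabilityTheory.iIndepFun_pi fun i => (hg i).aemeasurable)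
    fun i => (hg i).comp (measurable_pi_apply i)]
  refine Finset.prod_congr rfl fun i _ => ?_
  have h := measurePreserving_eval (fun _ : Fin n => μ) i
  exact h.lintegral_comp (hg i)

theorem pi_withDensity (μ : Measure Ω) [IsProbabilityMeasure μ] {p : Ω → ℝ≥0∞}
    (hp : Measurable p) [IsProbabilityMeasure (μ.withDensity p)] :
    (Measure.pi fun _ : Fin n => μ.withDensity p) =
      (Measure.pi fun _ : Fin n => μ).withDensity fun x => ∏ i, p (x i) := by
  refine Measure.pi_eq fun s hs => ?_
  rw [withDensity_apply _ (MeasurableSet.univ_pi hs),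
    ← lintegral_indicator (MeasurableSet.univ_pi hs)]
  have h1 : ∀ x : Fin n → Ω, (Set.univ.pi s).indicator (fun x => ∏ i, p (x i)) x =
      ∏ i, (s i).indicator p (x i) := fun x => by
    classical
    by_cases hx : x ∈ Set.univ.pi s
    · rw [Set.indicator_of_mem hx]
      exact Finset.prod_congr rfl fun i _ => (Set.indicator_of_mem (hx i trivial) p).symm
    · rw [Set.indicator_of_notMem hx]
      simp only [Set.mem_univ_pi, not_forall] at hx
      obtain ⟨i, hi⟩ := hx
      exact (Finset.prod_eq_zero (Finset.mem_univ i) (Set.indicator_of_notMem hi p)).symm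
  simp only [h1]
  rw [lintegral_pi_prod_eq_prod μ fun i => hp.indicator (hs i)]
  refine Finset.prod_congr rfl fun i _ => ?_
  rw [lintegral_indicator (hs i), withDensity_apply _ (hs i)]

/-- Arithmetic-geometric mean of `2 * min a b` and `max a b / 8`. It bounds the overlap of two
densities below by their affinity, without Cauchy-Schwarz for integrals. -/
theorem sqrt_mul_le_two_mul_min_add {a b : ℝ} (ha : 0 ≤ a) (hb : 0 ≤ b) :
    Real.sqrt (a * b) ≤ 2 * min a b + (a + b) / 8 := by
  have hm : 0 ≤ min a b := le_min ha hb
  rw [Real.sqrt_le_left (by positivity)]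
  rcases le_total a b with h | h
  · rw [min_eq_left h]
    nlinarith [sq_nonneg (2 * a - (a + b) / 8), mul_nonneg ha ha]
  · rw [min_eq_right h]
    nlinarith [sq_nonneg (2 * b - (a + b) / 8), mul_nonneg hb hb]

/-- The gap between the means is `(√a - √b) ^ 2 / 2 = (a - b) ^ 2 / (2 (√a + √b) ^ 2)`, and `(√a +
√b) ^ 2 ≥ 2`. Thus an `L²` bound controls Hellinger distance for densities bounded below. -/
theorem sqrt_mul_ge_of_half_le {a b : ℝ} (ha : 1 / 2 ≤ a) (hb : 1 / 2 ≤ b) :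
    (a + b) / 2 - (a - b) ^ 2 / 4 ≤ Real.sqrt (a * b) := by
  have ha0 : 0 ≤ a := by linarith
  have hb0 : 0 ≤ b := by linarith
  rw [Real.sqrt_mul ha0]
  set u := Real.sqrt a
  set v := Real.sqrt b
  have hu : u ^ 2 = a := Real.sq_sqrt ha0
  have hv : v ^ 2 = b := Real.sq_sqrt hb0
  have hu0 : 0 ≤ u := Real.sqrt_nonneg _
  have hv0 : 0 ≤ v := Real.sqrt_nonneg _
  have huv : 1 / 2 ≤ u * v := by
    by_contra! h
    nlinarith [mul_nonneg hu0 hv0]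
  have h2 : 2 ≤ (u + v) ^ 2 := by nlinarith
  have h3 : (u - v) ^ 2 * 2 ≤ (u - v) ^ 2 * (u + v) ^ 2 :=
    mul_le_mul_of_nonneg_left h2 (sq_nonneg _)
  have h4 : (u - v) ^ 2 * (u + v) ^ 2 = (a - b) ^ 2 := by rw [← hu, ← hv]; ring
  nlinarith

theorem ofReal_prod_sqrt_le (a b : Fin n → ℝ) (ha : ∀ i, 0 ≤ a i) (hb : ∀ i, 0 ≤ b i) :
    ∏ i, ENNReal.ofReal (Real.sqrt (a i * b i)) ≤
      2 * min (∏ i, ENNReal.ofReal (a i)) (∏ i, ENNReal.ofReal (b i)) +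
        (∏ i, ENNReal.ofReal (a i) + ∏ i, ENNReal.ofReal (b i)) / 8 := by
  have hA : 0 ≤ ∏ i, a i := Finset.prod_nonneg fun i _ => ha i
  have hB : 0 ≤ ∏ i, b i := Finset.prod_nonneg fun i _ => hb i
  have h1 : ∏ i, Real.sqrt (a i * b i) = Real.sqrt ((∏ i, a i) * ∏ i, b i) := by
    rw [← Finset.prod_mul_distrib, Real.sqrt_eq_iff_eq_sq
      (Finset.prod_nonneg fun i _ => mul_nonneg (ha i) (hb i))
      (Finset.prod_nonneg fun i _ => Real.sqrt_nonneg _) |>.2]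
    rw [← Finset.prod_pow]
    exact Finset.prod_congr rfl fun i _ => (Real.sq_sqrt (mul_nonneg (ha i) (hb i))).symm
  rw [← ENNReal.ofReal_prod_of_nonneg fun i _ => Real.sqrt_nonneg _,
    ← ENNReal.ofReal_prod_of_nonneg fun i _ => ha i,
    ← ENNReal.ofReal_prod_of_nonneg fun i _ => hb i, h1]
  refine (ENNReal.ofReal_le_ofReal (sqrt_mul_le_two_mul_min_add hA hB)).trans (le_of_eq ?_)
  rw [ENNReal.ofReal_add (mul_nonneg (by norm_num) (le_min hA hB)) (by positivity),
    ENNReal.ofReal_mul (by norm_num), ENNReal.ofReal_div_of_pos (by norm_num),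
    ENNReal.ofReal_add hA hB, (ENNReal.ofReal_mono).map_min]
  simp

/-- Le Cam's two-point bound: two product measures with close Hellinger affinity cannot both have
small expected loss when the losses add up to at least `D`. -/
theorem le_add_lintegral_pi_of_affinity (hn : 0 < n) (μ : Measure Ω) [IsProbabilityMeasure μ]
    {p q : Ω → ℝ} (hp : Measurable p) (hq : Measurable q)
    (hpn : ∀ x, 0 ≤ p x) (hqn : ∀ x, 0 ≤ q x) (hp0 : ∀ᵐ x ∂μ, 1 / 2 ≤ p x)
    (hq0 : ∀ᵐ x ∂μ, 1 / 2 ≤ q x) (hpi : Integrable p μ) (hqi : Integrable q μ)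
    (hp1 : ∫ x, p x ∂μ = 1) (hq1 : ∫ x, q x ∂μ = 1)
    (hpq : Integrable (fun x => (p x - q x) ^ 2) μ)
    (hclose : ∫ x, (p x - q x) ^ 2 ∂μ ≤ 2 / n)
    {l l' : (Fin n → Ω) → ℝ≥0∞} (hl : Measurable l) (hl' : Measurable l') {D : ℝ≥0∞}
    (hD : ∀ X, D ≤ l X + l' X) :
    D / 8 ≤ (∫⁻ X, l X ∂(Measure.pi fun _ : Fin n => μ.withDensity fun x => ENNReal.ofReal (p x))) +
      ∫⁻ X, l' X ∂(Measure.pi fun _ : Fin n => μ.withDensity fun x => ENNReal.ofReal (q x)) := by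
  have hn' : (0 : ℝ) < n := by exact_mod_cast hn
  have hone : ∀ {g : Ω → ℝ}, (∀ x, 0 ≤ g x) → Integrable g μ → ∫ x, g x ∂μ = 1 →
      ∫⁻ x, ENNReal.ofReal (g x) ∂μ = 1 := fun h0 hi h1 => by
    rw [← ofReal_integral_eq_lintegral_ofReal hi (ae_of_all _ h0), h1, ENNReal.ofReal_one]
  have hprob : ∀ {g : Ω → ℝ}, (∀ x, 0 ≤ g x) → Integrable g μ → ∫ x, g x ∂μ = 1 →
      IsProbabilityMeasure (μ.withDensity fun x => ENNReal.ofReal (g x)) := fun h0 hi h1 =>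
    ⟨by rw [withDensity_apply _ MeasurableSet.univ, setLIntegral_univ, hone h0 hi h1]⟩
  have := hprob hpn hpi hp1
  have := hprob hqn hqi hq1
  set ν := Measure.pi fun _ : Fin n => μ with hν
  set a : (Fin n → Ω) → ℝ≥0∞ := fun X => ∏ i, ENNReal.ofReal (p (X i)) with ha
  set b : (Fin n → Ω) → ℝ≥0∞ := fun X => ∏ i, ENNReal.ofReal (q (X i)) with hb
  have ham : Measurable a := Finset.measurable_prod _ fun i _ =>
    (hp.comp (measurable_pi_apply i)).ennreal_ofReal
  have hbm : Measurable b := Finset.measurable_prod _ fun i _ =>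
    (hq.comp (measurable_pi_apply i)).ennreal_ofReal
  have habm : Measurable fun X => a X + b X := ham.add hbm
  have ha1 : ∫⁻ X, a X ∂ν = 1 := by
    rw [ha, hν, lintegral_pi_prod_eq_prod μ fun i => hp.ennreal_ofReal, hone hpn hpi hp1]
    simp
  have hb1 : ∫⁻ X, b X ∂ν = 1 := by
    rw [hb, hν, lintegral_pi_prod_eq_prod μ fun i => hq.ennreal_ofReal, hone hqn hqi hq1]
    simp
  have hsqm : Measurable fun x => Real.sqrt (p x * q x) := (hp.mul hq).sqrt
  have hsqi : Integrable (fun x => Real.sqrt (p x * q x)) μ := by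
    refine (hpi.add hqi).mono' hsqm.aestronglyMeasurable (ae_of_all _ fun x => ?_)
    rw [Real.norm_of_nonneg (Real.sqrt_nonneg _)]
    simp only [Pi.add_apply]
    rw [Real.sqrt_le_left (add_nonneg (hpn x) (hqn x))]
    nlinarith [hpn x, hqn x, mul_nonneg (hpn x) (hqn x)]
  have haff : 1 - 1 / (2 * n) ≤ ∫ x, Real.sqrt (p x * q x) ∂μ := by
    have h1 : Integrable (fun x => (p x + q x) / 2) μ := (hpi.add hqi).div_const 2
    have h2 : Integrable (fun x => (p x - q x) ^ 2 / 4) μ := hpq.div_const 4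
    have h3 : ∫ x, ((p x + q x) / 2 - (p x - q x) ^ 2 / 4) ∂μ =
        1 - (∫ x, (p x - q x) ^ 2 ∂μ) / 4 := by
      rw [integral_sub h1 h2, integral_div, integral_div, integral_add hpi hqi, hp1, hq1]
      norm_num
    calc 1 - 1 / (2 * (n : ℝ)) = 1 - 2 / n / 4 := by field_simp; ring
      _ ≤ 1 - (∫ x, (p x - q x) ^ 2 ∂μ) / 4 := by gcongr
      _ ≤ _ := by
        rw [← h3]
        refine integral_mono_ae (h1.sub h2) hsqi ?_
        filter_upwards [hp0, hq0] with x hx hx'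
        exact sqrt_mul_ge_of_half_le hx hx'
  have hlow : ENNReal.ofReal (1 / 2) ≤ ∫⁻ X, ∏ i, ENNReal.ofReal
      (Real.sqrt (p (X i) * q (X i))) ∂ν := by
    rw [hν, lintegral_pi_prod_eq_prod μ (g := fun _ x => ENNReal.ofReal (Real.sqrt (p x * q x)))
      fun i => hsqm.ennreal_ofReal, ← ofReal_integral_eq_lintegral_ofReal hsqi
      (ae_of_all _ fun x => Real.sqrt_nonneg _), Finset.prod_const, Finset.card_univ,
      Fintype.card_fin, ← ENNReal.ofReal_pow (integral_nonneg fun x => Real.sqrt_nonneg _)]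
    refine ENNReal.ofReal_le_ofReal ?_
    have hn1 : (1 : ℝ) ≤ n := by exact_mod_cast hn
    have h1 : 1 / (2 * (n : ℝ)) ≤ 1 := by rw [div_le_one (by positivity)]; linarith
    have h2 := one_add_mul_le_pow (a := -(1 / (2 * (n : ℝ)))) (by linarith) n
    calc (1 / 2 : ℝ) = 1 + n * -(1 / (2 * (n : ℝ))) := by field_simp; norm_num
      _ ≤ (1 + -(1 / (2 * (n : ℝ)))) ^ n := h2
      _ ≤ _ := pow_le_pow_left₀ (by linarith) (by linarith) n
  -- The affinity of the product laws is at least `(1 - 1 / (2 n)) ^ n ≥ 1 / 2`; subtracting `(1 +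
  -- 1) / 8` and halving leaves `1 / 8`.
  have hmin : 1 / 8 ≤ ∫⁻ X, min (a X) (b X) ∂ν := by
    have h1 : ENNReal.ofReal (1 / 2) ≤ 2 * (∫⁻ X, min (a X) (b X) ∂ν) + (1 + 1) / 8 := by
      refine hlow.trans ?_
      calc ∫⁻ X, ∏ i, ENNReal.ofReal (Real.sqrt (p (X i) * q (X i))) ∂ν
          ≤ ∫⁻ X, (2 * min (a X) (b X) + (a X + b X) / 8) ∂ν :=
            lintegral_mono fun X => ofReal_prod_sqrt_le (fun i => p (X i)) (fun i => q (X i))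
              (fun i => hpn _) (fun i => hqn _)
        _ = _ := by
            simp only [div_eq_mul_inv]
            rw [lintegral_add_left ((ham.min hbm).const_mul 2),
              lintegral_const_mul _ (ham.min hbm), lintegral_mul_const _ habm,
              lintegral_add_left ham, ha1, hb1]
    have hfin : ∫⁻ X, min (a X) (b X) ∂ν ≠ ⊤ :=
      ((lintegral_mono fun X => min_le_left _ _).trans_lt (ha1 ▸ ENNReal.one_lt_top)).ne
    have h2 := ENNReal.toReal_mono (by finiteness) h1
    rw [ENNReal.toReal_ofReal (by norm_num), ENNReal.toReal_add (by finiteness) (by finiteness),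
      ENNReal.toReal_mul, ENNReal.toReal_div, ENNReal.toReal_add (by simp) (by simp)] at h2
    simp only [ENNReal.toReal_ofNat, ENNReal.toReal_one] at h2
    rw [← ENNReal.toReal_le_toReal (by finiteness) hfin, ENNReal.toReal_div]
    simp only [ENNReal.toReal_ofNat, ENNReal.toReal_one]
    linarith
  rw [pi_withDensity μ hp.ennreal_ofReal, pi_withDensity μ hq.ennreal_ofReal,
    lintegral_withDensity_eq_lintegral_mul _ ham hl,
    lintegral_withDensity_eq_lintegral_mul _ hbm hl',
    ← lintegral_add_left (ham.mul hl)]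
  calc D / 8 = D * (1 / 8) := by rw [mul_one_div]
    _ ≤ D * ∫⁻ X, min (a X) (b X) ∂ν := by gcongr
    _ = ∫⁻ X, D * min (a X) (b X) ∂ν := (lintegral_const_mul _ (ham.min hbm)).symm
    _ ≤ _ := by
        refine lintegral_mono fun X => ?_
        calc D * min (a X) (b X) ≤ (l X + l' X) * min (a X) (b X) := by gcongr; exact hD X
          _ = min (a X) (b X) * l X + min (a X) (b X) * l' X := by ring
          _ ≤ _ := by
              simp only [Pi.mul_apply]
              gcongr
              · exact min_le_left _ _
              · exact min_le_right _ _

end TwoPoint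

/-! ### Assouad's lemma -/

section Assouad
variable {d n m : ℕ}

/-- Changes the dominating measure to Lebesgue measure on `Q`, a probability measure when `Q` has
unit volume, as the two-point bound requires. -/
theorem sampleLaw_eq_pi_restrict {Q : Set (EuclideanSpace ℝ (Fin d))} (hQ : MeasurableSet Q)
    {f : EuclideanSpace ℝ (Fin d) → ℝ} (hf : ∀ x ∉ Q, f x = 0) :
    sampleLaw n f = Measure.pi fun _ : Fin n =>
      (volume.restrict Q).withDensity fun x => ENNReal.ofReal (f x) := by
  have h : (fun x => ENNReal.ofReal (f x)) = Q.indicator fun x => ENNReal.ofReal (f x) := by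
    ext x
    by_cases hx : x ∈ Q
    · rw [Set.indicator_of_mem hx]
    · rw [Set.indicator_of_notMem hx, hf x hx, ENNReal.ofReal_zero]
  rw [← withDensity_indicator hQ, ← h, sampleLaw]

theorem sum_setLIntegral_le_two_mul_tvDist {R : Fin m → Set (EuclideanSpace ℝ (Fin d))}
    (hR : ∀ i, MeasurableSet (R i)) (hdisj : Pairwise (Function.onFun Disjoint R))
    (p q : EuclideanSpace ℝ (Fin d) → ℝ) :
    ∑ i, ∫⁻ x in R i, ENNReal.ofReal |p x - q x| ≤ 2 * tvDist p q := by
  rw [tvDist, ENNReal.mul_div_cancel (by norm_num) (by norm_num)]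
  calc ∑ i, ∫⁻ x in R i, ENNReal.ofReal |p x - q x|
      = ∫⁻ x in ⋃ i, R i, ENNReal.ofReal |p x - q x| := by
        rw [lintegral_iUnion hR hdisj, tsum_fintype]
    _ ≤ _ := setLIntegral_le_lintegral _ _

theorem flip_involutive (i : Fin m) :
    Function.Involutive fun ω : Fin m → Bool => Function.update ω i (!ω i) := fun ω => by
  simp

/-- Assouad's lemma for total variation, over a hypercube of densities supported on a set of unit
volume, bounded below there, and perturbed on disjoint regions. -/
theorem assouad_le_riskTV (hn : 0 < n) {Q : Set (EuclideanSpace ℝ (Fin d))}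
    (hQ : MeasurableSet Q) (hQ1 : volume Q = 1)
    (f : (Fin m → Bool) → EuclideanSpace ℝ (Fin d) → ℝ)
    (hfm : ∀ ω, Measurable (f ω)) (hfn : ∀ ω x, 0 ≤ f ω x) (hfQ : ∀ ω, ∀ x ∉ Q, f ω x = 0)
    (hhalf : ∀ ω, ∀ x ∈ Q, 1 / 2 ≤ f ω x) (hfi : ∀ ω, Integrable (f ω))
    (hf1 : ∀ ω, ∫ x, f ω x = 1)
    (hsqi : ∀ ω i, Integrable fun x => (f ω x - f (Function.update ω i (!ω i)) x) ^ 2)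
    (hsq : ∀ ω i, ∫ x, (f ω x - f (Function.update ω i (!ω i)) x) ^ 2 ≤ 2 / n)
    {R : Fin m → Set (EuclideanSpace ℝ (Fin d))} (hR : ∀ i, MeasurableSet (R i))
    (hdisj : Pairwise (Function.onFun Disjoint R)) {D : ℝ≥0∞}
    (hD : ∀ ω i, D ≤ ∫⁻ x in R i, ENNReal.ofReal |f ω x - f (Function.update ω i (!ω i)) x|)
    {F : Set (EuclideanSpace ℝ (Fin d) → ℝ)} (hF : ∀ ω, f ω ∈ F) (est : Estimator d n) :
    m * D / 32 ≤ riskTV est F := by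
  set flip : Fin m → (Fin m → Bool) → Fin m → Bool := fun i ω => Function.update ω i (!ω i)
  set L : Fin m → (Fin m → Bool) → (Fin n → EuclideanSpace ℝ (Fin d)) → ℝ≥0∞ := fun i ω X =>
    ∫⁻ x in R i, ENNReal.ofReal |est.toFun X x - f ω x| with hL
  have hLm : ∀ i ω, Measurable (L i ω) := fun i ω => by
    have h : Measurable fun z : (Fin n → EuclideanSpace ℝ (Fin d)) × EuclideanSpace ℝ (Fin d) =>
        ENNReal.ofReal |est.toFun z.1 z.2 - f ω z.2| := by
      have h1 : Measurable fun z : (Fin n → EuclideanSpace ℝ (Fin d)) ×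
          EuclideanSpace ℝ (Fin d) => est.toFun z.1 z.2 - f ω z.2 :=
        est.measurable_uncurry.sub ((hfm ω).comp measurable_snd)
      exact (continuous_abs.measurable.comp h1).ennreal_ofReal
    exact h.lintegral_prod_right'
  set A : Fin m → (Fin m → Bool) → ℝ≥0∞ := fun i ω => ∫⁻ X, L i ω X ∂(sampleLaw n (f ω)) with hA
  have hμ : IsProbabilityMeasure (volume.restrict Q) := ⟨by simp [hQ1]⟩
  have hset : ∀ g : EuclideanSpace ℝ (Fin d) → ℝ, (∀ x ∉ Q, g x = 0) →
      ∫ x in Q, g x = ∫ x, g x := fun g hg =>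
    setIntegral_eq_integral_of_forall_compl_eq_zero hg
  have hpair : ∀ i ω, D / 8 ≤ A i ω + A i (flip i ω) := fun i ω => by
    simp only [hA]
    rw [sampleLaw_eq_pi_restrict hQ (hfQ ω), sampleLaw_eq_pi_restrict hQ (hfQ (flip i ω))]
    refine le_add_lintegral_pi_of_affinity hn (volume.restrict Q) (hfm _) (hfm _) (hfn _) (hfn _)
      ?_ ?_ (hfi _).restrict (hfi _).restrict ?_ ?_ (hsqi ω i).restrict ?_ (hLm _ _) (hLm _ _) ?_
    · filter_upwards [ae_restrict_mem hQ] with x hx using hhalf _ x hx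
    · filter_upwards [ae_restrict_mem hQ] with x hx using hhalf _ x hx
    · rw [hset _ (hfQ _), hf1]
    · rw [hset _ (hfQ _), hf1]
    · rw [hset _ fun x hx => by rw [hfQ _ x hx, hfQ _ x hx]; norm_num]
      exact hsq ω i
    · intro X
      refine (hD ω i).trans ?_
      simp only [hL]
      have hm : Measurable fun x => ENNReal.ofReal |est.toFun X x - f ω x| := by
        have h1 : Measurable fun x => est.toFun X x - f ω x :=
          (est.measurable_uncurry.comp measurable_prodMk_left).sub (hfm ω)
        exact (continuous_abs.measurable.comp h1).ennreal_ofReal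
      rw [← lintegral_add_left hm]
      refine lintegral_mono fun x => ?_
      rw [← ENNReal.ofReal_add (abs_nonneg _) (abs_nonneg _)]
      refine ENNReal.ofReal_le_ofReal ?_
      rw [abs_sub_comm (est.toFun X x) (f ω x)]
      exact abs_sub_le _ _ _
  have hrisk : ∀ ω, ∑ i, A i ω ≤ 2 * riskTV est F := fun ω => by
    simp only [hA]
    rw [← lintegral_finsetSum _ fun i _ => hLm i ω]
    calc ∫⁻ X, ∑ i, L i ω X ∂(sampleLaw n (f ω))
        ≤ ∫⁻ X, 2 * tvDist (est.toFun X) (f ω) ∂(sampleLaw n (f ω)) :=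
          lintegral_mono fun X => sum_setLIntegral_le_two_mul_tvDist hR hdisj _ _
      _ = 2 * ∫⁻ X, tvDist (est.toFun X) (f ω) ∂(sampleLaw n (f ω)) :=
          lintegral_const_mul' _ _ (by norm_num)
      _ ≤ 2 * riskTV est F := by
          gcongr
          exact le_iSup₂_of_le (f ω) (hF ω) le_rfl
  -- Flipping one bit permutes the hypercube, so summing the pair bounds counts every local loss
  -- twice.
  have hflip : ∀ i, ∑ ω, A i (flip i ω) = ∑ ω, A i ω := fun i =>
    Equiv.sum_comp (flip_involutive i).toPerm (A i)
  have hN : (Fintype.card (Fin m → Bool) : ℝ≥0∞) ≠ 0 := by simp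
  have hNt : (Fintype.card (Fin m → Bool) : ℝ≥0∞) ≠ ⊤ := ENNReal.natCast_ne_top _
  set N : ℝ≥0∞ := (Fintype.card (Fin m → Bool) : ℝ≥0∞)
  have hkey : N * (m * (D / 8)) ≤ N * (4 * riskTV est F) := by
    calc N * (m * (D / 8)) = ∑ i : Fin m, ∑ _ω : Fin m → Bool, D / 8 := by
          simp only [Finset.sum_const, Finset.card_univ, Fintype.card_fin, nsmul_eq_mul]
          ring
      _ ≤ ∑ i, ∑ ω, (A i ω + A i (flip i ω)) := by
          gcongr with i _ ω _
          exact hpair i ω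
      _ = 2 * ∑ ω, ∑ i, A i ω := by
          rw [Finset.sum_comm (s := Finset.univ (α := Fin m → Bool)), Finset.mul_sum]
          refine Finset.sum_congr rfl fun i _ => ?_
          rw [Finset.sum_add_distrib, hflip, two_mul]
      _ ≤ 2 * ∑ _ω : Fin m → Bool, 2 * riskTV est F := by
          gcongr with ω _
          exact hrisk ω
      _ = N * (4 * riskTV est F) := by
          rw [Finset.sum_const, Finset.card_univ, nsmul_eq_mul]
          ring
  rw [ENNReal.mul_le_mul_iff_right hN hNt] at hkey
  have h32 : (m : ℝ≥0∞) * D / 32 = m * (D / 8) / 4 := by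
    have : (32 : ℝ≥0∞)⁻¹ = 8⁻¹ * 4⁻¹ := by
      rw [← ENNReal.mul_inv (by norm_num) (by norm_num)]
      norm_num
    simp only [div_eq_mul_inv, this]
    ring
  rw [h32]
  exact ENNReal.div_le_of_le_mul' hkey

end Assouad

/-! ### Cubes, balls and packings -/

section Cube
variable {d : ℕ}

/-- The cube `[a, b]^d`. -/
def cube (d : ℕ) (a b : ℝ) : Set (EuclideanSpace ℝ (Fin d)) := {x | ∀ i, x i ∈ Set.Icc a b}

theorem cube_eq_preimage (a b : ℝ) :
    cube d a b = WithLp.ofLp ⁻¹' (Set.univ.pi fun _ : Fin d => Set.Icc a b) := by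
  ext x
  simp only [cube, Set.mem_preimage, Set.mem_univ_pi]
  rfl

theorem isClosed_cube (a b : ℝ) : IsClosed (cube d a b) := by
  rw [cube_eq_preimage]
  exact (isClosed_set_pi fun _ _ => isClosed_Icc).preimage (PiLp.continuous_ofLp 2 _)

theorem measurableSet_cube (a b : ℝ) : MeasurableSet (cube d a b) :=
  (isClosed_cube a b).measurableSet

theorem volume_cube (a b : ℝ) : volume (cube d a b) = ENNReal.ofReal (b - a) ^ d := by
  rw [cube_eq_preimage, (PiLp.volume_preserving_ofLp (Fin d)).measure_preimage
    (MeasurableSet.univ_pi fun _ => measurableSet_Icc).nullMeasurableSet, volume_pi_pi]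
  simp

theorem convex_cube (a b : ℝ) : Convex ℝ (cube d a b) := by
  intro x hx y hy s t hs ht hst i
  have := (convex_Icc a b) (hx i) (hy i) hs ht hst
  simpa using this

theorem norm_sq_le_of_mem_cube {x : EuclideanSpace ℝ (Fin d)} (hx : x ∈ cube d 0 1) :
    ‖x‖ ^ 2 ≤ d := by
  rw [EuclideanSpace.norm_sq_eq]
  calc ∑ i, ‖x i‖ ^ 2 ≤ ∑ _i : Fin d, (1 : ℝ) := by
        refine Finset.sum_le_sum fun i _ => ?_
        have h := hx i
        rw [Real.norm_of_nonneg h.1]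
        exact pow_le_one₀ h.1 h.2
    _ = d := by simp

theorem isBounded_cube : Bornology.IsBounded (cube d 0 1) := by
  refine (Metric.isBounded_closedBall (x := 0) (r := Real.sqrt d)).subset fun x hx => ?_
  rw [mem_closedBall_zero_iff]
  exact Real.le_sqrt_of_sq_le (norm_sq_le_of_mem_cube hx)

theorem abs_apply_sub_le_dist (x y : EuclideanSpace ℝ (Fin d)) (i : Fin d) :
    |x i - y i| ≤ dist x y := by
  rw [dist_eq_norm]
  simpa using PiLp.norm_apply_le (x - y) i

theorem ball_subset_cube {c : EuclideanSpace ℝ (Fin d)} {r a b : ℝ}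
    (hc : ∀ i, a + r ≤ c i ∧ c i ≤ b - r) : Metric.ball c r ⊆ cube d a b := fun x hx i => by
  have h := abs_le.1 ((abs_apply_sub_le_dist x c i).trans (Metric.mem_ball.1 hx).le)
  constructor <;> linarith [(hc i).1, (hc i).2, h.1, h.2]

theorem volumeReal_ball (c : EuclideanSpace ℝ (Fin d)) {r : ℝ} (hr : 0 < r) :
    volume.real (Metric.ball c r) =
      r ^ d * volume.real (Metric.ball (0 : EuclideanSpace ℝ (Fin d)) 1) := by
  rw [measureReal_def, Measure.addHaar_ball_of_pos _ _ hr, ENNReal.toReal_mul,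
    ENNReal.toReal_ofReal (by positivity), finrank_euclideanSpace_fin, measureReal_def]

theorem volumeReal_ball_one_le :
    volume.real (Metric.ball (0 : EuclideanSpace ℝ (Fin d)) 1) ≤ 2 ^ d := by
  have h : Metric.ball (0 : EuclideanSpace ℝ (Fin d)) 1 ⊆ cube d (-1) 1 :=
    ball_subset_cube fun i => by simp
  have h2 : volume (cube d (-1) 1) = 2 ^ d := by
    rw [volume_cube]; norm_num
  refine (measureReal_mono h (by rw [h2]; finiteness)).trans (le_of_eq ?_)
  rw [measureReal_def, h2]; simp

/-- A maximal `δ`-separated subset is also a `δ`-net, so its closed `δ`-balls cover `s`; compactness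
makes it finite. -/
theorem exists_separated_volumeReal_le {s : Set (EuclideanSpace ℝ (Fin d))} (hs : IsCompact s)
    {δ : ℝ} (hδ : 0 < δ) :
    ∃ (m : ℕ) (c : Fin m → EuclideanSpace ℝ (Fin d)), (∀ i, c i ∈ s) ∧
      (∀ i j, i ≠ j → δ ≤ dist (c i) (c j)) ∧
      volume.real s ≤ m * (δ ^ d * volume.real (Metric.ball (0 : EuclideanSpace ℝ (Fin d)) 1)) := by
  set ε : NNReal := ⟨δ, hδ.le⟩
  have hε2 : ε / 2 ≠ 0 := by
    have : ε ≠ 0 := fun h => hδ.ne' (congrArg NNReal.toReal h)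
    positivity
  have hpack : Metric.packingNumber ε s ≠ ⊤ := by
    obtain ⟨N, -, hN, hcov⟩ := Metric.exists_finite_isCover_of_isCompact hε2 hs
    have h1 := (Metric.packingNumber_two_mul_le_externalCoveringNumber (ε / 2) s).trans
      hcov.externalCoveringNumber_le_encard
    rw [mul_div_cancel₀ ε two_ne_zero] at h1
    exact (h1.trans_lt hN.encard_lt_top).ne
  set T := Metric.maximalSeparatedSet ε s
  have hT : T.Finite := by
    rw [← Set.encard_lt_top_iff, Metric.encard_maximalSeparatedSet hpack]
    exact lt_top_iff_ne_top.2 hpack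
  have hcov : s ⊆ ⋃ y ∈ T, Metric.closedBall y δ :=
    Metric.isCover_iff_subset_iUnion_closedBall.1 (Metric.isCover_maximalSeparatedSet hpack)
  have : Fintype T := hT.fintype
  let e := Fintype.equivFin T
  refine ⟨Fintype.card T, fun i => (e.symm i : EuclideanSpace ℝ (Fin d)), fun i =>
    Metric.maximalSeparatedSet_subset (e.symm i).2, fun i j hij => ?_, ?_⟩
  · have h := Metric.isSeparated_maximalSeparatedSet (e.symm i).2 (e.symm j).2
      fun h => hij (e.symm.injective (Subtype.ext h))
    simp only [edist_nndist, ENNReal.coe_lt_coe] at h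
    exact (NNReal.coe_lt_coe.2 h).le
  · have h1 : s ⊆ ⋃ i : Fin (Fintype.card T),
        Metric.closedBall (e.symm i : EuclideanSpace ℝ (Fin d)) δ := fun x hx => by
      obtain ⟨y, hy, hxy⟩ := Set.mem_iUnion₂.1 (hcov hx)
      exact Set.mem_iUnion.2 ⟨e ⟨y, hy⟩, by simpa using hxy⟩
    calc volume.real s ≤ volume.real (⋃ i : Fin (Fintype.card T),
          Metric.closedBall (e.symm i : EuclideanSpace ℝ (Fin d)) δ) :=
          measureReal_mono h1 (isCompact_iUnion fun i => isCompact_closedBall _ _).measure_lt_top.ne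
      _ ≤ ∑ i : Fin (Fintype.card T),
          volume.real (Metric.closedBall (e.symm i : EuclideanSpace ℝ (Fin d)) δ) :=
          measureReal_iUnion_fintype_le _
      _ = _ := by
          have h2 : ∀ x : EuclideanSpace ℝ (Fin d), volume.real (Metric.closedBall x δ) =
              δ ^ d * volume.real (Metric.ball (0 : EuclideanSpace ℝ (Fin d)) 1) := fun x => by
            rw [measureReal_def, Measure.addHaar_closedBall _ _ hδ.le, ENNReal.toReal_mul,
              ENNReal.toReal_ofReal (by positivity), finrank_euclideanSpace_fin, measureReal_def]
          simp only [h2, Finset.sum_const, Finset.card_univ, Fintype.card_fin, nsmul_eq_mul]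

end Cube

/-! ### Quadratic bumps -/

section QuadBump
variable {d : ℕ} {r : ℝ}

/-- The quadratic bump of radius `r` centred at `c`. -/
noncomputable def quadBump (r : ℝ) (c x : EuclideanSpace ℝ (Fin d)) : ℝ :=
  max (r ^ 2 - ‖x - c‖ ^ 2) 0

theorem quadBump_nonneg (r : ℝ) (c x : EuclideanSpace ℝ (Fin d)) : 0 ≤ quadBump r c x :=
  le_max_right _ _

theorem quadBump_le (r : ℝ) (c x : EuclideanSpace ℝ (Fin d)) : quadBump r c x ≤ r ^ 2 :=
  max_le (by linarith [sq_nonneg ‖x - c‖]) (sq_nonneg _)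

theorem quadBump_of_notMem (hr : 0 ≤ r) {c x : EuclideanSpace ℝ (Fin d)}
    (hx : x ∉ Metric.ball c r) : quadBump r c x = 0 := by
  rw [Metric.mem_ball, not_lt, dist_eq_norm] at hx
  exact max_eq_right (by nlinarith)

theorem quadBump_of_mem {c x : EuclideanSpace ℝ (Fin d)} (hx : x ∈ Metric.ball c r) :
    quadBump r c x = r ^ 2 - ‖x - c‖ ^ 2 := by
  rw [mem_ball_iff_norm] at hx
  exact max_eq_left (by nlinarith [norm_nonneg (x - c)])

theorem continuous_quadBump (r : ℝ) (c : EuclideanSpace ℝ (Fin d)) : Continuous (quadBump r c) := by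
  unfold quadBump; fun_prop

theorem integrable_quadBump (hr : 0 ≤ r) (c : EuclideanSpace ℝ (Fin d)) :
    Integrable (quadBump r c) :=
  (continuous_quadBump r c).integrable_of_hasCompactSupport <|
    HasCompactSupport.intro (isCompact_closedBall c r) fun _ hx =>
      quadBump_of_notMem hr fun h => hx (Metric.ball_subset_closedBall h)

theorem integral_quadBump_eq (r : ℝ) (c : EuclideanSpace ℝ (Fin d)) :
    ∫ x, quadBump r c x = ∫ x : EuclideanSpace ℝ (Fin d), quadBump r 0 x := by
  rw [← integral_sub_right_eq_self (fun x => quadBump r 0 x) c]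
  simp [quadBump]

theorem integral_quadBump_le (hr : 0 < r) (c : EuclideanSpace ℝ (Fin d)) :
    ∫ x, quadBump r c x ≤
      r ^ 2 * (r ^ d * volume.real (Metric.ball (0 : EuclideanSpace ℝ (Fin d)) 1)) := by
  have hi : Integrable ((Metric.ball c r).indicator fun _ => r ^ 2) :=
    (integrable_indicator_iff measurableSet_ball).2
      (integrableOn_const measure_ball_lt_top.ne)
  calc ∫ x, quadBump r c x ≤ ∫ x, (Metric.ball c r).indicator (fun _ => r ^ 2) x := by
        refine integral_mono (integrable_quadBump hr.le c) hi fun x => ?_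
        by_cases hx : x ∈ Metric.ball c r
        · rw [Set.indicator_of_mem hx]; exact quadBump_le r c x
        · rw [Set.indicator_of_notMem hx, quadBump_of_notMem hr.le hx]
    _ = _ := by
        rw [integral_indicator measurableSet_ball, setIntegral_const, volumeReal_ball c hr,
          smul_eq_mul, mul_comm]

theorem le_integral_quadBump (hr : 0 < r) (c : EuclideanSpace ℝ (Fin d)) :
    3 / 4 * r ^ 2 *
      ((r / 2) ^ d * volume.real (Metric.ball (0 : EuclideanSpace ℝ (Fin d)) 1)) ≤
      ∫ x, quadBump r c x := by
  have hi : Integrable ((Metric.ball c (r / 2)).indicator fun _ => 3 / 4 * r ^ 2) :=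
    (integrable_indicator_iff measurableSet_ball).2
      (integrableOn_const measure_ball_lt_top.ne)
  calc _ = ∫ x, (Metric.ball c (r / 2)).indicator (fun _ => 3 / 4 * r ^ 2) x := by
        rw [integral_indicator measurableSet_ball, setIntegral_const,
          volumeReal_ball c (half_pos hr), smul_eq_mul, mul_comm]
    _ ≤ _ := by
        refine integral_mono hi (integrable_quadBump hr.le c) fun x => ?_
        by_cases hx : x ∈ Metric.ball c (r / 2)
        · rw [Set.indicator_of_mem hx]
          refine le_trans ?_ (le_max_left _ _)
          rw [mem_ball_iff_norm] at hx
          nlinarith [norm_nonneg (x - c)]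
        · rw [Set.indicator_of_notMem hx]; exact quadBump_nonneg r c x

variable {m : ℕ} {c : Fin m → EuclideanSpace ℝ (Fin d)}

theorem sum_quadBump_eq_of_mem (hr : 0 ≤ r)
    (hc : Pairwise (Function.onFun Disjoint fun i => Metric.ball (c i) r))
    {x : EuclideanSpace ℝ (Fin d)} {k : Fin m} (hx : x ∈ Metric.ball (c k) r) :
    ∑ i, quadBump r (c i) x = quadBump r (c k) x :=
  Finset.sum_eq_single k (fun i _ hik => quadBump_of_notMem hr fun h =>
    Set.disjoint_left.1 (hc hik) h hx) (by simp)

theorem sum_quadBump_eq_zero (hr : 0 ≤ r) {x : EuclideanSpace ℝ (Fin d)}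
    (hx : ∀ k, x ∉ Metric.ball (c k) r) : ∑ i, quadBump r (c i) x = 0 :=
  Finset.sum_eq_zero fun i _ => quadBump_of_notMem hr (hx i)

theorem sum_quadBump_le (hr : 0 ≤ r)
    (hc : Pairwise (Function.onFun Disjoint fun i => Metric.ball (c i) r))
    (x : EuclideanSpace ℝ (Fin d)) : ∑ i, quadBump r (c i) x ≤ r ^ 2 := by
  by_cases hx : ∃ k, x ∈ Metric.ball (c k) r
  · obtain ⟨k, hk⟩ := hx
    rw [sum_quadBump_eq_of_mem hr hc hk]
    exact quadBump_le _ _ _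
  · push Not at hx
    rw [sum_quadBump_eq_zero hr hx]
    positivity

/-- Adding quadratic bumps with disjoint supports to `‖x‖²` makes it affine on each support and
keeps it convex. -/
theorem convexOn_norm_sq_add_sum_quadBump (hr : 0 ≤ r)
    (hc : Pairwise (Function.onFun Disjoint fun i => Metric.ball (c i) r)) :
    ConvexOn ℝ Set.univ fun x => ‖x‖ ^ 2 + ∑ i, quadBump r (c i) x := by
  refine ⟨convex_univ, fun x _ y _ s t hs ht hst => ?_⟩
  simp only [smul_eq_mul]
  have hnn : ∀ z, 0 ≤ ∑ i, quadBump r (c i) z := fun z =>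
    Finset.sum_nonneg fun i _ => quadBump_nonneg _ _ _
  by_cases hz : ∃ k, s • x + t • y ∈ Metric.ball (c k) r
  · obtain ⟨k, hk⟩ := hz
    rw [sum_quadBump_eq_of_mem hr hc hk, quadBump_of_mem hk]
    -- On the ball `k` the function agrees with an affine function that minorizes it everywhere, a
    -- supporting hyperplane; off the balls `‖x‖ ^ 2` plays this role.
    have hge : ∀ z, r ^ 2 - ‖z - c k‖ ^ 2 ≤ ∑ i, quadBump r (c i) z := fun z =>
      (le_max_left _ _).trans
        (Finset.single_le_sum (f := fun i => quadBump r (c i) z)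
          (fun i _ => quadBump_nonneg _ _ _) (Finset.mem_univ k))
    have haff : ∀ z : EuclideanSpace ℝ (Fin d),
        ‖z‖ ^ 2 + (r ^ 2 - ‖z - c k‖ ^ 2) = r ^ 2 + 2 * inner ℝ z (c k) - ‖c k‖ ^ 2 := fun z => by
      rw [norm_sub_sq_real]; ring
    have hx := mul_le_mul_of_nonneg_left (hge x) hs
    have hy := mul_le_mul_of_nonneg_left (hge y) ht
    have hx' := congrArg (s * ·) (haff x)
    have hy' := congrArg (t * ·) (haff y)
    rw [haff, inner_add_left, real_inner_smul_left, real_inner_smul_left]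
    have hone : r ^ 2 - ‖c k‖ ^ 2 = (s + t) * (r ^ 2 - ‖c k‖ ^ 2) := by rw [hst, one_mul]
    linarith
  · push Not at hz
    rw [sum_quadBump_eq_zero hr hz]
    have h := (convexOn_univ_norm (E := EuclideanSpace ℝ (Fin d))).pow
      (fun x _ => norm_nonneg x) 2
    have h2 := h.2 (Set.mem_univ x) (Set.mem_univ y) hs ht hst
    simp only [Pi.pow_apply, smul_eq_mul] at h2
    have hx := mul_nonneg hs (hnn x)
    have hy := mul_nonneg ht (hnn y)
    linarith

end QuadBump

/-! ### Log-concave densities with bumps on the unit cube -/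

section BumpDensity
variable {d m : ℕ} {b r : ℝ}

/-- A quadratic density on the unit cube, with quadratic bumps at the points `c i` subtracted. -/
noncomputable def bumpDensity (b r : ℝ) (c : Fin m → EuclideanSpace ℝ (Fin d)) :
    EuclideanSpace ℝ (Fin d) → ℝ :=
  (cube d 0 1).indicator fun x =>
    1 + b * (∫ y in cube d 0 1, ‖y‖ ^ 2) +
      b * (m * ∫ y : EuclideanSpace ℝ (Fin d), quadBump r 0 y) -
      b * (‖x‖ ^ 2 + ∑ i, quadBump r (c i) x)

variable {c : Fin m → EuclideanSpace ℝ (Fin d)}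

theorem volume_unitCube : volume (cube d 0 1) = 1 := by simp [volume_cube]

theorem measurable_bumpDensity : Measurable (bumpDensity b r c) := by
  refine Measurable.indicator ?_ (measurableSet_cube 0 1)
  have : Continuous fun x : EuclideanSpace ℝ (Fin d) => ∑ i, quadBump r (c i) x :=
    continuous_finsetSum _ fun i _ => continuous_quadBump r (c i)
  fun_prop

theorem bumpDensity_of_notMem {x : EuclideanSpace ℝ (Fin d)} (hx : x ∉ cube d 0 1) :
    bumpDensity b r c x = 0 := Set.indicator_of_notMem hx _

theorem half_le_bumpDensity (hb : 0 ≤ b) (hbd : b * (d + 1) ≤ 1 / 2) (hr : 0 ≤ r) (hr1 : r ≤ 1)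
    (hc : Pairwise (Function.onFun Disjoint fun i => Metric.ball (c i) r))
    {x : EuclideanSpace ℝ (Fin d)} (hx : x ∈ cube d 0 1) : 1 / 2 ≤ bumpDensity b r c x := by
  rw [bumpDensity, Set.indicator_of_mem hx]
  have h1 : 0 ≤ b * ∫ y in cube d 0 1, ‖y‖ ^ 2 :=
    mul_nonneg hb (integral_nonneg fun y => by positivity)
  have h2 : 0 ≤ b * (m * ∫ y : EuclideanSpace ℝ (Fin d), quadBump r 0 y) :=
    mul_nonneg hb (mul_nonneg (by positivity) (integral_nonneg fun y => quadBump_nonneg _ _ _))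
  have h3 : ∑ i, quadBump r (c i) x ≤ 1 :=
    (sum_quadBump_le hr hc x).trans (pow_le_one₀ hr hr1)
  have h4 := mul_le_mul_of_nonneg_left (add_le_add (norm_sq_le_of_mem_cube hx) h3) hb
  linarith

theorem bumpDensity_nonneg (hb : 0 ≤ b) (hbd : b * (d + 1) ≤ 1 / 2) (hr : 0 ≤ r) (hr1 : r ≤ 1)
    (hc : Pairwise (Function.onFun Disjoint fun i => Metric.ball (c i) r))
    (x : EuclideanSpace ℝ (Fin d)) : 0 ≤ bumpDensity b r c x := by
  by_cases hx : x ∈ cube d 0 1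
  · linarith [half_le_bumpDensity hb hbd hr hr1 hc hx]
  · exact (bumpDensity_of_notMem hx).ge

theorem integrableOn_norm_sq_unitCube :
    IntegrableOn (fun x : EuclideanSpace ℝ (Fin d) => ‖x‖ ^ 2) (cube d 0 1) :=
  (continuous_norm.pow 2).continuousOn.integrableOn_compact
    (Metric.isCompact_of_isClosed_isBounded (isClosed_cube 0 1) isBounded_cube)

theorem integrableOn_const_unitCube (a : ℝ) :
    IntegrableOn (fun _ : EuclideanSpace ℝ (Fin d) => a) (cube d 0 1) :=
  integrableOn_const (by rw [volume_unitCube]; finiteness)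

theorem integrableOn_norm_sq_add_sum_quadBump (hr : 0 ≤ r) :
    IntegrableOn (fun x => ‖x‖ ^ 2 + ∑ i, quadBump r (c i) x) (cube d 0 1) :=
  integrableOn_norm_sq_unitCube.add
    (integrable_finsetSum _ fun i _ => integrable_quadBump hr (c i)).integrableOn

theorem integrable_bumpDensity (hr : 0 ≤ r) : Integrable (bumpDensity b r c) :=
  (integrable_indicator_iff (measurableSet_cube 0 1)).2 <|
    (integrableOn_const_unitCube _).sub ((integrableOn_norm_sq_add_sum_quadBump hr).const_mul b)

/-- All bumps have the same integral and lie inside the cube, so the normalizing constant does not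
depend on the centers and moving a bump keeps the mass. -/
theorem integral_bumpDensity (hr : 0 ≤ r) (hcube : ∀ i, Metric.ball (c i) r ⊆ cube d 0 1) :
    ∫ x, bumpDensity b r c x = 1 := by
  have hsum : IntegrableOn (fun x => ∑ i, quadBump r (c i) x) (cube d 0 1) :=
    (integrable_finsetSum _ fun i _ => integrable_quadBump hr (c i)).integrableOn
  have hone : volume.real (cube d 0 1) = 1 := by rw [measureReal_def, volume_unitCube]; rfl
  have hb : ∀ i, ∫ x in cube d 0 1, quadBump r (c i) x =
      ∫ x : EuclideanSpace ℝ (Fin d), quadBump r 0 x := fun i => by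
    rw [← integral_quadBump_eq r (c i)]
    exact setIntegral_eq_integral_of_forall_compl_eq_zero fun x hx =>
      quadBump_of_notMem hr fun h => hx (hcube i h)
  rw [bumpDensity, integral_indicator (measurableSet_cube 0 1), integral_sub
    (integrableOn_const_unitCube _) ((integrableOn_norm_sq_add_sum_quadBump hr).const_mul b),
    setIntegral_const, hone, integral_const_mul, integral_add integrableOn_norm_sq_unitCube hsum,
    integral_finsetSum _ fun i _ => (integrable_quadBump hr (c i)).integrableOn]
  simp only [hb, Finset.sum_const, Finset.card_univ, Fintype.card_fin, nsmul_eq_mul, smul_eq_mul]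
  ring

/-- The density is concave and positive on the convex cube and zero elsewhere, so log-concavity
follows from the weighted arithmetic-geometric mean inequality. -/
theorem bumpDensity_mem_logConcaveDensities (hb : 0 ≤ b) (hbd : b * (d + 1) ≤ 1 / 2) (hr : 0 ≤ r)
    (hr1 : r ≤ 1) (hc : Pairwise (Function.onFun Disjoint fun i => Metric.ball (c i) r))
    (hcube : ∀ i, Metric.ball (c i) r ⊆ cube d 0 1) :
    bumpDensity b r c ∈ logConcaveDensities d := by
  have hnn := bumpDensity_nonneg hb hbd hr hr1 hc
  refine ⟨⟨measurable_bumpDensity.aemeasurable, hnn, ?_⟩, fun x y t ht ht1 => ?_⟩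
  · rw [← ofReal_integral_eq_lintegral_ofReal (integrable_bumpDensity hr) (ae_of_all _ hnn),
      integral_bumpDensity hr hcube, ENNReal.ofReal_one]
  · have ht' : 0 < 1 - t := by linarith
    by_cases hx : x ∈ cube d 0 1
    · by_cases hy : y ∈ cube d 0 1
      · refine (Real.geom_mean_le_arith_mean2_weighted ht.le ht'.le (hnn x) (hnn y)
          (by ring)).trans ?_
        have hz := convex_cube 0 1 hx hy ht.le ht'.le (by ring)
        rw [bumpDensity, Set.indicator_of_mem hx, Set.indicator_of_mem hy,
          Set.indicator_of_mem hz]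
        have h := mul_le_mul_of_nonneg_left ((convexOn_norm_sq_add_sum_quadBump hr hc).2
          (Set.mem_univ x) (Set.mem_univ y) ht.le ht'.le (by ring)) hb
        simp only [smul_eq_mul] at h
        linarith
      · rw [bumpDensity_of_notMem hy, Real.zero_rpow ht'.ne', mul_zero]
        exact hnn _
    · rw [bumpDensity_of_notMem hx, Real.zero_rpow ht.ne', zero_mul]
      exact hnn _

theorem bumpDensity_sub (hr : 0 ≤ r) {c' : Fin m → EuclideanSpace ℝ (Fin d)} {k : Fin m}
    (hcube : Metric.ball (c k) r ⊆ cube d 0 1) (hcube' : Metric.ball (c' k) r ⊆ cube d 0 1)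
    (heq : ∀ i, i ≠ k → c i = c' i) (x : EuclideanSpace ℝ (Fin d)) :
    bumpDensity b r c x - bumpDensity b r c' x =
      b * (quadBump r (c' k) x - quadBump r (c k) x) := by
  by_cases hx : x ∈ cube d 0 1
  · rw [bumpDensity, bumpDensity, Set.indicator_of_mem hx, Set.indicator_of_mem hx]
    have h : ∑ i, quadBump r (c i) x - ∑ i, quadBump r (c' i) x =
        quadBump r (c k) x - quadBump r (c' k) x := by
      rw [← Finset.sum_sub_distrib]
      exact Finset.sum_eq_single k (fun i _ hi => by rw [heq i hi, sub_self]) (by simp)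
    linear_combination (-b) * h
  · rw [bumpDensity_of_notMem hx, bumpDensity_of_notMem hx,
      quadBump_of_notMem hr fun h => hx (hcube h), quadBump_of_notMem hr fun h => hx (hcube' h)]
    ring

end BumpDensity

/-! ### The hypercube of bump densities -/

section Hypercube
variable {d n m : ℕ} {b r : ℝ}

theorem sq_sub_quadBump_le (b r : ℝ) (c c' x : EuclideanSpace ℝ (Fin d)) :
    (b * (quadBump r c' x - quadBump r c x)) ^ 2 ≤
      b ^ 2 * r ^ 2 * (quadBump r c' x + quadBump r c x) := by
  have h1 := quadBump_nonneg r c x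
  have h2 := quadBump_nonneg r c' x
  have h3 := mul_le_mul_of_nonneg_right (quadBump_le r c x) h1
  have h4 := mul_le_mul_of_nonneg_right (quadBump_le r c' x) h2
  have h5 := mul_nonneg h1 h2
  rw [mul_pow, mul_assoc]
  refine mul_le_mul_of_nonneg_left ?_ (sq_nonneg b)
  nlinarith

theorem riskTV_ge_of_centers (hn : 0 < n) (hb : 0 ≤ b) (hbd : b * (d + 1) ≤ 1 / 2) (hr : 0 < r)
    (hr1 : r ≤ 1)
    (hbr : 2 * b ^ 2 * r ^ 2 * ∫ x : EuclideanSpace ℝ (Fin d), quadBump r 0 x ≤ 2 / n)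
    (c : Fin m → Bool → EuclideanSpace ℝ (Fin d))
    (hcube : ∀ i β, Metric.ball (c i β) r ⊆ cube d 0 1)
    (hdisj : ∀ i j β β', (i, β) ≠ (j, β') →
      Disjoint (Metric.ball (c i β) r) (Metric.ball (c j β') r)) (est : Estimator d n) :
    m * ENNReal.ofReal (b * ∫ x : EuclideanSpace ℝ (Fin d), quadBump r 0 x) / 32 ≤
      riskTV est (logConcaveDensities d) := by
  set f : (Fin m → Bool) → EuclideanSpace ℝ (Fin d) → ℝ := fun ω =>
    bumpDensity b r fun i => c i (ω i) with hf
  have hpw : ∀ ω : Fin m → Bool,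
      Pairwise (Function.onFun Disjoint fun i => Metric.ball (c i (ω i)) r) := fun ω i j hij =>
    hdisj i j _ _ fun h => hij (congrArg Prod.fst h)
  have hsub : ∀ ω i x, f ω x - f (Function.update ω i (!ω i)) x =
      b * (quadBump r (c i (!ω i)) x - quadBump r (c i (ω i)) x) := fun ω i x => by
    have h := bumpDensity_sub (b := b) hr.le (c := fun j => c j (ω j))
      (c' := fun j => c j (Function.update ω i (!ω i) j)) (k := i) (hcube _ _) (hcube _ _)
      (fun j hj => by rw [Function.update_of_ne hj]) x
    rwa [Function.update_self] at h
  have hint : ∀ (ω : Fin m → Bool) i, Integrable fun x =>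
      b ^ 2 * r ^ 2 * (quadBump r (c i (!ω i)) x + quadBump r (c i (ω i)) x) := fun ω i =>
    ((integrable_quadBump hr.le _).add (integrable_quadBump hr.le _)).const_mul _
  have hsqi : ∀ ω i, Integrable fun x => (f ω x - f (Function.update ω i (!ω i)) x) ^ 2 := by
    intro ω i
    refine (hint ω i).mono' ((measurable_bumpDensity.sub measurable_bumpDensity).pow_const
      2).aestronglyMeasurable (ae_of_all _ fun x => ?_)
    rw [Real.norm_of_nonneg (sq_nonneg _), hsub]
    exact sq_sub_quadBump_le _ _ _ _ _
  refine assouad_le_riskTV hn (measurableSet_cube 0 1) volume_unitCube f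
    (fun ω => measurable_bumpDensity) (fun ω => bumpDensity_nonneg hb hbd hr.le hr1 (hpw ω))
    (fun ω x hx => bumpDensity_of_notMem hx)
    (fun ω x hx => half_le_bumpDensity hb hbd hr.le hr1 (hpw ω) hx)
    (fun ω => integrable_bumpDensity hr.le) (fun ω => integral_bumpDensity hr.le fun i => hcube _ _)
    hsqi (fun ω i => ?_) (R := fun i => Metric.ball (c i false) r) (fun i => measurableSet_ball)
    (hpw fun _ => false) (fun ω i => ?_)
    (fun ω => bumpDensity_mem_logConcaveDensities hb hbd hr.le hr1 (hpw ω) fun i => hcube _ _) est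
  · calc ∫ x, (f ω x - f (Function.update ω i (!ω i)) x) ^ 2
        ≤ ∫ x, b ^ 2 * r ^ 2 * (quadBump r (c i (!ω i)) x + quadBump r (c i (ω i)) x) := by
          refine integral_mono (hsqi ω i) (hint ω i) fun x => ?_
          simp only [hsub]
          exact sq_sub_quadBump_le _ _ _ _ _
      _ = 2 * b ^ 2 * r ^ 2 * ∫ x : EuclideanSpace ℝ (Fin d), quadBump r 0 x := by
          rw [integral_const_mul, integral_add (integrable_quadBump hr.le _)
            (integrable_quadBump hr.le _), integral_quadBump_eq r (c i (!ω i)),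
            integral_quadBump_eq r (c i (ω i))]
          ring
      _ ≤ 2 / n := hbr
  -- Of the two positions of bump `i` only the `false` ball is tested: whichever way the bit stands,
  -- exactly one of the two densities has a bump there.
  · have habs : ∀ x ∈ Metric.ball (c i false) r,
        |f ω x - f (Function.update ω i (!ω i)) x| = b * quadBump r (c i false) x := by
      intro x hx
      have h0 : quadBump r (c i true) x = 0 := quadBump_of_notMem hr.le fun h =>
        Set.disjoint_left.1 (hdisj i i false true (by simp)) hx h
      rw [hsub]
      have hnn := quadBump_nonneg r (c i false) x
      cases ω i <;> simp [h0, abs_mul, abs_of_nonneg hb, abs_of_nonneg hnn]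
    rw [setLIntegral_congr_fun (g := fun x => ENNReal.ofReal (b * quadBump r (c i false) x))
      measurableSet_ball fun x hx => by simp only [habs x hx]]
    rw [← ofReal_integral_eq_lintegral_ofReal
      ((integrable_quadBump hr.le _).const_mul b).integrableOn
      (ae_of_all _ fun x => mul_nonneg hb (quadBump_nonneg _ _ _)), integral_const_mul,
      setIntegral_eq_integral_of_forall_compl_eq_zero fun x hx => quadBump_of_notMem hr.le hx,
      integral_quadBump_eq r (c i false)]

end Hypercube

/-! ### Packing and the lower rate -/

section LowerBound
variable {d n : ℕ}

theorem exists_disjoint_balls_subset_unitCube (hd : 0 < d) {r : ℝ} (hr : 0 < r) (hr8 : r ≤ 1 / 8) :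
    ∃ (m : ℕ) (c : Fin m → Bool → EuclideanSpace ℝ (Fin d)),
      (∀ i β, Metric.ball (c i β) r ⊆ cube d 0 1) ∧
      (∀ i j β β', (i, β) ≠ (j, β') →
        Disjoint (Metric.ball (c i β) r) (Metric.ball (c j β') r)) ∧
      (1 / 8) ^ d ≤ m * (r ^ d * volume.real (Metric.ball (0 : EuclideanSpace ℝ (Fin d)) 1)) := by
  have hs : IsCompact (cube d (1 / 8) (3 / 8)) := by
    refine Metric.isCompact_of_isClosed_isBounded (isClosed_cube _ _)
      (isBounded_cube.subset fun x hx i => ?_)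
    constructor <;> linarith [(hx i).1, (hx i).2]
  obtain ⟨m, c, hcs, hsep, hvol⟩ := exists_separated_volumeReal_le hs (mul_pos two_pos hr)
  -- The second position of each bump is a translate by `1 / 2` in one coordinate: it stays in the
  -- unit cube and at distance at least `1 / 4 ≥ 2 r` from all first positions.
  set e : EuclideanSpace ℝ (Fin d) := EuclideanSpace.single ⟨0, hd⟩ (1 / 2)
  have he : e ⟨0, hd⟩ = 1 / 2 := by simp [e]
  have he' : ∀ i, 0 ≤ e i ∧ e i ≤ 1 / 2 := fun i => by
    by_cases hi : i = ⟨0, hd⟩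
    · rw [hi, he]; norm_num
    · simp [e, hi]
  have hfar : ∀ i j, r + r ≤ dist (c i) (c j + e) := fun i j => by
    refine le_trans ?_ (abs_apply_sub_le_dist _ _ ⟨0, hd⟩)
    rw [PiLp.add_apply, he]
    refine le_trans ?_ (neg_le_abs _)
    linarith [(hcs i ⟨0, hd⟩).2, (hcs j ⟨0, hd⟩).1]
  refine ⟨m, fun i β => if β then c i + e else c i, fun i β => ball_subset_cube fun j => ?_,
    fun i j β β' h => Metric.ball_disjoint_ball ?_, ?_⟩
  · have h1 := hcs i j
    have h2 := he' j
    cases β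
    · simp only [Bool.false_eq_true, if_false]
      constructor <;> linarith [h1.1, h1.2]
    · simp only [if_true, PiLp.add_apply]
      constructor <;> linarith [h1.1, h1.2, h2.1, h2.2]
  · cases β <;> cases β' <;> simp only [Bool.false_eq_true, if_false, if_true]
    · exact (by linarith : r + r ≤ 2 * r).trans (hsep i j fun hij => h (by rw [hij]))
    · exact hfar i j
    · rw [dist_comm]; exact hfar j i
    · rw [dist_add_right]
      exact (by linarith : r + r ≤ 2 * r).trans (hsep i j fun hij => h (by rw [hij]))
  · have h1 : volume.real (cube d (1 / 8) (3 / 8)) = (1 / 4) ^ d := by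
      rw [measureReal_def, volume_cube, ENNReal.toReal_pow, ENNReal.toReal_ofReal (by norm_num)]
      norm_num
    rw [h1, mul_pow] at hvol
    have h2 : (1 / 4 : ℝ) ^ d = 2 ^ d * (1 / 8) ^ d := by rw [← mul_pow]; norm_num
    rw [h2] at hvol
    refine le_of_mul_le_mul_left (hvol.trans (le_of_eq ?_)) (pow_pos (two_pos (α := ℝ)) d)
    ring

theorem le_minimaxRiskTV (hd : 0 < d) (hn : 0 < n) :
    ENNReal.ofReal ((1 / 2 ^ 20) ^ d * (n : ℝ) ^ (-(2 : ℝ) / ((d : ℝ) + 4))) ≤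
      minimaxRiskTV n (logConcaveDensities d) := by
  refine le_iInf fun est => ?_
  have hd1 : (1 : ℝ) ≤ d := by exact_mod_cast hd
  have hn1 : (1 : ℝ) ≤ n := by exact_mod_cast hn
  -- Flipping a bit changes the density by order `r ^ 4 (2 r) ^ d` in squared `L²` norm, which must
  -- not exceed order `1 / n`; hence `ρ ^ (d + 4) = 1 / n`.
  set ρ : ℝ := (n : ℝ) ^ (-(1 : ℝ) / ((d : ℝ) + 4)) with hρ
  have hρ0 : 0 < ρ := Real.rpow_pos_of_pos (by linarith) _
  have hρ1 : ρ ≤ 1 := Real.rpow_le_one_of_one_le_of_nonpos hn1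
    (div_nonpos_of_nonpos_of_nonneg (by norm_num) (by linarith))
  have hρ2 : (n : ℝ) ^ (-(2 : ℝ) / ((d : ℝ) + 4)) = ρ ^ 2 := by
    rw [hρ, ← Real.rpow_natCast, ← Real.rpow_mul (by linarith)]
    congr 1
    push_cast
    ring
  have hρd : ρ ^ (d + 4) = 1 / n := by
    rw [hρ, ← Real.rpow_natCast, ← Real.rpow_mul (by linarith)]
    push_cast
    rw [div_mul_cancel₀ _ (by linarith), Real.rpow_neg_one, one_div]
  set r : ℝ := ρ / 8 with hr
  have hr0 : 0 < r := by positivity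
  obtain ⟨m, c, hcube, hdisj, hm⟩ :=
    exists_disjoint_balls_subset_unitCube hd hr0 (by linarith : r ≤ 1 / 8)
  set V := volume.real (Metric.ball (0 : EuclideanSpace ℝ (Fin d)) 1)
  have hV : V ≤ 2 ^ d := volumeReal_ball_one_le
  set I := ∫ x : EuclideanSpace ℝ (Fin d), quadBump r 0 x
  have hI : I ≤ r ^ 2 * (r ^ d * V) := integral_quadBump_le hr0 0
  have hI0 : 0 ≤ I := integral_nonneg fun x => quadBump_nonneg r 0 x
  have hI' : 3 / 4 * r ^ 2 * ((r / 2) ^ d * V) ≤ I := le_integral_quadBump hr0 0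
  set b : ℝ := 1 / (4 * d) with hb
  have hb0 : 0 < b := by positivity
  have hb4 : b ≤ 1 / 4 := by
    rw [hb]; exact one_div_le_one_div_of_le (by norm_num) (by linarith)
  have hbd : b * (d + 1) ≤ 1 / 2 := by
    have : b * d = 1 / 4 := by rw [hb]; field_simp
    linarith
  have hbr : 2 * b ^ 2 * r ^ 2 * I ≤ 2 / n := by
    have h1 : b ^ 2 ≤ 1 := pow_le_one₀ hb0.le (by linarith)
    calc 2 * b ^ 2 * r ^ 2 * I ≤ 2 * 1 * r ^ 2 * (r ^ 2 * (r ^ d * 2 ^ d)) := by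
          have h2 : I ≤ r ^ 2 * (r ^ d * 2 ^ d) := hI.trans (by gcongr)
          gcongr
      _ = 2 * (r ^ 4 * (2 * r) ^ d) := by rw [mul_pow]; ring
      _ ≤ 2 * (ρ ^ 4 * ρ ^ d) := by gcongr <;> linarith
      _ = 2 / n := by rw [← pow_add, add_comm 4 d, hρd]; ring
  refine le_trans ?_ (riskTV_ge_of_centers hn hb0.le hbd hr0 (by linarith) hbr c hcube hdisj est)
  rw [← ENNReal.ofReal_natCast m, ← ENNReal.ofReal_mul (Nat.cast_nonneg m),
    ← ENNReal.ofReal_ofNat 32, ← ENNReal.ofReal_div_of_pos (by norm_num), hρ2]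
  refine ENNReal.ofReal_le_ofReal ?_
  have hd2 : (d : ℝ) ≤ 2 ^ d := by exact_mod_cast Nat.lt_two_pow_self.le
  have h15 : (2 : ℝ) ^ 15 ≤ (2 ^ 15) ^ d := le_self_pow₀ (by norm_num) hd.ne'
  -- `2 ^ 15 d` collects the constants of `b`, `r ^ 2` and Assouad's lemma, up to a factor `3`. `16
  -- ^ d` comes from the half-radius balls in the bump integral and from the packing.
  have hpow : (2 ^ 15 : ℝ) * d * 16 ^ d ≤ (2 ^ 20) ^ d := by
    calc (2 ^ 15 : ℝ) * d * 16 ^ d ≤ (2 ^ 15) ^ d * 2 ^ d * 16 ^ d := by gcongr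
      _ = (2 ^ 20) ^ d := by rw [← mul_pow, ← mul_pow]; norm_num
  calc (1 / 2 ^ 20 : ℝ) ^ d * ρ ^ 2 = 1 / (2 ^ 20) ^ d * ρ ^ 2 := by rw [one_div_pow]
    _ ≤ 1 / (2 ^ 15 * d * 16 ^ d) * ρ ^ 2 := by gcongr
    _ ≤ 3 * (1 / (2 ^ 15 * d * 16 ^ d)) * ρ ^ 2 := by
        have : 0 ≤ 1 / (2 ^ 15 * (d : ℝ) * 16 ^ d) * ρ ^ 2 := by positivity
        linarith
    _ = b * (3 / 4 * r ^ 2 * (1 / 2) ^ d * (1 / 8) ^ d) / 32 := by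
        have h16 : (1 / 2 : ℝ) ^ d * (1 / 8) ^ d = 1 / 16 ^ d := by
          rw [← mul_pow, ← one_div_pow]; norm_num
        rw [mul_assoc (3 / 4 * r ^ 2), h16, hb, hr]
        field_simp
        norm_num
    _ ≤ b * (3 / 4 * r ^ 2 * (1 / 2) ^ d * (m * (r ^ d * V))) / 32 := by gcongr
    _ = m * (b * (3 / 4 * r ^ 2 * ((r / 2) ^ d * V))) / 32 := by
        rw [div_eq_mul_one_div r 2, mul_pow]; ring
    _ ≤ m * (b * I) / 32 := by gcongr

end LowerBound

theorem theorem4 :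
    (∀ d : ℕ, 2 ≤ d → ∃ C : ℝ, 0 < C ∧ ∃ N : ℕ, ∀ n : ℕ, N ≤ n →
      ∃ est : Estimator d n,
        (∀ X : Fin n → EuclideanSpace ℝ (Fin d), IsProbDensity (est.toFun X)) ∧
        riskTV est (logConcaveDensities d) ≤
          ENNReal.ofReal
            (C * Real.log (n : ℝ) ^ ((d : ℝ) * ((d : ℝ) + 1) / ((d : ℝ) + 4))
              * (n : ℝ) ^ (-(2 : ℝ) / ((d : ℝ) + 4)))) ∧
    (∃ c : ℝ, 0 < c ∧ ∀ d : ℕ, 2 ≤ d → ∀ n : ℕ, 1 ≤ n →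
      ENNReal.ofReal (c ^ d * (n : ℝ) ^ (-(2 : ℝ) / ((d : ℝ) + 4))) ≤
        minimaxRiskTV n (logConcaveDensities d)) := by
  exact ⟨fun d hd => exists_estimator_riskTV_le hd, 1 / 2 ^ 20, by positivity, fun d hd n hn =>
    le_minimaxRiskTV (Nat.zero_lt_of_lt hd) hn⟩
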